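/- Consider a single-tier downlink cellular network whose base stations form a homogeneous Poisson point process of density $\lambda>0$ in the plane, all with transmit power $P>0$ and path-loss $d\mapsto d^{-\alpha}$ with $\alpha>2$. The mobile terminal at the origin is served by the nearest base station, at distance $d_0$, through a link of power gain $g_0$; the other base stations $b$, at distances $d_b$, have power gains $g_b$, which are i.i.d. All gains are nonnegative with mean one; the laws of $g_0$ and of $g_b$ are otherwise arbitrary and may differ. There are $F_B\ge 1$ frequency bands, every interfering base station picks one of them uniformly at random, and only those in the band of the serving base station interfere. Positions, gains and bands are mutually independent. With noise power $\sigma_N^2\ge 0$, the average rate is $$\mathcal R^{(F_B)}=\frac1{F_B}\,\mathbb E\left\{\ln\left(1+\frac{P g_0 d_0^{-\alpha}}{\sigma_N^2+I}\right)\right\},\qquad I=\sum_{b\text{ non-serving, in the serving band}}P g_b d_b^{-\alpha}.$$ Let $\mathcal M_0(s)=\mathbb E\{e^{-s g_0}\}$, $\mathcal M_I(s)=\mathbb E\{e^{-s g_b}\}$, $\mathcal M_I^{(k)}(s)=\mathbb E\{g_b^{k+1}e^{-s g_b}\}$, $$\mathcal T_I(y)=\Gamma\left(1-\tfrac2\alpha\right)\sum_{k=0}^{\infty}\frac{y^{k+1}\mathcal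 M_I^{(k)}(y)}{\Gamma\left(2-\frac2\alpha+k\right)},$$ $$\mathcal Z_I^{(F_B)}(z)=(F_B-1)+\mathcal M_I(z)+\mathcal T_I(z),\qquad \lambda^{(F_B)}=\lambda/F_B,$$ and, for $\sigma_N^2>0$, $\mathrm{SNR}=P/\sigma_N^2$. Then the interference series converges almost surely, the expectation above is finite, all the series (for $y>0$) and integrals below converge, and the following hold. 1. If $\sigma_N^2>0$, then $\mathcal R^{(F_B)}=\int_0^\infty[1-\mathcal M_0(\mathrm{SNR}\,y)]\,\frac{\mathcal G_I(y)}{y}\,dy$, where $$\mathcal G_I(y)=\frac1{\mathcal Z_I^{(F_B)}(\mathrm{SNR}\,y)}-\frac\alpha2\,\frac{y}{\mathcal Z_I^{(F_B)}(\mathrm{SNR}\,y)}\int_0^\infty\xi^{\frac\alpha2-1}e^{-\pi\lambda^{(F_B)}\mathcal Z_I^{(F_B)}(\mathrm{SNR}\,y)\,\xi}\,e^{-y\xi^{\alpha/2}}\,d\xi .$$ 2. If $\sigma_N^2>0$, then, with all parameters other than $\lambda$ fixed, $$\mathcal R^{(F_B)}\le\lim_{\lambda\to+\infty}\mathcal R^{(F_B)}(\lambda)=\int_0^\infty\frac{1-\mathcal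 M_0(z)}{\mathcal Z_I^{(F_B)}(z)}\,\frac{dz}{z}.$$ 3. If $\sigma_N^2=0$, then $\mathcal R^{(F_B)}=\mathcal R^{(\mathrm{SNR}_\infty)}:=\int_0^\infty\frac{1-\mathcal M_0(z)}{\mathcal Z_I^{(F_B)}(z)}\,\frac{dz}{z}$. 4. If $\sigma_N^2>0$, then $$\mathcal R^{(\mathrm{SNR}_\infty)}-\frac{\left(\pi\lambda^{(F_B)}\right)^{-\alpha/2}\,\Gamma\left(1+\frac\alpha2\right)}{\mathrm{SNR}}\int_0^\infty\frac{1-\mathcal M_0(z)}{\left[\mathcal Z_I^{(F_B)}(z)\right]^{1+\alpha/2}}\,dz\;\le\;\mathcal R^{(F_B)}\;\le\;\mathcal R^{(\mathrm{SNR}_\infty)}.$$ -/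

import Mathlib

open MeasureTheory ProbabilityTheory Filter Topology Set
open scoped ENNReal NNReal

universe u

namespace Downlink

noncomputable section

/-! ### Fading laws and the functionals built from them -/

/-- The law `ν` of a power channel gain: a probability law of a nonnegative random variable,
normalized to have mean one. (The integral being `1` forces integrability.) -/
structure IsFadingLaw (ν : Measure ℝ) : Prop where
  prob : IsProbabilityMeasure ν
  nonneg : ∀ᵐ x ∂ν, 0 ≤ x
  mean_one : ∫ x, x ∂ν = 1

/-- `M(s) = E[exp (-s g)]` for a gain `g` with law `ν`. -/
def fadingMGF (ν : Measure ℝ) (s : ℝ) : ℝ :=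
  ∫ x, Real.exp (-(s * x)) ∂ν

/-- `M^{(k)}(s) = E[g ^ (k+1) exp (-s g)]` for a gain `g` with law `ν`. -/
def fadingMGFDeriv (ν : Measure ℝ) (k : ℕ) (s : ℝ) : ℝ :=
  ∫ x, x ^ (k + 1) * Real.exp (-(s * x)) ∂ν

/-- The `k`-th term of the series that defines `T_I`. -/
def interferenceTerm (α : ℝ) (ν : Measure ℝ) (y : ℝ) (k : ℕ) : ℝ :=
  y ^ (k + 1) * fadingMGFDeriv ν k y * (Real.Gamma (2 - 2 / α + k))⁻¹

/-- `T_I(y) = Γ(1 - 2/α) ∑ₖ y^(k+1) M_I^{(k)}(y) / Γ(2 - 2/α + k)`. -/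
def interferenceT (α : ℝ) (ν : Measure ℝ) (y : ℝ) : ℝ :=
  Real.Gamma (1 - 2 / α) * ∑' k : ℕ, interferenceTerm α ν y k

/-- `Z_I^{(F_B)}(z) = (F_B - 1) + M_I(z) + T_I(z)`. -/
def reuseZ (α : ℝ) (F : ℕ) (ν : Measure ℝ) (z : ℝ) : ℝ :=
  ((F : ℝ) - 1) + fadingMGF ν z + interferenceT α ν z

/-! ### The rate formulas, as functions of the density and of the function `Z` -/

/-- The integrand of the inner integral in `G_I`. -/
def innerIntegrand (α lam snr : ℝ) (Z : ℝ → ℝ) (y ξ : ℝ) : ℝ :=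
  ξ ^ (α / 2 - 1) * Real.exp (-(Real.pi * lam * Z (snr * y) * ξ)) *
    Real.exp (-(y * ξ ^ (α / 2)))

/-- The function `G_I`. -/
def weightG (α lam snr : ℝ) (Z : ℝ → ℝ) (y : ℝ) : ℝ :=
  1 / Z (snr * y) -
    α / 2 * (y / Z (snr * y)) * ∫ ξ in Ioi (0 : ℝ), innerIntegrand α lam snr Z y ξ

/-- The integrand of the general rate formula. -/
def rateIntegrand (α lam snr : ℝ) (M₀ Z : ℝ → ℝ) (y : ℝ) : ℝ :=
  (1 - M₀ (snr * y)) * (weightG α lam snr Z y / y)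

/-- The general rate formula `∫₀^∞ [1 - M₀(SNR y)] G_I(y) dy / y`. -/
def rateFormula (α lam snr : ℝ) (M₀ Z : ℝ → ℝ) : ℝ :=
  ∫ y in Ioi (0 : ℝ), rateIntegrand α lam snr M₀ Z y

/-- The integrand of the limiting rate. -/
def limitIntegrand (M₀ Z : ℝ → ℝ) (z : ℝ) : ℝ :=
  (1 - M₀ z) / Z z * (1 / z)

/-- The limiting rate `∫₀^∞ (1 - M₀(z)) / Z(z) dz / z`. -/
def limitRate (M₀ Z : ℝ → ℝ) : ℝ :=
  ∫ z in Ioi (0 : ℝ), limitIntegrand M₀ Z z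

/-- The integrand of the high-SNR correction. -/
def correctionIntegrand (α : ℝ) (M₀ Z : ℝ → ℝ) (z : ℝ) : ℝ :=
  (1 - M₀ z) / Z z ^ (1 + α / 2)

/-- The high-SNR rate
`R^{(SNR_∞)} - (π λ)^(-α/2) Γ(1 + α/2) SNR⁻¹ ∫₀^∞ (1 - M₀(z)) / Z(z)^(1 + α/2) dz`. -/
def highSNRRate (α lam snr : ℝ) (M₀ Z : ℝ → ℝ) : ℝ :=
  limitRate M₀ Z -
    (Real.pi * lam) ^ (-(α / 2)) * Real.Gamma (1 + α / 2) * (1 / snr) *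
      ∫ z in Ioi (0 : ℝ), correctionIntegrand α M₀ Z z

/-! ### The cellular network -/

/-- The number of indices `b` with `X b ω ∈ A`. -/
def pointCount {Ω : Type u} (X : ℕ → Ω → EuclideanSpace ℝ (Fin 2))
    (A : Set (EuclideanSpace ℝ (Fin 2))) (ω : Ω) : ℕ∞ :=
  {b : ℕ | X b ω ∈ A}.encard

/-- The random points `X 0, X 1, …` (in an arbitrary enumeration) form a homogeneous Poisson point
process of density `lam` in the plane: the number of points in a Borel set `A` of finite area is
Poisson distributed with mean `lam * area A`, and the numbers of points in pairwise disjoint Borel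
sets are independent. -/
structure IsPoissonPointProcess {Ω : Type u} [MeasurableSpace Ω] (lam : ℝ)
    (X : ℕ → Ω → EuclideanSpace ℝ (Fin 2)) (μ : Measure Ω) : Prop where
  measurable : ∀ b, Measurable (X b)
  count_law : ∀ A : Set (EuclideanSpace ℝ (Fin 2)), MeasurableSet A → volume A ≠ ∞ → ∀ n : ℕ,
    μ {ω | pointCount X A ω = n} = poissonMeasure (Real.toNNReal lam * (volume A).toNNReal) {n}
  count_indep : ∀ (m : ℕ) (A : Fin m → Set (EuclideanSpace ℝ (Fin 2))),
    (∀ i, MeasurableSet (A i)) → Pairwise (fun i j => Disjoint (A i) (A j)) →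
      iIndepFun (fun i => pointCount X (A i)) μ

/-- A single-tier downlink network of density `lam` with `F` frequency bands and random frequency
reuse, seen by the mobile terminal at the origin. The serving link has gain `g₀` of law `ν₀` and
uses the band `servingBand`. The `b`-th base station is at `X b`; when it interferes, its link has
gain `g b` of law `νI`, and it transmits in the band `band b`, picked uniformly at random. The
positions, the serving gain, the interfering gains and the bands are mutually independent. -/
structure Network (lam : ℝ) (F : ℕ) (ν₀ νI : Measure ℝ) : Type (u + 1) where
  Ω : Type u
  [mΩ : MeasurableSpace Ω]
  P : Measure Ω
  [isProb : IsProbabilityMeasure P]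
  X : ℕ → Ω → EuclideanSpace ℝ (Fin 2)
  g₀ : Ω → ℝ
  g : ℕ → Ω → ℝ
  band : ℕ → Ω → Fin F
  servingBand : Fin F
  poisson : IsPoissonPointProcess lam X P
  measurable_g₀ : Measurable g₀
  measurable_g : ∀ b, Measurable (g b)
  measurable_band : ∀ b, Measurable (band b)
  law_g₀ : P.map g₀ = ν₀
  law_g : ∀ b, P.map (g b) = νI
  law_band : ∀ b k, P {ω | band b ω = k} = (F : ℝ≥0∞)⁻¹
  iIndep_g : iIndepFun g P
  iIndep_band : iIndepFun band P
  indep_g_band : IndepFun (fun ω b => g b ω) (fun ω b => band b ω) P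
  indep_g₀ : IndepFun g₀ (fun ω => ((fun b => g b ω), (fun b => band b ω))) P
  indep_X : IndepFun (fun ω b => X b ω)
    (fun ω => (g₀ ω, (fun b => g b ω), (fun b => band b ω))) P

attribute [instance] Network.mΩ Network.isProb

namespace Network

variable {lam : ℝ} {F : ℕ} {ν₀ νI : Measure ℝ}

/-- The distance from the origin to the serving base station, which is the nearest one. -/
def servingDist (N : Network.{u} lam F ν₀ νI) (ω : N.Ω) : ℝ :=
  ⨅ b : ℕ, ‖N.X b ω‖

open Classical in
/-- The interference power received from the `b`-th base station: `p * g b * ‖X b‖ ^ (-α)` if it is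
farther away than the serving one and transmits in the same band, and zero otherwise. (Almost
surely the nearest base station is unique.) -/
def interferenceFrom (N : Network.{u} lam F ν₀ νI) (α p : ℝ) (ω : N.Ω) (b : ℕ) : ℝ :=
  if N.servingDist ω < ‖N.X b ω‖ ∧ N.band b ω = N.servingBand then
    p * N.g b ω * ‖N.X b ω‖ ^ (-α)
  else 0

/-- The aggregate interference. -/
def interference (N : Network.{u} lam F ν₀ νI) (α p : ℝ) (ω : N.Ω) : ℝ :=
  ∑' b : ℕ, N.interferenceFrom α p ω b

/-- The signal-to-interference-plus-noise ratio for path-loss exponent `α`, transmit power `p` and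
noise power `noise`. -/
def sinr (N : Network.{u} lam F ν₀ νI) (α p noise : ℝ) (ω : N.Ω) : ℝ :=
  p * N.g₀ ω * N.servingDist ω ^ (-α) / (noise + N.interference α p ω)

/-- The average rate `(1 / F) E[ln (1 + SINR)]`: each band is a fraction `1 / F` of the spectrum. -/
def avgRate (N : Network.{u} lam F ν₀ νI) (α p noise : ℝ) : ℝ :=
  1 / (F : ℝ) * ∫ ω, Real.log (1 + N.sinr α p noise ω) ∂N.P

/-- The average rate is given by convergent expressions: the interference is almost surely a
convergent series, and `ln (1 + SINR)` has a finite expectation. -/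
def RateWellDefined (N : Network.{u} lam F ν₀ νI) (α p noise : ℝ) : Prop :=
  (∀ᵐ ω ∂N.P, Summable (N.interferenceFrom α p ω)) ∧
    Integrable (fun ω => Real.log (1 + N.sinr α p noise ω)) N.P

end Network

end

end Downlink

open Downlink

/-! Dividing signal, noise and interference by the mean serving power `p * D ^ (-α)`, where `D` is
the serving distance, turns the SINR into `g₀ / (T + S)`, with `T = (noise / p) * D ^ α` and `S` the
sum of `g b * (D / ‖X b‖) ^ α` over the interferers. The identity `ln (1 + x / y) = ∫₀^∞ e^(-zy) (1
- e^(-zx)) dz / z` then reduces the rate to Laplace transforms (`ofReal_log_sinr`,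
`lintegral_logIntegrand`).

By independence the serving gain contributes `(1 - M₀(z)) / z`. Given `D`, the farther stations are
still Poisson. Averaging over gains and bands, then applying the Laplace functional and the scaling
`‖x‖² = D² s`, gives the transform of `S` as `exp (-πλ D² (Z - F) / F)`, where `Z(z) = F + ∫₁^∞ (1 -
M_I(z s^(-α/2))) ds`. Since `D²` is exponential of rate `πλ`, integrating over `ξ = D²` yields `F`
times the weight `c ∫₀^∞ exp (-c Z ξ - σ z ξ^(α/2)) dξ`, with `c = πλ / F` and `σ = noise / p`
(`lintegral_noise_interference`). The factor `F` cancels the share `1 / F` of the spectrum.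

The series form of `Z` comes from a layer-cake integration in `s`, the expansion `e^(-cu) = e^(-c)
e^(c(1-u))` on `0 < u < 1`, and Beta integrals (`lintegral_one_sub_laplace_add`, `ofReal_reuseZ`).

All four claims follow from this weight. Integrating an exact derivative turns it into `G_I`
(`weightG_eq`). Without noise it equals `1 / Z`, which is also an upper bound with noise. The
inequality `e^(-t) ≥ 1 - t` on the noise factor gives the lower bound. Its correction is of order
`λ^(-α/2)`, so the dense limit is a squeeze.

Almost everything is computed in `[0, ∞]`: Tonelli needs no integrability, infinite interference is
harmless because `e^(-∞) = 0`, and the convergence claims are consequences of finite values rather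
than prerequisites. -/

namespace Downlink

/-! ### The function `exp (-x)` on `[0, ∞]` -/

/-- The function `x ↦ exp (-x)` on `[0, ∞]`. -/
noncomputable def expNeg (x : ℝ≥0∞) : ℝ≥0∞ := EReal.exp (-(x : EReal))

@[simp] lemma expNeg_zero : expNeg 0 = 1 := by simp [expNeg]

@[simp] lemma expNeg_top : expNeg ∞ = 0 := by simp [expNeg]

lemma continuous_expNeg : Continuous expNeg :=
  ENNReal.continuous_exp.comp (continuous_neg.comp continuous_coe_ennreal_ereal)

@[fun_prop] lemma measurable_expNeg : Measurable expNeg := continuous_expNeg.measurable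

lemma expNeg_antitone : Antitone expNeg := fun x y h => by
  unfold expNeg
  rw [EReal.exp_le_exp_iff, EReal.neg_le_neg_iff]
  exact_mod_cast h

lemma expNeg_le_one (x : ℝ≥0∞) : expNeg x ≤ 1 := by
  simpa using expNeg_antitone (zero_le : 0 ≤ x)

lemma expNeg_ne_top (x : ℝ≥0∞) : expNeg x ≠ ∞ :=
  ((expNeg_le_one x).trans_lt ENNReal.one_lt_top).ne

lemma expNeg_ofReal {x : ℝ} (hx : 0 ≤ x) :
    expNeg (ENNReal.ofReal x) = ENNReal.ofReal (Real.exp (-x)) := by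
  rw [expNeg, EReal.coe_ennreal_ofReal, max_eq_left hx, ← EReal.coe_neg, EReal.exp_coe]

lemma expNeg_add (x y : ℝ≥0∞) : expNeg (x + y) = expNeg x * expNeg y := by
  unfold expNeg
  rw [← EReal.exp_add, EReal.coe_ennreal_add, EReal.neg_add, sub_eq_add_neg]
  · left; exact EReal.coe_ennreal_ne_bot x
  · right; exact EReal.coe_ennreal_ne_bot y

lemma expNeg_sum {ι : Type*} (s : Finset ι) (f : ι → ℝ≥0∞) :
    expNeg (∑ i ∈ s, f i) = ∏ i ∈ s, expNeg (f i) := by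
  classical
  induction s using Finset.induction_on with
  | empty => simp
  | insert a s ha ih => rw [Finset.sum_insert ha, Finset.prod_insert ha, expNeg_add, ih]

lemma expNeg_mul_natCast (c : ℝ≥0∞) (n : ℕ) : expNeg (c * n) = expNeg c ^ n := by
  have := expNeg_sum (Finset.range n) (fun _ => c)
  simpa [mul_comm] using this

lemma tendsto_prod_expNeg (f : ℕ → ℝ≥0∞) :
    Tendsto (fun n => ∏ i ∈ Finset.range n, expNeg (f i)) atTop (𝓝 (expNeg (∑' i, f i))) := by
  simp_rw [← expNeg_sum]
  exact (continuous_expNeg.tendsto _).comp ENNReal.summable.hasSum.tendsto_sum_nat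

/-- The inverse of `expNeg` on `[0, 1]`. -/
noncomputable def negLog (x : ℝ≥0∞) : ℝ≥0∞ := (-(ENNReal.log x)).toENNReal

@[fun_prop] lemma measurable_negLog : Measurable negLog := by
  unfold negLog
  have : Measurable fun x => -(ENNReal.log x) :=
    (continuous_neg.comp ENNReal.continuous_log).measurable
  exact measurable_ereal_toENNReal.comp this

lemma expNeg_negLog {x : ℝ≥0∞} (hx : x ≤ 1) : expNeg (negLog x) = x := by
  have h : 0 ≤ -(ENNReal.log x) := by
    rw [EReal.le_neg, neg_zero]
    simpa using hx
  rw [expNeg, negLog, EReal.coe_toENNReal h, neg_neg, ENNReal.exp_log]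

lemma expNeg_toReal {x : ℝ≥0∞} (hx : x ≠ ∞) :
    expNeg x = ENNReal.ofReal (Real.exp (-x.toReal)) := by
  conv_lhs => rw [← ENNReal.ofReal_toReal hx]
  exact expNeg_ofReal ENNReal.toReal_nonneg

lemma one_sub_expNeg_le (x : ℝ≥0∞) : 1 - expNeg x ≤ x := by
  by_cases hx : x = ∞
  · simp [hx]
  rw [expNeg_toReal hx, ← ENNReal.ofReal_one, ← ENNReal.ofReal_sub _ (Real.exp_pos _).le]
  conv_rhs => rw [← ENNReal.ofReal_toReal hx]
  apply ENNReal.ofReal_le_ofReal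
  have := Real.add_one_le_exp (-x.toReal)
  linarith

/-! ### Laplace transforms of sums of independent variables -/

variable {Ω : Type*} [MeasurableSpace Ω] {μ : Measure Ω}

/-- The Laplace transform of a series of functions of independent variables. -/
lemma lintegral_expNeg_tsum_of_iIndepFun {β : Type*} [MeasurableSpace β] {Y : ℕ → Ω → β}
    (hY : iIndepFun Y μ) (hm : ∀ b, Measurable (Y b)) (f : ℕ → β → ℝ≥0∞)
    (hf : ∀ b, Measurable (f b)) (w : ℕ → ℝ≥0∞)
    (hw : ∀ b, ∫⁻ ω, expNeg (f b (Y b ω)) ∂μ = expNeg (w b)) :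
    ∫⁻ ω, expNeg (∑' b, f b (Y b ω)) ∂μ = expNeg (∑' b, w b) := by
  have : IsProbabilityMeasure μ := hY.isProbabilityMeasure
  have hcomp : iIndepFun (fun b ω => expNeg (f b (Y b ω))) μ :=
    hY.comp (fun b y => expNeg (f b y)) (fun b => measurable_expNeg.comp (hf b))
  have hmeas : ∀ b, Measurable fun ω => expNeg (f b (Y b ω)) := fun b =>
    measurable_expNeg.comp ((hf b).comp (hm b))
  have h1 : Tendsto (fun n => ∫⁻ ω, ∏ i ∈ Finset.range n, expNeg (f i (Y i ω)) ∂μ) atTop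
      (𝓝 (∫⁻ ω, expNeg (∑' b, f b (Y b ω)) ∂μ)) := by
    refine tendsto_lintegral_of_dominated_convergence (fun _ => 1)
      (fun n => Finset.measurable_fun_prod _ fun i _ => hmeas i) ?_ (by simp) ?_
    · exact fun n => ae_of_all _ fun ω => Finset.prod_le_one' fun i _ => expNeg_le_one _
    · exact ae_of_all _ fun ω => tendsto_prod_expNeg _
  have h2 : ∀ n, ∫⁻ ω, ∏ i ∈ Finset.range n, expNeg (f i (Y i ω)) ∂μ
      = ∏ i ∈ Finset.range n, expNeg (w i) := fun n => by
    rw [lintegral_prod_eq_prod_lintegral_of_indepFun _ _ hcomp hmeas]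
    exact Finset.prod_congr rfl fun i _ => hw i
  simp_rw [h2] at h1
  exact tendsto_nhds_unique h1 (tendsto_prod_expNeg w)

/-! ### The Laplace functional of a Poisson point process -/

/-- The generating function of a Poisson variable: `E[q ^ n] = e^(-r(1-q))` at `q = e^(-c)`, from
the exponential series. The case `c = ∞`, `q = 0`, is included and gives the void probability. -/
lemma lintegral_expNeg_poissonMeasure (r : ℝ≥0) (c : ℝ≥0∞) :
    ∫⁻ n : ℕ, expNeg (c * n) ∂(poissonMeasure r) = expNeg (r * (1 - expNeg c)) := by
  have hq : (expNeg c).toReal ≤ 1 := ENNReal.toReal_le_of_le_ofReal zero_le_one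
    (by simpa using expNeg_le_one c)
  obtain ⟨q, hq0, hqc⟩ : ∃ q : ℝ, 0 ≤ q ∧ expNeg c = ENNReal.ofReal q :=
    ⟨_, ENNReal.toReal_nonneg, (ENNReal.ofReal_toReal (expNeg_ne_top c)).symm⟩
  rw [hqc, ENNReal.toReal_ofReal hq0] at hq
  have hs : HasSum (fun n : ℕ => Real.exp (-r) * r ^ n / (n.factorial : ℝ) * q ^ n)
      (Real.exp (-(r * (1 - q)))) := by
    have h := (NormedSpace.expSeries_div_hasSum_exp ((r : ℝ) * q)).mul_left (Real.exp (-r))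
    rw [← Real.exp_eq_exp_ℝ, ← Real.exp_add] at h
    have e1 : -(r : ℝ) + r * q = -(r * (1 - q)) := by ring
    rw [e1] at h
    refine h.congr_fun fun n => ?_
    rw [mul_pow]; ring
  rw [lintegral_countable']
  have : ∀ n : ℕ, expNeg (c * n) * poissonMeasure r {n}
      = ENNReal.ofReal (Real.exp (-r) * r ^ n / (n.factorial : ℝ) * q ^ n) := fun n => by
    rw [expNeg_mul_natCast, poissonMeasure_singleton, hqc, ← ENNReal.ofReal_pow hq0,
      ← ENNReal.ofReal_mul (by positivity), mul_comm]
  simp_rw [this]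
  rw [← ENNReal.ofReal_tsum_of_nonneg (fun n => by positivity) hs.summable, hs.tsum_eq,
    ← expNeg_ofReal (mul_nonneg r.coe_nonneg (sub_nonneg.2 hq)), hqc, ENNReal.ofReal_mul r.coe_nonneg,
    ENNReal.ofReal_sub _ hq0]
  simp

variable {lam : ℝ} {X : ℕ → Ω → EuclideanSpace ℝ (Fin 2)}

lemma coe_pointCount {Ω : Type*} {X : ℕ → Ω → EuclideanSpace ℝ (Fin 2)} (A : Set (EuclideanSpace ℝ (Fin 2))) (ω : Ω) :
    ((pointCount X A ω : ℕ∞) : ℝ≥0∞) = ∑' b, A.indicator 1 (X b ω) := by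
  rw [pointCount, ← ENNReal.tsum_set_one, tsum_subtype {b | X b ω ∈ A} (fun _ => (1 : ℝ≥0∞))]
  rfl

lemma measurable_pointCount (hX : ∀ b, Measurable (X b))
    {A : Set (EuclideanSpace ℝ (Fin 2))} (hA : MeasurableSet A) :
    Measurable (pointCount X A) := by
  rw [ENat.measurable_iff]
  intro n
  have : pointCount X A ⁻¹' {(n : ℕ∞)} = {ω | ∑' b, A.indicator 1 (X b ω) = (n : ℝ≥0∞)} := by
    ext ω
    rw [mem_ofPred_eq, ← coe_pointCount, mem_preimage, mem_singleton_iff]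
    exact_mod_cast Iff.rfl
  rw [this]
  have hm : Measurable fun ω => ∑' b, A.indicator (1 : EuclideanSpace ℝ (Fin 2) → ℝ≥0∞) (X b ω) :=
    Measurable.tsum fun b => (measurable_one.indicator hA).comp (hX b)
  exact hm (measurableSet_singleton _)

/-- `count_law` fixes the mass of every finite count. The mass at `⊤` is then forced, since both
sides are probability measures. -/
lemma IsPoissonPointProcess.map_pointCount [IsProbabilityMeasure μ]
    (h : IsPoissonPointProcess lam X μ) {A : Set (EuclideanSpace ℝ (Fin 2))}
    (hA : MeasurableSet A) (hfin : volume A ≠ ∞) :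
    μ.map (pointCount X A) =
      (poissonMeasure (lam.toNNReal * (volume A).toNNReal)).map (Nat.cast : ℕ → ℕ∞) := by
  have hm := measurable_pointCount h.measurable hA
  have hc : Measurable (Nat.cast : ℕ → ℕ∞) := measurable_from_top
  set ν := poissonMeasure (lam.toNNReal * (volume A).toNNReal) with hν
  have h1 : IsProbabilityMeasure (μ.map (pointCount X A)) :=
    Measure.isProbabilityMeasure_map hm.aemeasurable
  have h2 : IsProbabilityMeasure (ν.map (Nat.cast : ℕ → ℕ∞)) :=
    Measure.isProbabilityMeasure_map hc.aemeasurable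
  have hnat : ∀ n : ℕ, μ.map (pointCount X A) {(n : ℕ∞)} = ν.map (Nat.cast : ℕ → ℕ∞) {(n : ℕ∞)} := by
    intro n
    rw [Measure.map_apply hm (measurableSet_singleton _),
      Measure.map_apply hc (measurableSet_singleton _)]
    have : (Nat.cast : ℕ → ℕ∞) ⁻¹' {(n : ℕ∞)} = {n} := by ext k; simp
    rw [this]
    exact h.count_law A hA hfin n
  have hrange : range (Nat.cast : ℕ → ℕ∞) = {⊤}ᶜ := by
    rw [ENat.range_natCast]; ext; simp [lt_top_iff_ne_top]
  have hcompl : μ.map (pointCount X A) ({⊤}ᶜ) = ν.map (Nat.cast : ℕ → ℕ∞) ({⊤}ᶜ) := by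
    rw [← hrange, ← iUnion_singleton_eq_range,
      measure_iUnion (fun i j hij => by simpa using hij) (fun _ => measurableSet_singleton _),
      measure_iUnion (fun i j hij => by simpa using hij) (fun _ => measurableSet_singleton _)]
    exact tsum_congr hnat
  refine Measure.ext_of_singleton fun a => ?_
  induction a using ENat.recTopCoe with
  | coe n => exact hnat n
  | top =>
    rw [← compl_compl {(⊤ : ℕ∞)}, prob_compl_eq_one_sub (measurableSet_singleton _).compl,
      prob_compl_eq_one_sub (measurableSet_singleton _).compl, hcompl]

lemma IsPoissonPointProcess.lintegral_expNeg_pointCount [IsProbabilityMeasure μ]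
    (h : IsPoissonPointProcess lam X μ) {A : Set (EuclideanSpace ℝ (Fin 2))}
    (hA : MeasurableSet A) (hfin : volume A ≠ ∞) (c : ℝ≥0∞) :
    ∫⁻ ω, expNeg (c * (pointCount X A ω : ℕ∞)) ∂μ =
      expNeg (ENNReal.ofReal lam * volume A * (1 - expNeg c)) := by
  have hm := measurable_pointCount h.measurable hA
  have hc : Measurable (Nat.cast : ℕ → ℕ∞) := measurable_from_top
  have hf : Measurable fun n : ℕ∞ => expNeg (c * (n : ℝ≥0∞)) := measurable_from_top
  rw [← lintegral_map hf hm, h.map_pointCount hA hfin, lintegral_map hf hc]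
  have := lintegral_expNeg_poissonMeasure (lam.toNNReal * (volume A).toNNReal) c
  simp only [ENat.toENNReal_coe]
  rw [this, ENNReal.coe_mul, ENNReal.coe_toNNReal hfin]
  rfl

lemma IsPoissonPointProcess.lintegral_expNeg_sum_pointCount [IsProbabilityMeasure μ]
    (h : IsPoissonPointProcess lam X μ) {m : ℕ} (A : Fin m → Set (EuclideanSpace ℝ (Fin 2)))
    (hA : ∀ i, MeasurableSet (A i)) (hd : Pairwise fun i j => Disjoint (A i) (A j))
    (hfin : ∀ i, volume (A i) ≠ ∞) (c : Fin m → ℝ≥0∞) :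
    ∫⁻ ω, expNeg (∑ i, c i * (pointCount X (A i) ω : ℕ∞)) ∂μ =
      expNeg (∑ i, ENNReal.ofReal lam * volume (A i) * (1 - expNeg (c i))) := by
  have hcomp : iIndepFun (fun i ω => expNeg (c i * (pointCount X (A i) ω : ℕ∞))) μ :=
    (h.count_indep m A hA hd).comp (fun i (n : ℕ∞) => expNeg (c i * (n : ℝ≥0∞)))
      (fun i => measurable_from_top)
  have hmeas : ∀ i, Measurable fun ω => expNeg (c i * (pointCount X (A i) ω : ℕ∞)) := fun i =>
    (measurable_from_top (f := fun n : ℕ∞ => expNeg (c i * (n : ℝ≥0∞)))).comp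
      (measurable_pointCount h.measurable (hA i))
  simp_rw [expNeg_sum]
  rw [lintegral_prod_eq_prod_lintegral_of_indepFun _ _ hcomp hmeas]
  exact Finset.prod_congr rfl fun i _ => h.lintegral_expNeg_pointCount (hA i) (hfin i) (c i)

/-- On the level sets of `s` inside `B` the sum is a finite combination of counts in disjoint sets.
Cutting down to `B` makes their areas finite, as `count_law` requires. -/
lemma IsPoissonPointProcess.lintegral_expNeg_tsum_simpleFunc [IsProbabilityMeasure μ]
    (h : IsPoissonPointProcess lam X μ) (s : SimpleFunc (EuclideanSpace ℝ (Fin 2)) ℝ≥0∞)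
    {B : Set (EuclideanSpace ℝ (Fin 2))} (hB : MeasurableSet B) (hfin : volume B ≠ ∞) :
    ∫⁻ ω, expNeg (∑' b, B.indicator s (X b ω)) ∂μ =
      expNeg (ENNReal.ofReal lam * ∫⁻ x, (1 - expNeg (B.indicator s x))) := by
  classical
  let e := s.range.equivFin
  let c : Fin s.range.card → ℝ≥0∞ := fun i => (e.symm i : ℝ≥0∞)
  let A : Fin s.range.card → Set (EuclideanSpace ℝ (Fin 2)) := fun i => s ⁻¹' {c i} ∩ B
  have hA : ∀ i, MeasurableSet (A i) := fun i => (s.measurableSet_fiber _).inter hB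
  have hinj : Function.Injective c := Subtype.val_injective.comp e.symm.injective
  have hd : Pairwise fun i j => Disjoint (A i) (A j) := fun i j hij => by
    refine Set.disjoint_left.2 ?_
    rintro x ⟨hx, -⟩ ⟨hy, -⟩
    exact hij (hinj (hx.symm.trans hy))
  have hAfin : ∀ i, volume (A i) ≠ ∞ := fun i => measure_ne_top_of_subset inter_subset_right hfin
  -- Needed twice: with `f = id` for the sum over points, and with `f y = 1 - expNeg y` for the area
  -- integral. The condition `f 0 = 0` takes care of the points outside `B`.
  have key : ∀ (f : ℝ≥0∞ → ℝ≥0∞), f 0 = 0 → ∀ x,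
      f (B.indicator s x) = ∑ i, f (c i) * (A i).indicator 1 x := by
    intro f hf x
    by_cases hx : x ∈ B
    · rw [indicator_of_mem hx, Finset.sum_eq_single (e ⟨s x, s.mem_range_self x⟩)]
      · have : x ∈ A (e ⟨s x, s.mem_range_self x⟩) := ⟨by simp [c], hx⟩
        rw [indicator_of_mem this]; simp [c]
      · intro i _ hi
        rw [indicator_of_notMem, mul_zero]
        rintro ⟨hxi, -⟩
        apply hi
        refine e.symm.injective ?_
        rw [e.symm_apply_apply]
        exact Subtype.ext hxi.symm
      · simp
    · rw [indicator_of_notMem hx, hf]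
      symm
      refine Finset.sum_eq_zero fun i _ => ?_
      rw [indicator_of_notMem (fun hh => hx hh.2), mul_zero]
  have h1 : ∀ ω, ∑' b, B.indicator s (X b ω) = ∑ i, c i * (pointCount X (A i) ω : ℕ∞) := by
    intro ω
    simp_rw [coe_pointCount, ← ENNReal.tsum_mul_left]
    rw [← Summable.tsum_finsetSum (fun i _ => ENNReal.summable)]
    exact tsum_congr fun b => key id rfl _
  have h2 : ∫⁻ x, (1 - expNeg (B.indicator s x)) = ∑ i, (1 - expNeg (c i)) * volume (A i) := by
    simp_rw [key (fun y => 1 - expNeg y) (by simp)]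
    rw [lintegral_finsetSum _ (fun i _ => (measurable_one.indicator (hA i)).const_mul _)]
    refine Finset.sum_congr rfl fun i _ => ?_
    rw [lintegral_const_mul _ (measurable_one.indicator (hA i)), lintegral_indicator_one (hA i)]
  simp_rw [h1]
  rw [h.lintegral_expNeg_sum_pointCount A hA hd hAfin c, h2, Finset.mul_sum]
  congr 1
  exact Finset.sum_congr rfl fun i _ => by ring

/-- The Laplace functional of a Poisson point process. -/
lemma IsPoissonPointProcess.lintegral_expNeg_tsum [IsProbabilityMeasure μ]
    (h : IsPoissonPointProcess lam X μ) {f : EuclideanSpace ℝ (Fin 2) → ℝ≥0∞}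
    (hf : Measurable f) :
    ∫⁻ ω, expNeg (∑' b, f (X b ω)) ∂μ =
      expNeg (ENNReal.ofReal lam * ∫⁻ x, (1 - expNeg (f x))) := by
  -- Approximation from below by simple functions on growing balls: the sums and the area integrals
  -- converge monotonically, and the outer expectation converges by domination by 1.
  let B : ℕ → Set (EuclideanSpace ℝ (Fin 2)) := fun n => Metric.closedBall 0 n
  have hB : ∀ n, MeasurableSet (B n) := fun n => measurableSet_closedBall
  have hBfin : ∀ n, volume (B n) ≠ ∞ := fun n => measure_closedBall_lt_top.ne
  let s := SimpleFunc.eapprox f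
  let v : ℕ → EuclideanSpace ℝ (Fin 2) → ℝ≥0∞ := fun n => (B n).indicator (s n)
  have hvm : ∀ n, Measurable (v n) := fun n => (s n).measurable.indicator (hB n)
  have hvmono : Monotone v := by
    intro n m hnm x
    refine indicator_le_indicator_of_subset ?_ (fun _ => zero_le) x |>.trans
      (indicator_le_indicator (SimpleFunc.monotone_eapprox f hnm x))
    exact Metric.closedBall_subset_closedBall (by exact_mod_cast hnm)
  have hvlim : ∀ x, Tendsto (fun n => v n x) atTop (𝓝 (f x)) := by
    intro x
    refine (SimpleFunc.tendsto_eapprox hf x).congr' ?_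
    filter_upwards [eventually_ge_atTop ⌈‖x‖⌉₊] with n hn
    have : x ∈ B n := by
      simp only [B, mem_closedBall_zero_iff]
      exact Nat.ceil_le.1 hn
    exact (indicator_of_mem this _).symm
  have hsum : ∀ ω, Tendsto (fun n => ∑' b, v n (X b ω)) atTop (𝓝 (∑' b, f (X b ω))) := by
    intro ω
    simp_rw [← lintegral_count]
    exact lintegral_tendsto_of_tendsto_of_monotone (fun n => Measurable.of_discrete.aemeasurable)
      (ae_of_all _ fun b n m hnm => hvmono hnm _) (ae_of_all _ fun b => hvlim _)
  have hL : Tendsto (fun n => ∫⁻ ω, expNeg (∑' b, v n (X b ω)) ∂μ) atTop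
      (𝓝 (∫⁻ ω, expNeg (∑' b, f (X b ω)) ∂μ)) := by
    refine tendsto_lintegral_of_dominated_convergence (fun _ => 1)
      (fun n => measurable_expNeg.comp (Measurable.tsum fun b =>
        (hvm n).comp (h.measurable b))) ?_ (by simp) ?_
    · exact fun n => ae_of_all _ fun ω => expNeg_le_one _
    · exact ae_of_all _ fun ω => (continuous_expNeg.tendsto _).comp (hsum ω)
  have hR : Tendsto (fun n => ∫⁻ x, (1 - expNeg (v n x))) atTop
      (𝓝 (∫⁻ x, (1 - expNeg (f x)))) := by
    refine lintegral_tendsto_of_tendsto_of_monotone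
      (fun n => (measurable_const.sub (measurable_expNeg.comp (hvm n))).aemeasurable) ?_ ?_
    · exact ae_of_all _ fun x n m hnm => tsub_le_tsub_left (expNeg_antitone (hvmono hnm x)) _
    · exact ae_of_all _ fun x => ENNReal.Tendsto.sub tendsto_const_nhds
        ((continuous_expNeg.tendsto _).comp (hvlim x)) (Or.inl ENNReal.one_ne_top)
  refine tendsto_nhds_unique hL ?_
  simp_rw [v, fun n => h.lintegral_expNeg_tsum_simpleFunc (s n) (hB n) (hBfin n)]
  exact (continuous_expNeg.tendsto _).comp
    (ENNReal.Tendsto.const_mul hR (Or.inr ENNReal.ofReal_ne_top))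

end Downlink

/-! ### Conditioning a Poisson process on its nearest point -/

namespace Downlink

/-- Convergence of integrals of functions dominated by their pointwise limit. -/
lemma tendsto_lintegral_of_le_of_tendsto {β : Type*} [MeasurableSpace β] {ν : Measure β}
    {f : ℕ → β → ℝ≥0∞} {g : β → ℝ≥0∞} (hf : ∀ n, Measurable (f n)) (hle : ∀ n x, f n x ≤ g x)
    (hlim : ∀ x, Tendsto (fun n => f n x) atTop (𝓝 (g x))) :
    Tendsto (fun n => ∫⁻ x, f n x ∂ν) atTop (𝓝 (∫⁻ x, g x ∂ν)) := by
  refine tendsto_of_le_liminf_of_limsup_le ?_ ?_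
  · calc ∫⁻ x, g x ∂ν = ∫⁻ x, liminf (fun n => f n x) atTop ∂ν :=
        lintegral_congr fun x => (hlim x).liminf_eq.symm
      _ ≤ _ := lintegral_liminf_le hf
  · exact limsup_le_of_le (by isBoundedDefault) (Eventually.of_forall fun n => lintegral_mono (hle n))

section Nearest

variable {Ω : Type*} [MeasurableSpace Ω] {μ : Measure Ω} [IsProbabilityMeasure μ]
  {lam : ℝ} {X : ℕ → Ω → EuclideanSpace ℝ (Fin 2)}

lemma le_iInf_norm_iff {x : ℕ → EuclideanSpace ℝ (Fin 2)} {a : ℝ} :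
    a ≤ ⨅ b, ‖x b‖ ↔ ∀ b, a ≤ ‖x b‖ :=
  le_ciInf_iff ⟨0, by rintro _ ⟨b, rfl⟩; exact norm_nonneg _⟩

lemma iInf_norm_nonneg (x : ℕ → EuclideanSpace ℝ (Fin 2)) : 0 ≤ ⨅ b, ‖x b‖ :=
  le_iInf_norm_iff.2 fun _ => norm_nonneg _

lemma measurable_iInf_norm : Measurable fun x : ℕ → EuclideanSpace ℝ (Fin 2) => ⨅ b, ‖x b‖ := by
  refine Measurable.iInf fun b => ?_
  fun_prop

/-- The event that no point lies in the ball is encoded as an infinite cost on the ball: a single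
point inside makes the exponent infinite and the exponential zero. -/
lemma indicator_le_iInf_mul_expNeg (x : ℕ → EuclideanSpace ℝ (Fin 2)) (a : ℝ)
    (f : EuclideanSpace ℝ (Fin 2) → ℝ≥0∞) :
    (if a ≤ ⨅ b, ‖x b‖ then expNeg (∑' b, f (x b)) else 0) =
      expNeg (∑' b, ((Metric.ball 0 a).indicator (fun _ => ∞) (x b) + f (x b))) := by
  split_ifs with h
  · rw [le_iInf_norm_iff] at h
    congr 1
    refine tsum_congr fun b => ?_
    rw [indicator_of_notMem (by simpa using h b), zero_add]
  · rw [le_iInf_norm_iff] at h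
    push Not at h
    obtain ⟨b, hb⟩ := h
    have : ∑' b, ((Metric.ball 0 a).indicator (fun _ => ∞) (x b) + f (x b)) = ∞ := by
      refine ENNReal.tsum_eq_top_of_eq_top ⟨b, ?_⟩
      rw [indicator_of_mem (by simpa using hb), top_add]
    rw [this, expNeg_top]

/-- The Laplace functional at `∞ · 1_ball + f`. As `f` vanishes on the ball, `1 - e^(-·)` of this
cost is `1_ball + (1 - e^(-f))`, so the result factors into the void probability and the functional
of `f`. -/
lemma IsPoissonPointProcess.setLIntegral_expNeg_tsum (h : IsPoissonPointProcess lam X μ) {a : ℝ}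
    {f : EuclideanSpace ℝ (Fin 2) → ℝ≥0∞} (hf : Measurable f)
    (hfa : ∀ x, ‖x‖ < a → f x = 0) :
    ∫⁻ ω in {ω | a ≤ ⨅ b, ‖X b ω‖}, expNeg (∑' b, f (X b ω)) ∂μ =
      expNeg (ENNReal.ofReal lam * volume (Metric.ball (0 : EuclideanSpace ℝ (Fin 2)) a)) *
        expNeg (ENNReal.ofReal lam * ∫⁻ x, (1 - expNeg (f x))) := by
  have hD : Measurable fun ω => ⨅ b, ‖X b ω‖ :=
    measurable_iInf_norm.comp (measurable_pi_lambda _ h.measurable)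
  have hball : Measurable ((Metric.ball (0 : EuclideanSpace ℝ (Fin 2)) a).indicator
      (fun _ => (∞ : ℝ≥0∞))) := measurable_const.indicator measurableSet_ball
  rw [← lintegral_indicator (measurableSet_le measurable_const hD)]
  have h1 : ∀ ω, {ω | a ≤ ⨅ b, ‖X b ω‖}.indicator (fun ω => expNeg (∑' b, f (X b ω))) ω =
      expNeg (∑' b, ((Metric.ball 0 a).indicator (fun _ => ∞) (X b ω) + f (X b ω))) := fun ω => by
    rw [← indicator_le_iInf_mul_expNeg (fun b => X b ω) a f]
    rfl
  simp_rw [h1]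
  rw [h.lintegral_expNeg_tsum (f := fun x => (Metric.ball 0 a).indicator (fun _ => ∞) x + f x)
    (hball.add hf), ← expNeg_add, ← mul_add]
  congr 2
  rw [← lintegral_indicator_one measurableSet_ball, ← lintegral_add_left
    (measurable_one.indicator measurableSet_ball)]
  refine lintegral_congr fun x => ?_
  by_cases hx : x ∈ Metric.ball 0 a
  · rw [indicator_of_mem hx, indicator_of_mem hx, hfa x (by simpa using hx)]
    simp
  · rw [indicator_of_notMem hx, indicator_of_notMem hx, zero_add, zero_add]

lemma IsPoissonPointProcess.measure_le_iInf_norm (h : IsPoissonPointProcess lam X μ) (a : ℝ) :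
    μ {ω | a ≤ ⨅ b, ‖X b ω‖} =
      expNeg (ENNReal.ofReal lam * volume (Metric.ball (0 : EuclideanSpace ℝ (Fin 2)) a)) := by
  have := h.setLIntegral_expNeg_tsum (a := a) (f := fun _ => 0) measurable_const (fun _ _ => rfl)
  simpa using this

/-- The shell event is the difference of `{a ≤ D}` and `{a' ≤ D}`. Since `f` vanishes within radius
`a'`, averaging over either event gives its probability times the same constant, so the difference
does too. -/
lemma IsPoissonPointProcess.setLIntegral_shell (h : IsPoissonPointProcess lam X μ) {a a' : ℝ}
    (haa' : a ≤ a') {f : EuclideanSpace ℝ (Fin 2) → ℝ≥0∞} (hf : Measurable f)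
    (hfa : ∀ x, ‖x‖ < a' → f x = 0) :
    ∫⁻ ω in {ω | a ≤ ⨅ b, ‖X b ω‖ ∧ ⨅ b, ‖X b ω‖ < a'}, expNeg (∑' b, f (X b ω)) ∂μ =
      ∫⁻ _ in {ω | a ≤ ⨅ b, ‖X b ω‖ ∧ ⨅ b, ‖X b ω‖ < a'},
        expNeg (ENNReal.ofReal lam * ∫⁻ x, (1 - expNeg (f x))) ∂μ := by
  have hD : Measurable fun ω => ⨅ b, ‖X b ω‖ :=
    measurable_iInf_norm.comp (measurable_pi_lambda _ h.measurable)
  have hm : MeasurableSet {ω | a' ≤ ⨅ b, ‖X b ω‖} := measurableSet_le measurable_const hD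
  have hset : {ω | a ≤ ⨅ b, ‖X b ω‖} \ {ω | a' ≤ ⨅ b, ‖X b ω‖} =
      {ω | a ≤ ⨅ b, ‖X b ω‖ ∧ ⨅ b, ‖X b ω‖ < a'} := by
    ext ω; simp
  have hsub : {ω | a' ≤ ⨅ b, ‖X b ω‖} ⊆ {ω | a ≤ ⨅ b, ‖X b ω‖} := fun ω hω => haa'.trans hω
  have hinter : {ω | a ≤ ⨅ b, ‖X b ω‖} ∩ {ω | a' ≤ ⨅ b, ‖X b ω‖} = {ω | a' ≤ ⨅ b, ‖X b ω‖} :=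
    inter_eq_right.2 hsub
  have hsplit : ∀ g : Ω → ℝ≥0∞, ∫⁻ ω in {ω | a' ≤ ⨅ b, ‖X b ω‖}, g ω ∂μ +
      ∫⁻ ω in {ω | a ≤ ⨅ b, ‖X b ω‖ ∧ ⨅ b, ‖X b ω‖ < a'}, g ω ∂μ =
      ∫⁻ ω in {ω | a ≤ ⨅ b, ‖X b ω‖}, g ω ∂μ := fun g => by
    rw [← lintegral_inter_add_sdiff g {ω | a ≤ ⨅ b, ‖X b ω‖} hm, hset, hinter]
  have h1 := hsplit fun ω => expNeg (∑' b, f (X b ω))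
  have h2 := hsplit fun _ => expNeg (ENNReal.ofReal lam * ∫⁻ x, (1 - expNeg (f x)))
  have e1 := h.setLIntegral_expNeg_tsum hf hfa
  have e2 := h.setLIntegral_expNeg_tsum hf (fun x hx => hfa x (hx.trans_le haa'))
  simp only [← h.measure_le_iInf_norm] at e1 e2
  simp only [setLIntegral_const] at h2 ⊢
  rw [e1, e2, mul_comm (μ _), mul_comm (μ _), ← h2] at h1
  -- The term cancelled is finite, which makes the subtraction legitimate in `[0, ∞]`.
  exact (ENNReal.add_right_inj (ENNReal.mul_ne_top (expNeg_ne_top _) (measure_ne_top _ _))).1 h1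

/-- Conditionally on the distance of the nearest point, the farther points of a Poisson process
form a Poisson process. -/
lemma IsPoissonPointProcess.lintegral_nearest (h : IsPoissonPointProcess lam X μ)
    {q v : ℝ → ℝ≥0∞} (hq : Continuous q) (hq1 : ∀ r, q r ≤ 1) (hv : Continuous v)
    (hmono : MonotoneOn v (Ici 0)) :
    ∫⁻ ω, q (⨅ b, ‖X b ω‖) * expNeg (∑' b, if ⨅ b, ‖X b ω‖ < ‖X b ω‖ then
        v ((⨅ b, ‖X b ω‖) / ‖X b ω‖) else 0) ∂μ =
      ∫⁻ ω, q (⨅ b, ‖X b ω‖) * expNeg (ENNReal.ofReal lam *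
        ∫⁻ x : EuclideanSpace ℝ (Fin 2), if ⨅ b, ‖X b ω‖ < ‖x‖ then
          1 - expNeg (v ((⨅ b, ‖X b ω‖) / ‖x‖)) else 0) ∂μ := by
  set D : Ω → ℝ := fun ω => ⨅ b, ‖X b ω‖ with hDdef
  have hD : Measurable D := measurable_iInf_norm.comp (measurable_pi_lambda _ h.measurable)
  have hD0 : ∀ ω, 0 ≤ D ω := fun ω => iInf_norm_nonneg _
  -- The distance is rounded to a grid of mesh `1 / (n + 1)`: `K n` indexes the shell, with inner
  -- radius `lo` and outer radius `hi`. Within a shell the cost no longer depends on the random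
  -- distance.
  let K : ℕ → Ω → ℕ := fun n ω => ⌊D ω * (n + 1)⌋₊
  have hK : ∀ n, Measurable (K n) := fun n => Nat.measurable_floor.comp (hD.mul_const _)
  let lo : ℕ → ℕ → ℝ := fun n k => k / (n + 1)
  let hi : ℕ → ℕ → ℝ := fun n k => (k + 1) / (n + 1)
  have hn : ∀ n : ℕ, (0 : ℝ) < n + 1 := fun n => by positivity
  have hlo : ∀ n ω, lo n (K n ω) ≤ D ω := fun n ω => by
    rw [div_le_iff₀ (hn n)]
    exact Nat.floor_le (mul_nonneg (hD0 ω) (hn n).le)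
  have hhi : ∀ n ω, D ω < hi n (K n ω) := fun n ω => by
    rw [lt_div_iff₀ (hn n)]
    exact Nat.lt_floor_add_one _
  have hlo0 : ∀ n k, 0 ≤ lo n k := fun n k => by positivity
  have hstep : ∀ n k, hi n k = lo n k + 1 / (n + 1) := fun n k => by
    simp only [hi, lo]; ring
  have hshell : ∀ n k, K n ⁻¹' {k} = {ω | lo n k ≤ D ω ∧ D ω < hi n k} := by
    intro n k
    ext ω
    simp only [mem_preimage, mem_singleton_iff, mem_ofPred_eq]
    constructor
    · rintro rfl
      exact ⟨hlo n ω, hhi n ω⟩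
    · rintro ⟨h1, h2⟩
      rw [Nat.floor_eq_iff (mul_nonneg (hD0 ω) (hn n).le)]
      exact ⟨(div_le_iff₀ (hn n)).1 h1, (lt_div_iff₀ (hn n)).1 h2⟩
  have hone : Tendsto (fun n : ℕ => 1 / ((n : ℝ) + 1)) atTop (𝓝 0) :=
    tendsto_one_div_add_atTop_nhds_zero_nat
  have hlolim : ∀ ω, Tendsto (fun n => lo n (K n ω)) atTop (𝓝 (D ω)) := fun ω => by
    refine tendsto_of_tendsto_of_tendsto_of_le_of_le (g := fun n : ℕ => D ω - 1 / ((n : ℝ) + 1))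
      (by simpa using hone.const_sub (D ω)) tendsto_const_nhds (fun n => ?_) (fun n => hlo n ω)
    have := hhi n ω
    rw [hstep] at this
    simp only
    linarith
  have hhilim : ∀ ω, Tendsto (fun n => hi n (K n ω)) atTop (𝓝 (D ω)) := fun ω => by
    simp_rw [hstep]
    simpa using (hlolim ω).add hone
  -- the integrands obtained by rounding the distance of the nearest point
  let f : ℕ → ℕ → EuclideanSpace ℝ (Fin 2) → ℝ≥0∞ := fun n k x =>
    if hi n k ≤ ‖x‖ then v (lo n k / ‖x‖) else 0
  have hf : ∀ n k, Measurable (f n k) := fun n k =>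
    Measurable.ite (measurableSet_le measurable_const measurable_norm)
      (hv.measurable.comp (measurable_const.div measurable_norm)) measurable_const
  have hdisc : ∀ n, ∫⁻ ω, q (lo n (K n ω)) * expNeg (∑' b, f n (K n ω) (X b ω)) ∂μ =
      ∫⁻ ω, q (lo n (K n ω)) * expNeg (ENNReal.ofReal lam *
        ∫⁻ x, (1 - expNeg (f n (K n ω) x))) ∂μ := by
    intro n
    have hsplit : ∀ G : ℕ → Ω → ℝ≥0∞, ∫⁻ ω, G (K n ω) ω ∂μ =
        ∑' k, ∫⁻ ω in K n ⁻¹' {k}, G k ω ∂μ := by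
      intro G
      rw [← setLIntegral_univ, ← preimage_univ (f := K n), ← iUnion_of_singleton ℕ,
        preimage_iUnion, lintegral_iUnion (fun k => hK n (measurableSet_singleton k))
          (fun i j hij => (disjoint_singleton.2 hij).preimage _)]
      refine tsum_congr fun k => setLIntegral_congr_fun (hK n (measurableSet_singleton k)) ?_
      rintro ω rfl
      rfl
    rw [hsplit fun k ω => q (lo n k) * expNeg (∑' b, f n k (X b ω)),
      hsplit fun k ω => q (lo n k) * expNeg (ENNReal.ofReal lam * ∫⁻ x, (1 - expNeg (f n k x)))]
    refine tsum_congr fun k => ?_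
    have hqt : q (lo n k) ≠ ∞ := ((hq1 _).trans_lt ENNReal.one_lt_top).ne
    rw [lintegral_const_mul' _ _ hqt, lintegral_const_mul' _ _ hqt, hshell,
      h.setLIntegral_shell (by rw [hstep]; have := hn n; linarith [one_div_pos.2 this]) (hf n k)]
    intro x hx
    exact if_neg hx.not_ge
  -- Both roundings decrease the cost: `lo ≤ D` does so by monotonicity of `v`, and `D < hi`
  -- discards points. The approximants need not be monotone in `n`, but they stay below their limit,
  -- so Fatou gives convergence of sums and area integrals.
  have hfle : ∀ n ω x, f n (K n ω) x ≤ if D ω < ‖x‖ then v (D ω / ‖x‖) else 0 := by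
    intro n ω x
    simp only [f]
    split_ifs with h1 h2
    · refine hmono (div_nonneg (hlo0 _ _) (norm_nonneg _)) (div_nonneg (hD0 _) (norm_nonneg _)) ?_
      exact div_le_div_of_nonneg_right (hlo n ω) (norm_nonneg _)
    · exact absurd ((hhi n ω).trans_le h1) h2
    · exact zero_le
    · exact le_rfl
  have hflim : ∀ ω x, Tendsto (fun n => f n (K n ω) x) atTop
      (𝓝 (if D ω < ‖x‖ then v (D ω / ‖x‖) else 0)) := by
    intro ω x
    split_ifs with h1
    · have : Tendsto (fun n => v (lo n (K n ω) / ‖x‖)) atTop (𝓝 (v (D ω / ‖x‖))) :=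
        (hv.tendsto _).comp ((hlolim ω).div_const _)
      refine this.congr' ?_
      filter_upwards [(hhilim ω).eventually_lt_const h1] with n hn'
      exact (if_pos hn'.le).symm
    · refine tendsto_const_nhds.congr fun n => ?_
      have := hfle n ω x
      rw [if_neg h1] at this
      exact (le_antisymm this zero_le).symm
  have hKf : ∀ n b, Measurable fun ω => f n (K n ω) (X b ω) := fun n b => by
    have : Measurable fun p : ℕ × EuclideanSpace ℝ (Fin 2) => f n p.1 p.2 :=
      measurable_from_prod_countable_right fun k => hf n k
    exact this.comp ((hK n).prodMk (h.measurable b))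
  have hKq : ∀ n, Measurable fun ω => q (lo n (K n ω)) := fun n =>
    (measurable_from_top (f := fun k => q (lo n k))).comp (hK n)
  have hqlim : ∀ ω, Tendsto (fun n => q (lo n (K n ω))) atTop (𝓝 (q (D ω))) := fun ω =>
    (hq.tendsto _).comp (hlolim ω)
  have hmul : ∀ {e : ℕ → ℝ≥0∞} {e' : ℝ≥0∞} (ω : Ω), Tendsto e atTop (𝓝 e') →
      Tendsto (fun n => q (lo n (K n ω)) * expNeg (e n)) atTop (𝓝 (q (D ω) * expNeg e')) :=
    fun ω he => ENNReal.Tendsto.mul (hqlim ω) (Or.inr (expNeg_ne_top _))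
      ((continuous_expNeg.tendsto _).comp he)
      (Or.inr ((hq1 _).trans_lt ENNReal.one_lt_top).ne)
  have hL : Tendsto (fun n => ∫⁻ ω, q (lo n (K n ω)) * expNeg (∑' b, f n (K n ω) (X b ω)) ∂μ)
      atTop (𝓝 (∫⁻ ω, q (D ω) * expNeg (∑' b, if D ω < ‖X b ω‖ then
        v (D ω / ‖X b ω‖) else 0) ∂μ)) := by
    refine tendsto_lintegral_of_dominated_convergence (fun _ => 1)
      (fun n => (hKq n).mul (measurable_expNeg.comp (Measurable.tsum fun b => hKf n b)))
      (fun n => ae_of_all _ fun ω => mul_le_one' (hq1 _) (expNeg_le_one _)) (by simp)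
      (ae_of_all _ fun ω => hmul ω ?_)
    simp_rw [← lintegral_count]
    exact tendsto_lintegral_of_le_of_tendsto (fun n => Measurable.of_discrete)
      (fun n b => hfle n ω _) (fun b => hflim ω _)
  have hR : Tendsto (fun n => ∫⁻ ω, q (lo n (K n ω)) * expNeg (ENNReal.ofReal lam *
        ∫⁻ x, (1 - expNeg (f n (K n ω) x))) ∂μ)
      atTop (𝓝 (∫⁻ ω, q (D ω) * expNeg (ENNReal.ofReal lam *
        ∫⁻ x : EuclideanSpace ℝ (Fin 2), if D ω < ‖x‖ then
          1 - expNeg (v (D ω / ‖x‖)) else 0) ∂μ)) := by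
    refine tendsto_lintegral_of_dominated_convergence (fun _ => 1)
      (fun n => (hKq n).mul ?_)
      (fun n => ae_of_all _ fun ω => mul_le_one' (hq1 _) (expNeg_le_one _)) (by simp)
      (ae_of_all _ fun ω => hmul ω (ENNReal.Tendsto.const_mul ?_ (Or.inr ENNReal.ofReal_ne_top)))
    · exact (measurable_from_top (f := fun k => expNeg (ENNReal.ofReal lam *
        ∫⁻ x, (1 - expNeg (f n k x))))).comp (hK n)
    · have e : ∀ x : EuclideanSpace ℝ (Fin 2), (if D ω < ‖x‖ then
          1 - expNeg (v (D ω / ‖x‖)) else 0) =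
          1 - expNeg (if D ω < ‖x‖ then v (D ω / ‖x‖) else 0) := fun x => by
        split_ifs <;> simp
      simp_rw [e]
      refine tendsto_lintegral_of_le_of_tendsto
        (fun n => measurable_const.sub (measurable_expNeg.comp (hf n _)))
        (fun n x => tsub_le_tsub_left (expNeg_antitone (hfle n ω x)) _) (fun x => ?_)
      exact ENNReal.Tendsto.sub tendsto_const_nhds
        ((continuous_expNeg.tendsto _).comp (hflim ω x)) (Or.inl ENNReal.one_ne_top)
  simp_rw [hdisc] at hL
  exact tendsto_nhds_unique hL hR

end Nearest

end Downlink

/-! ### Polar coordinates and the law of the nearest distance -/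

namespace Downlink

/-- The disc of radius `√a` has area `πa`, so the squared norm carries the area to `π` times length.
Agreement on the half-lines `Iio a` suffices. -/
lemma map_norm_sq_volume :
    (volume : Measure (EuclideanSpace ℝ (Fin 2))).map (fun x => ‖x‖ ^ 2) =
      ENNReal.ofReal Real.pi • volume.restrict (Ioi (0 : ℝ)) := by
  have hm : Measurable fun x : EuclideanSpace ℝ (Fin 2) => ‖x‖ ^ 2 := by fun_prop
  have key : ∀ a : ℝ, (volume : Measure (EuclideanSpace ℝ (Fin 2))).map (fun x => ‖x‖ ^ 2) (Iio a) =
      (ENNReal.ofReal Real.pi • volume.restrict (Ioi (0 : ℝ))) (Iio a) := by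
    intro a
    rw [Measure.map_apply hm measurableSet_Iio, Measure.smul_apply,
      Measure.restrict_apply measurableSet_Iio, Iio_inter_Ioi, Real.volume_Ioo, sub_zero]
    by_cases ha : 0 ≤ a
    · have : (fun x : EuclideanSpace ℝ (Fin 2) => ‖x‖ ^ 2) ⁻¹' Iio a = Metric.ball 0 (√a) := by
        ext x
        rw [mem_preimage, mem_Iio, mem_ball_zero_iff, Real.lt_sqrt (norm_nonneg _)]
      rw [this, EuclideanSpace.volume_ball_fin_two, ← ENNReal.ofReal_pow (Real.sqrt_nonneg _),
        Real.sq_sqrt ha, smul_eq_mul, mul_comm]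
    · have : (fun x : EuclideanSpace ℝ (Fin 2) => ‖x‖ ^ 2) ⁻¹' Iio a = ∅ := by
        ext x
        simp only [mem_preimage, mem_Iio, mem_empty_iff_false, iff_false, not_lt]
        nlinarith [sq_nonneg ‖x‖]
      rw [this, measure_empty, ENNReal.ofReal_of_nonpos (not_le.1 ha).le, smul_zero]
  refine Measure.ext_of_generateFrom_of_iUnion (range Iio) (fun n : ℕ => Iio (n : ℝ))
    (borel_eq_generateFrom_Iio ℝ ▸ BorelSpace.measurable_eq) isPiSystem_Iio ?_
    (fun n => mem_range_self _) (fun n => ?_) ?_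
  · exact eq_univ_of_forall fun x => mem_iUnion.2 (exists_nat_gt x)
  · rw [key, Measure.smul_apply, Measure.restrict_apply measurableSet_Iio, Iio_inter_Ioi,
      Real.volume_Ioo]
    exact ENNReal.mul_ne_top ENNReal.ofReal_ne_top ENNReal.ofReal_ne_top
  · rintro _ ⟨a, rfl⟩
    exact key a

/-- Polar coordinates in the plane. -/
lemma lintegral_norm_sq {f : ℝ → ℝ≥0∞} (hf : Measurable f) :
    ∫⁻ x : EuclideanSpace ℝ (Fin 2), f (‖x‖ ^ 2) =
      ENNReal.ofReal Real.pi * ∫⁻ ξ in Ioi (0 : ℝ), f ξ := by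
  rw [← lintegral_map (f := f) (g := fun x : EuclideanSpace ℝ (Fin 2) => ‖x‖ ^ 2) hf (by fun_prop),
    map_norm_sq_volume, lintegral_smul_measure, smul_eq_mul]

lemma lintegral_eq_mul_lintegral_comp_mul_left {f : ℝ → ℝ≥0∞} (hf : Measurable f) {a : ℝ}
    (ha : 0 < a) : ∫⁻ x, f x = ENNReal.ofReal a * ∫⁻ x, f (a * x) := by
  conv_lhs => rw [← Real.smul_map_volume_mul_left ha.ne']
  rw [lintegral_smul_measure, lintegral_map hf (by fun_prop), abs_of_pos ha, smul_eq_mul]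

lemma setLIntegral_Ioi_eq_mul_comp_mul_left {f : ℝ → ℝ≥0∞} (hf : Measurable f) {a : ℝ}
    (ha : 0 < a) (b : ℝ) :
    ∫⁻ x in Ioi (a * b), f x = ENNReal.ofReal a * ∫⁻ x in Ioi b, f (a * x) := by
  rw [← lintegral_indicator measurableSet_Ioi, ← lintegral_indicator measurableSet_Ioi,
    lintegral_eq_mul_lintegral_comp_mul_left (hf.indicator measurableSet_Ioi) ha]
  congr 1
  refine lintegral_congr fun x => ?_
  simp only [indicator_apply, mem_Ioi, mul_lt_mul_iff_right₀ ha]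

lemma setLIntegral_Ici_exp {c a : ℝ} (hc : 0 < c) :
    ∫⁻ ξ in Ici a, ENNReal.ofReal (c * Real.exp (-(c * ξ))) = ENNReal.ofReal (Real.exp (-(c * a))) := by
  have hi : IntegrableOn (fun ξ => c * Real.exp (-c * ξ)) (Ioi a) :=
    (exp_neg_integrableOn_Ioi a hc).const_mul c
  have h := integral_exp_mul_Ioi (a := -c) (by linarith) a
  rw [setLIntegral_congr Ioi_ae_eq_Ici.symm]
  simp_rw [← neg_mul]
  rw [← ofReal_integral_eq_lintegral_ofReal hi (ae_of_all _ fun ξ => by positivity),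
    integral_const_mul, h]
  congr 1
  field_simp

section Nearest

variable {Ω : Type*} [MeasurableSpace Ω] {μ : Measure Ω} [IsProbabilityMeasure μ]
  {lam : ℝ} {X : ℕ → Ω → EuclideanSpace ℝ (Fin 2)}

/-- The squared distance of the nearest point is exponentially distributed. -/
lemma IsPoissonPointProcess.lintegral_iInf_norm_sq (h : IsPoissonPointProcess lam X μ)
    (hlam : 0 < lam) {f : ℝ → ℝ≥0∞} (hf : Measurable f) :
    ∫⁻ ω, f ((⨅ b, ‖X b ω‖) ^ 2) ∂μ = ∫⁻ ξ in Ioi (0 : ℝ),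
      ENNReal.ofReal (Real.pi * lam * Real.exp (-(Real.pi * lam * ξ))) * f ξ := by
  have hc : 0 < Real.pi * lam := mul_pos Real.pi_pos hlam
  have hD : Measurable fun ω => (⨅ b, ‖X b ω‖) ^ 2 :=
    (measurable_iInf_norm.comp (measurable_pi_lambda _ h.measurable)).pow_const 2
  have hd : Measurable fun ξ : ℝ =>
      ENNReal.ofReal (Real.pi * lam * Real.exp (-(Real.pi * lam * ξ))) := by fun_prop
  have hlaw : μ.map (fun ω => (⨅ b, ‖X b ω‖) ^ 2) = (volume.restrict (Ioi (0 : ℝ))).withDensity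
      fun ξ => ENNReal.ofReal (Real.pi * lam * Real.exp (-(Real.pi * lam * ξ))) := by
    have : IsProbabilityMeasure (μ.map (fun ω => (⨅ b, ‖X b ω‖) ^ 2)) :=
      Measure.isProbabilityMeasure_map hD.aemeasurable
    -- The tail event `D² ≥ a` says that the ball of radius `√a` is empty, which has probability
    -- `e^(-πλa)`. For `a ≤ 0` both sides are 1.
    refine Measure.ext_of_Ici _ _ fun a => ?_
    rw [Measure.map_apply hD measurableSet_Ici, withDensity_apply _ measurableSet_Ici,
      Measure.restrict_restrict measurableSet_Ici]
    by_cases ha : 0 < a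
    · have e1 : (fun ω => (⨅ b, ‖X b ω‖) ^ 2) ⁻¹' Ici a = {ω | √a ≤ ⨅ b, ‖X b ω‖} := by
        ext ω
        rw [mem_preimage, mem_Ici, mem_ofPred_eq, Real.sqrt_le_left (iInf_norm_nonneg _)]
      have e2 : Ici a ∩ Ioi 0 = Ici a := inter_eq_left.2 fun x hx => ha.trans_le hx
      rw [e1, e2, h.measure_le_iInf_norm, setLIntegral_Ici_exp hc,
        EuclideanSpace.volume_ball_fin_two, ← ENNReal.ofReal_pow (Real.sqrt_nonneg _),
        Real.sq_sqrt ha.le, ← ENNReal.ofReal_mul ha.le, ← ENNReal.ofReal_mul hlam.le,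
        expNeg_ofReal (by positivity)]
      congr 3
      ring
    · have e1 : (fun ω => (⨅ b, ‖X b ω‖) ^ 2) ⁻¹' Ici a = univ := by
        ext ω
        simp only [mem_preimage, mem_Ici, mem_univ, iff_true]
        exact (not_lt.1 ha).trans (sq_nonneg _)
      have e2 : Ici a ∩ Ioi 0 = Ioi 0 := inter_eq_right.2 fun x hx => (not_lt.1 ha).trans (le_of_lt hx)
      rw [e1, e2, measure_univ, setLIntegral_congr Ioi_ae_eq_Ici, setLIntegral_Ici_exp hc]
      simp
  rw [← lintegral_map hf hD, hlaw, lintegral_withDensity_eq_lintegral_mul _ hd hf]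
  rfl

/-- Almost surely, no point is at the origin. -/
lemma IsPoissonPointProcess.ae_iInf_norm_pos (h : IsPoissonPointProcess lam X μ) (hlam : 0 < lam) :
    ∀ᵐ ω ∂μ, 0 < ⨅ b, ‖X b ω‖ := by
  have hD : Measurable fun ω => (⨅ b, ‖X b ω‖) :=
    (measurable_iInf_norm.comp (measurable_pi_lambda _ h.measurable))
  have hpos : ∀ᵐ ω ∂μ, 0 < (⨅ b, ‖X b ω‖) ^ 2 := by
    have hm : MeasurableSet {ω | 0 < (⨅ b, ‖X b ω‖) ^ 2}ᶜ :=
      (measurableSet_lt measurable_const (hD.pow_const 2)).compl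
    rw [ae_iff, ← compl_ofPred, ← lintegral_indicator_one hm]
    have := h.lintegral_iInf_norm_sq hlam (f := (Iic 0).indicator 1)
      (measurable_one.indicator measurableSet_Iic)
    rw [setLIntegral_congr_fun (g := fun _ => 0) measurableSet_Ioi
      (fun ξ hξ => by simp [indicator_of_notMem, hξ.out]), lintegral_zero] at this
    rw [← this]
    refine lintegral_congr fun ω => ?_
    simp [indicator_apply]
  filter_upwards [hpos] with ω hω
  refine lt_of_le_of_ne (iInf_norm_nonneg _) fun h0 => ?_
  rw [← h0] at hω
  simp at hω

/-- The joint law of the distance of the nearest point and of the relative distances of the other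
points. -/
lemma IsPoissonPointProcess.lintegral_nearest_sq (h : IsPoissonPointProcess lam X μ)
    (hlam : 0 < lam) {q v : ℝ → ℝ≥0∞} (hq : Continuous q) (hq1 : ∀ r, q r ≤ 1)
    (hv : Continuous v) (hmono : MonotoneOn v (Ici 0)) :
    ∫⁻ ω, q ((⨅ b, ‖X b ω‖) ^ 2) * expNeg (∑' b, if ⨅ b, ‖X b ω‖ < ‖X b ω‖ then
        v (((⨅ b, ‖X b ω‖) / ‖X b ω‖) ^ 2) else 0) ∂μ =
      ∫⁻ ξ in Ioi (0 : ℝ), ENNReal.ofReal (Real.pi * lam * Real.exp (-(Real.pi * lam * ξ))) *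
        (q ξ * expNeg (ENNReal.ofReal (Real.pi * lam * ξ) *
          ∫⁻ s in Ioi (1 : ℝ), (1 - expNeg (v s⁻¹)))) := by
  have hmain := h.lintegral_nearest (q := fun r => q (r ^ 2)) (v := fun r => v (r ^ 2))
    (hq.comp (continuous_pow 2)) (fun r => hq1 _) (hv.comp (continuous_pow 2))
    (fun a ha b hb hab => hmono (sq_nonneg a) (sq_nonneg b)
      (pow_le_pow_left₀ ha hab 2))
  rw [hmain]
  have hq' : Measurable fun ξ => q ξ * expNeg (ENNReal.ofReal (Real.pi * lam * ξ) *
          ∫⁻ s in Ioi (1 : ℝ), (1 - expNeg (v s⁻¹))) :=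
    hq.measurable.mul (measurable_expNeg.comp ((by fun_prop : Measurable fun ξ : ℝ =>
      ENNReal.ofReal (Real.pi * lam * ξ)).mul_const _))
  rw [← h.lintegral_iInf_norm_sq hlam hq']
  refine lintegral_congr_ae ?_
  filter_upwards [h.ae_iInf_norm_pos hlam] with ω hω'
  have hω := pow_pos hω' 2
  congr 2
  set D := ⨅ b, ‖X b ω‖ with hDdef
  have hg : Measurable fun ξ : ℝ => 1 - expNeg (v (D ^ 2 / ξ)) :=
    measurable_const.sub (measurable_expNeg.comp (hv.measurable.comp (by fun_prop)))
  have e1 : ∀ x : EuclideanSpace ℝ (Fin 2), (if D < ‖x‖ then 1 - expNeg (v ((D / ‖x‖) ^ 2)) else 0)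
      = (Ioi (D ^ 2)).indicator (fun ξ : ℝ => 1 - expNeg (v (D ^ 2 / ξ))) (‖x‖ ^ 2) := by
    intro x
    simp only [indicator_apply, mem_Ioi, div_pow,
      pow_lt_pow_iff_left₀ hω'.le (norm_nonneg x) two_ne_zero]
  have e2 : Ioi (D ^ 2) ∩ Ioi 0 = Ioi (D ^ 2) := inter_eq_left.2 fun x hx => hω.trans hx
  -- Polar coordinates turn the area integral into `π ∫` over `ξ > D²`. The substitution `ξ = D² s`
  -- then extracts `D²` and leaves an integral over `s > 1` free of `D`.
  simp_rw [e1]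
  rw [lintegral_norm_sq (hg.indicator measurableSet_Ioi), lintegral_indicator measurableSet_Ioi,
    Measure.restrict_restrict measurableSet_Ioi, e2, ← mul_one (D ^ 2),
    setLIntegral_Ioi_eq_mul_comp_mul_left (by simpa using hg) hω]
  simp only [mul_one]
  rw [← mul_assoc, ← mul_assoc, ← ENNReal.ofReal_mul hlam.le,
    ← ENNReal.ofReal_mul (mul_nonneg hlam.le Real.pi_pos.le), mul_comm lam]
  congr 1
  refine lintegral_congr fun s => ?_
  rw [← div_div, div_self hω.ne', one_div]

end Nearest

end Downlink

namespace Downlink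

/-! ### The logarithm as a mixture of exponentials -/

lemma setLIntegral_Ioc_exp {c x : ℝ} (hc : 0 ≤ c) (hx : 0 ≤ x) :
    ∫⁻ a in Ioc 0 x, ENNReal.ofReal (c * Real.exp (-(c * a))) =
      ENNReal.ofReal (1 - Real.exp (-(c * x))) := by
  have hcont : Continuous fun a => c * Real.exp (-(c * a)) := by fun_prop
  have hint : IntervalIntegrable (fun a => c * Real.exp (-(c * a))) volume 0 x :=
    hcont.intervalIntegrable _ _
  have hder : ∀ a ∈ uIcc 0 x, HasDerivAt (fun a => -Real.exp (-(c * a)))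
      (c * Real.exp (-(c * a))) a := fun a _ => by
    have := (((hasDerivAt_id a).const_mul c).neg.exp).neg
    convert! this using 1
    simp [mul_comm]
  have h := intervalIntegral.integral_eq_sub_of_hasDerivAt hder hint
  rw [intervalIntegral.integral_of_le hx] at h
  rw [← ofReal_integral_eq_lintegral_ofReal
    ((intervalIntegrable_iff_integrableOn_Ioc_of_le hx).1 hint)
    (ae_of_all _ fun a => by positivity), h]
  congr 1
  simp
  ring

lemma setLIntegral_Ioi_exp {c : ℝ} (hc : 0 < c) :
    ∫⁻ z in Ioi (0 : ℝ), ENNReal.ofReal (Real.exp (-(z * c))) = ENNReal.ofReal c⁻¹ := by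
  have h := setLIntegral_Ici_exp (a := 0) hc
  rw [setLIntegral_congr Ioi_ae_eq_Ici.symm] at h
  simp_rw [ENNReal.ofReal_mul hc.le] at h
  rw [lintegral_const_mul _ (by fun_prop)] at h
  simp only [mul_zero, neg_zero, Real.exp_zero, ENNReal.ofReal_one] at h
  rw [ENNReal.ofReal_inv_of_pos hc]
  refine ENNReal.eq_inv_of_mul_eq_one_left ?_
  rw [mul_comm, ← h]
  simp_rw [mul_comm]

/-- Write `(1 - e^(-zx)) / z` as `∫₀^x e^(-za) da` and exchange the integrals. The case `y = 0` is
kept in order to detect a vanishing denominator of the SINR. -/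
lemma setLIntegral_exp_mul_one_sub_exp_div {x y : ℝ} (hx : 0 ≤ x) (hy : 0 ≤ y) :
    ∫⁻ z in Ioi (0 : ℝ), ENNReal.ofReal (Real.exp (-(z * y)) * ((1 - Real.exp (-(z * x))) / z)) =
      ∫⁻ a in Ioc 0 x, ENNReal.ofReal (y + a)⁻¹ := by
  have h1 : ∀ z ∈ Ioi (0 : ℝ),
      ENNReal.ofReal (Real.exp (-(z * y)) * ((1 - Real.exp (-(z * x))) / z)) =
        ∫⁻ a in Ioc 0 x, ENNReal.ofReal (Real.exp (-(z * (y + a)))) := by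
    intro z hz
    have hz : 0 < z := hz
    have e : ∀ a, ENNReal.ofReal (Real.exp (-(z * (y + a)))) =
        ENNReal.ofReal (Real.exp (-(z * y)) / z) * ENNReal.ofReal (z * Real.exp (-(z * a))) := by
      intro a
      rw [← ENNReal.ofReal_mul (by positivity)]
      congr 1
      rw [mul_add, neg_add, Real.exp_add]
      field_simp
    simp_rw [e]
    rw [lintegral_const_mul _ (by fun_prop), setLIntegral_Ioc_exp hz.le hx,
      ← ENNReal.ofReal_mul (by positivity)]
    congr 1
    field_simp
  rw [setLIntegral_congr_fun measurableSet_Ioi h1, lintegral_lintegral_swap (by fun_prop)]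
  refine setLIntegral_congr_fun measurableSet_Ioc fun a ha => ?_
  exact setLIntegral_Ioi_exp (by linarith [ha.1])

lemma setLIntegral_exp_eq_ofReal_log {x y : ℝ} (hx : 0 ≤ x) (hy : 0 < y) :
    ∫⁻ z in Ioi (0 : ℝ), ENNReal.ofReal (Real.exp (-(z * y)) * ((1 - Real.exp (-(z * x))) / z)) =
      ENNReal.ofReal (Real.log (1 + x / y)) := by
  rw [setLIntegral_exp_mul_one_sub_exp_div hx hy.le]
  have hii : IntervalIntegrable (fun a => (y + a)⁻¹) volume 0 x := by
    refine ContinuousOn.intervalIntegrable_of_Icc hx (ContinuousOn.inv₀ (by fun_prop) ?_)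
    intro a ha
    linarith [ha.1]
  have h : ∫ a in (0)..x, (y + a)⁻¹ = Real.log (1 + x / y) := by
    rw [intervalIntegral.integral_comp_add_left (fun a => a⁻¹), add_zero,
      integral_inv_of_pos hy (by linarith)]
    congr 1
    field_simp
  rw [intervalIntegral.integral_of_le hx] at h
  rw [← ofReal_integral_eq_lintegral_ofReal
    ((intervalIntegrable_iff_integrableOn_Ioc_of_le hx).1 hii), h]
  refine (ae_restrict_iff' measurableSet_Ioc).2 (ae_of_all _ fun a ha => ?_)
  exact inv_nonneg.2 (by linarith [ha.1])

/-- `1 / a` is not integrable at zero. Hence a finite expectation excludes, up to a null event, a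
positive serving gain with neither noise nor interference. -/
lemma setLIntegral_exp_eq_top {x : ℝ} (hx : 0 < x) :
    ∫⁻ z in Ioi (0 : ℝ), ENNReal.ofReal (Real.exp (-(z * 0)) * ((1 - Real.exp (-(z * x))) / z)) =
      ∞ := by
  rw [setLIntegral_exp_mul_one_sub_exp_div hx.le le_rfl]
  by_contra hne
  have hi : IntegrableOn (fun a : ℝ => (0 + a)⁻¹) (Ioc 0 x) := by
    refine ⟨by fun_prop, ?_⟩
    rw [hasFiniteIntegral_iff_ofReal]
    · exact lt_top_iff_ne_top.2 hne
    · refine (ae_restrict_iff' measurableSet_Ioc).2 (ae_of_all _ fun a ha => ?_)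
      exact inv_nonneg.2 (by linarith [ha.1])
  simp only [zero_add] at hi
  rw [← intervalIntegrable_iff_integrableOn_Ioc_of_le hx.le, intervalIntegrable_inv_iff] at hi
  rcases hi with h | h
  · exact hx.ne h
  · exact h (left_mem_uIcc)

end Downlink

namespace Downlink

/-! ### The function `Z` as an integral -/

/-- The Beta integral `B(a, k + 1)`, read off from the normalization of the Beta density. -/
lemma setLIntegral_rpow_mul_one_sub_pow {a : ℝ} (ha : 0 < a) (k : ℕ) :
    ∫⁻ u in Ioo (0 : ℝ) 1, ENNReal.ofReal (u ^ (a - 1) * (1 - u) ^ k) =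
      ENNReal.ofReal (Real.Gamma a * k.factorial / Real.Gamma (a + 1 + k)) := by
  have hk : (0 : ℝ) < k + 1 := by positivity
  have hb := beta_pos ha hk
  have h := lintegral_betaPDF_eq_one ha hk
  rw [lintegral_betaPDF] at h
  have e : ∀ u : ℝ, ENNReal.ofReal (1 / beta a (k + 1) * u ^ (a - 1) * (1 - u) ^ ((k : ℝ) + 1 - 1)) =
      ENNReal.ofReal (1 / beta a (k + 1)) * ENNReal.ofReal (u ^ (a - 1) * (1 - u) ^ k) := fun u => by
    rw [← ENNReal.ofReal_mul (by positivity), mul_assoc, add_sub_cancel_right, Real.rpow_natCast]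
  simp_rw [e] at h
  rw [lintegral_const_mul _ (by fun_prop), one_div, ENNReal.ofReal_inv_of_pos hb] at h
  have hne : ENNReal.ofReal (beta a (k + 1)) ≠ 0 := by simpa using hb
  have h2 := congrArg (fun t => ENNReal.ofReal (beta a (k + 1)) * t) h
  simp only [mul_one] at h2
  rw [← mul_assoc, ENNReal.mul_inv_cancel hne ENNReal.ofReal_ne_top, one_mul] at h2
  rw [h2, beta, Real.Gamma_nat_eq_factorial]
  congr 3
  ring

/-- The series of the lower incomplete Gamma function. -/
lemma setLIntegral_rpow_mul_exp {a c : ℝ} (ha : 0 < a) (hc : 0 ≤ c) :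
    ∫⁻ u in Ioo (0 : ℝ) 1, ENNReal.ofReal (c * Real.exp (-(c * u)) * u ^ (a - 1)) =
      ∑' k : ℕ, ENNReal.ofReal (Real.Gamma a *
        (c ^ (k + 1) * Real.exp (-c) * (Real.Gamma (a + 1 + k))⁻¹)) := by
  have hexp : ∀ u ∈ Ioo (0 : ℝ) 1, ENNReal.ofReal (c * Real.exp (-(c * u)) * u ^ (a - 1)) =
      ∑' k : ℕ, ENNReal.ofReal (c ^ (k + 1) * Real.exp (-c) / k.factorial) *
        ENNReal.ofReal (u ^ (a - 1) * (1 - u) ^ k) := by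
    intro u hu
    have hu0 := hu.1
    have hu1 : 0 ≤ 1 - u := by linarith [hu.2]
    -- Expanding `e^(c(1-u))` rather than `e^(-cu)` makes all terms nonnegative, so sum and integral
    -- may be exchanged, and it produces the weights `(1 - u) ^ k` of a Beta integral.
    have hs := (NormedSpace.expSeries_div_hasSum_exp (c * (1 - u))).mul_left
      (c * Real.exp (-c) * u ^ (a - 1))
    rw [← Real.exp_eq_exp_ℝ] at hs
    have e1 : c * Real.exp (-c) * u ^ (a - 1) * Real.exp (c * (1 - u)) =
        c * Real.exp (-(c * u)) * u ^ (a - 1) := by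
      have : Real.exp (-(c * u)) = Real.exp (-c) * Real.exp (c * (1 - u)) := by
        rw [← Real.exp_add]; congr 1; ring
      rw [this]; ring
    rw [← e1, ← hs.tsum_eq, ENNReal.ofReal_tsum_of_nonneg (fun k => by positivity) hs.summable]
    refine tsum_congr fun k => ?_
    rw [← ENNReal.ofReal_mul (by positivity)]
    congr 1
    rw [mul_pow]
    ring
  rw [setLIntegral_congr_fun measurableSet_Ioo hexp, lintegral_tsum (fun k => by fun_prop)]
  refine tsum_congr fun k => ?_
  rw [lintegral_const_mul _ (by fun_prop), setLIntegral_rpow_mul_one_sub_pow ha,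
    ← ENNReal.ofReal_mul (by positivity)]
  congr 1
  have : (k.factorial : ℝ) ≠ 0 := by positivity
  field_simp

lemma le_inv_rpow_iff {β s u : ℝ} (hβ : 0 < β) (hs : 0 < s) (hu : 0 < u) :
    u ≤ s⁻¹ ^ β ↔ s ≤ u ^ (-(1 / β)) := by
  rw [Real.inv_rpow hs.le, le_inv_comm₀ hu (Real.rpow_pos_of_pos hs _),
    Real.le_rpow_inv_iff_of_pos hs.le (inv_nonneg.2 hu.le) hβ |>.symm, one_div,
    Real.rpow_neg hu.le, Real.inv_rpow hu.le]

/-- Layer cake: `1 - e^(-ct) = ∫₀^t c e^(-cu) du` with `t = s^(-β) < 1`. After the exchange, the set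
of `s > 1` with `u ≤ s^(-β)` has length `u^(-1/β) - 1`, and the added `1 - e^(-c) = ∫₀^1 c e^(-cu)
du` compensates the `-1`. The exponent is displayed as `a - 1` with `a = 1 - 1/β`, to match
`setLIntegral_rpow_mul_exp`. -/
lemma setLIntegral_Ioi_one_sub_exp {β c : ℝ} (hβ : 1 < β) (hc : 0 ≤ c) :
    (∫⁻ s in Ioi (1 : ℝ), ENNReal.ofReal (1 - Real.exp (-(c * s⁻¹ ^ β)))) +
        ENNReal.ofReal (1 - Real.exp (-c)) =
      ∫⁻ u in Ioo (0 : ℝ) 1, ENNReal.ofReal (c * Real.exp (-(c * u)) * u ^ (1 - 1 / β - 1)) := by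
  have hβ0 : 0 < β := by linarith
  have h1 : ∀ s ∈ Ioi (1 : ℝ), ENNReal.ofReal (1 - Real.exp (-(c * s⁻¹ ^ β))) =
      ∫⁻ u in Ioo (0 : ℝ) 1, (if u ≤ s⁻¹ ^ β then 1 else 0) *
        ENNReal.ofReal (c * Real.exp (-(c * u))) := by
    intro s hs
    have hs0 : (0 : ℝ) < s := zero_lt_one.trans hs
    rw [← setLIntegral_Ioc_exp hc (by positivity), ← lintegral_indicator measurableSet_Ioc,
      ← lintegral_indicator measurableSet_Ioo]
    refine lintegral_congr fun u => ?_
    have hlt : s⁻¹ ^ β < 1 :=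
      Real.rpow_lt_one (by positivity) (inv_lt_one_of_one_lt₀ hs) hβ0
    simp only [indicator_apply, mem_Ioc, mem_Ioo]
    by_cases h0 : 0 < u <;> by_cases h2 : u ≤ s⁻¹ ^ β
    · simp [h0, h2, h2.trans_lt hlt]
    · simp [h2]
    · simp [h0]
    · simp [h0]
  have hm : Measurable fun p : ℝ × ℝ => (if p.2 ≤ p.1⁻¹ ^ β then (1 : ℝ≥0∞) else 0) *
        ENNReal.ofReal (c * Real.exp (-(c * p.2))) := by
    refine Measurable.mul (Measurable.ite (measurableSet_le (by fun_prop) (by fun_prop))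
      measurable_const measurable_const) (by fun_prop)
  rw [setLIntegral_congr_fun measurableSet_Ioi h1, lintegral_lintegral_swap hm.aemeasurable]
  have h3 : ENNReal.ofReal (1 - Real.exp (-c)) =
      ∫⁻ u in Ioo (0 : ℝ) 1, ENNReal.ofReal (c * Real.exp (-(c * u))) := by
    have := setLIntegral_Ioc_exp hc zero_le_one
    rw [mul_one] at this
    rw [← this, setLIntegral_congr Ioo_ae_eq_Ioc]
  rw [h3, ← lintegral_add_right _ (by fun_prop)]
  refine setLIntegral_congr_fun measurableSet_Ioo fun u hu => ?_
  have hu0 : 0 < u := hu.1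
  have hpow : 1 ≤ u ^ (-(1 / β)) := Real.one_le_rpow_of_pos_of_le_one_of_nonpos hu0 hu.2.le
    (by simp only [Left.neg_nonpos_iff]; positivity)
  have h4 : ∫⁻ s in Ioi (1 : ℝ), (if u ≤ s⁻¹ ^ β then (1 : ℝ≥0∞) else 0) =
      ENNReal.ofReal (u ^ (-(1 / β)) - 1) := by
    rw [← Real.volume_Ioc, ← lintegral_indicator_one measurableSet_Ioc,
      ← lintegral_indicator measurableSet_Ioi]
    refine lintegral_congr fun s => ?_
    simp only [indicator_apply, mem_Ioi, mem_Ioc, Pi.one_apply]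
    by_cases hs : 1 < s
    · simp [hs, le_inv_rpow_iff hβ0 (zero_lt_one.trans hs) hu0]
    · simp [hs]
  rw [lintegral_mul_const' _ _ ENNReal.ofReal_ne_top, h4, ← ENNReal.ofReal_mul (by linarith),
    ← ENNReal.ofReal_add (mul_nonneg (by linarith) (by positivity)) (by positivity)]
  congr 1
  have : 1 - 1 / β - 1 = -(1 / β) := by ring
  rw [this]
  ring

end Downlink

namespace Downlink

/-! ### Laplace transforms of fading laws -/

/-- The Laplace transform of a law on the line, with values in `[0, ∞]`. -/
noncomputable def laplace (ν : Measure ℝ) (s : ℝ) : ℝ≥0∞ :=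
  ∫⁻ x, expNeg (ENNReal.ofReal (s * x)) ∂ν

namespace IsFadingLaw

variable {ν : Measure ℝ} (hν : IsFadingLaw ν)

include hν

lemma integrable_id : Integrable (fun x => x) ν := by
  by_contra h
  have := hν.mean_one
  rw [integral_undef h] at this
  exact zero_ne_one this

lemma lintegral_ofReal : ∫⁻ x, ENNReal.ofReal x ∂ν = 1 := by
  rw [← ofReal_integral_eq_lintegral_ofReal hν.integrable_id hν.nonneg, hν.mean_one,
    ENNReal.ofReal_one]

lemma laplace_le_one (s : ℝ) : laplace ν s ≤ 1 := by
  have := hν.prob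
  calc laplace ν s ≤ ∫⁻ _, 1 ∂ν := lintegral_mono fun x => expNeg_le_one _
    _ = 1 := by simp

lemma one_sub_laplace (s : ℝ) :
    1 - laplace ν s = ∫⁻ x, (1 - expNeg (ENNReal.ofReal (s * x))) ∂ν := by
  have := hν.prob
  rw [lintegral_sub (by fun_prop) ((hν.laplace_le_one s).trans_lt ENNReal.one_lt_top).ne
    (ae_of_all _ fun x => expNeg_le_one _)]
  simp [laplace]

lemma ofReal_fadingMGF {s : ℝ} (hs : 0 ≤ s) : ENNReal.ofReal (fadingMGF ν s) = laplace ν s := by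
  have := hν.prob
  have hb : ∀ᵐ x ∂ν, ‖Real.exp (-(s * x))‖ ≤ 1 := by
    filter_upwards [hν.nonneg] with x hx
    rw [Real.norm_eq_abs, abs_of_pos (Real.exp_pos _), Real.exp_le_one_iff]
    exact neg_nonpos.2 (mul_nonneg hs hx)
  rw [fadingMGF, laplace, ofReal_integral_eq_lintegral_ofReal
    (Integrable.of_bound (by fun_prop) 1 hb) (ae_of_all _ fun x => (Real.exp_pos _).le)]
  refine lintegral_congr_ae ?_
  filter_upwards [hν.nonneg] with x hx
  rw [expNeg_ofReal (mul_nonneg hs hx)]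

lemma continuous_laplace : Continuous (laplace ν) := by
  have := hν.prob
  refine continuous_iff_continuousAt.2 fun s => ?_
  refine tendsto_lintegral_filter_of_dominated_convergence (fun _ => 1)
    (Eventually.of_forall fun t => by fun_prop)
    (Eventually.of_forall fun t => ae_of_all _ fun x => expNeg_le_one _) (by simp)
    (ae_of_all _ fun x => ?_)
  have : Continuous fun t => expNeg (ENNReal.ofReal (t * x)) :=
    continuous_expNeg.comp (ENNReal.continuous_ofReal.comp (by fun_prop))
  exact this.tendsto s

lemma laplace_antitone : Antitone (laplace ν) := fun s t hst => by
  refine lintegral_mono_ae ?_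
  filter_upwards [hν.nonneg] with x hx
  exact expNeg_antitone (ENNReal.ofReal_le_ofReal (mul_le_mul_of_nonneg_right hst hx))

lemma one_sub_laplace_le {s : ℝ} (hs : 0 ≤ s) : 1 - laplace ν s ≤ ENNReal.ofReal s := by
  rw [hν.one_sub_laplace]
  calc ∫⁻ x, (1 - expNeg (ENNReal.ofReal (s * x))) ∂ν
      ≤ ∫⁻ x, ENNReal.ofReal s * ENNReal.ofReal x ∂ν := lintegral_mono fun x => by
        rw [← ENNReal.ofReal_mul hs]
        exact one_sub_expNeg_le _
    _ = ENNReal.ofReal s := by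
        rw [lintegral_const_mul _ (by fun_prop), hν.lintegral_ofReal, mul_one]

/-- Equality would make the gain almost surely zero, against mean one. -/
lemma laplace_one_lt : laplace ν 1 < 1 := by
  refine lt_of_le_of_ne (hν.laplace_le_one 1) fun h => ?_
  have h1 := hν.one_sub_laplace 1
  rw [h, tsub_self, eq_comm, lintegral_eq_zero_iff (by fun_prop)] at h1
  have h2 : ∀ᵐ x ∂ν, ENNReal.ofReal x = 0 := by
    filter_upwards [h1] with x hx
    simp only [one_mul, Pi.zero_apply, tsub_eq_zero_iff_le] at hx
    by_contra hne
    rw [expNeg_toReal ENNReal.ofReal_ne_top, ENNReal.one_le_ofReal, Real.one_le_exp_iff,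
      Left.nonneg_neg_iff] at hx
    exact hne ((ENNReal.toReal_eq_zero_iff _).1
      (le_antisymm hx ENNReal.toReal_nonneg) |>.resolve_right ENNReal.ofReal_ne_top)
  have h3 := hν.lintegral_ofReal
  rw [lintegral_congr_ae h2] at h3
  simp at h3

end IsFadingLaw

/-! ### The function `Z` -/

/-- `Z(z) = F + ∫₁^∞ (1 - M(z s^(-α/2))) ds`, with values in `[0, ∞]`. -/
noncomputable def integralZ (α : ℝ) (F : ℕ) (ν : Measure ℝ) (z : ℝ) : ℝ≥0∞ :=
  F + ∫⁻ s in Ioi (1 : ℝ), (1 - laplace ν (z * s⁻¹ ^ (α / 2)))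

section Z

variable {α : ℝ} {F : ℕ} {ν : Measure ℝ}

lemma measurable_integralZ (hν : IsFadingLaw ν) : Measurable (integralZ α F ν) := by
  have hL := hν.continuous_laplace.measurable
  refine measurable_const.add (Measurable.lintegral_prod_right' (f := fun p : ℝ × ℝ =>
    1 - laplace ν (p.1 * p.2⁻¹ ^ (α / 2))) ?_)
  exact measurable_const.sub (hL.comp (by fun_prop))

lemma natCast_le_integralZ (z : ℝ) : (F : ℝ≥0∞) ≤ integralZ α F ν z := le_self_add

/-- Mean one gives `1 - M(s) ≤ s`, so `C = ∫₁^∞ s^(-α/2) ds` works, finite because `α > 2`. Besides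
finiteness of `Z`, the bound controls `Z` as `z → 0`, which is what shows the interference to be
finite. -/
lemma exists_integralZ_le (hα : 2 < α) (hν : IsFadingLaw ν) :
    ∃ C : ℝ≥0∞, C ≠ ∞ ∧ ∀ z, 0 ≤ z → integralZ α F ν z ≤ F + ENNReal.ofReal z * C := by
  refine ⟨∫⁻ s in Ioi (1 : ℝ), ENNReal.ofReal (s ^ (-(α / 2))), ?_, fun z hz => ?_⟩
  · have hi := integrableOn_Ioi_rpow_of_lt (a := -(α / 2)) (by linarith) one_pos
    exact hi.lintegral_lt_top.ne
  · refine add_le_add_right ?_ _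
    rw [← lintegral_const_mul _ (by fun_prop)]
    refine setLIntegral_mono (by fun_prop) fun s hs => ?_
    have hs0 : (0 : ℝ) < s := zero_lt_one.trans hs
    rw [← ENNReal.ofReal_mul hz, Real.rpow_neg hs0.le, ← Real.inv_rpow hs0.le]
    exact hν.one_sub_laplace_le (by positivity)

lemma integralZ_ne_top (hα : 2 < α) (hν : IsFadingLaw ν) {z : ℝ} (hz : 0 ≤ z) :
    integralZ α F ν z ≠ ∞ := by
  obtain ⟨C, hC, h⟩ := exists_integralZ_le (F := F) hα hν
  exact ((h z hz).trans_lt (ENNReal.add_lt_top.2 ⟨ENNReal.natCast_lt_top F,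
    ENNReal.mul_lt_top ENNReal.ofReal_lt_top (lt_top_iff_ne_top.2 hC)⟩)).ne

/-- Take `δ = 1 - M(1)`. For `1 < s ≤ z^(2/α)` the argument `z s^(-α/2)` is at least 1, so the
integrand is at least `δ` on an interval of length `z^(2/α) - 1`; the missing `δ` is supplied by `F
≥ 1 ≥ δ`. This growth gives integrability at infinity. -/
lemma exists_le_integralZ (hα : 2 < α) (hF : 1 ≤ F) (hν : IsFadingLaw ν) :
    ∃ δ : ℝ, 0 < δ ∧ ∀ z, 1 ≤ z → ENNReal.ofReal (δ * z ^ (2 / α)) ≤ integralZ α F ν z := by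
  have hlt := hν.laplace_one_lt
  have hne : 1 - laplace ν 1 ≠ ∞ := (tsub_le_self.trans_lt ENNReal.one_lt_top).ne
  refine ⟨(1 - laplace ν 1).toReal, ENNReal.toReal_pos (tsub_pos_of_lt hlt).ne' hne, fun z hz => ?_⟩
  have hz0 : 0 < z := zero_lt_one.trans_le hz
  have hp : 1 ≤ z ^ (2 / α) := Real.one_le_rpow hz (by positivity)
  have h1 : (1 - laplace ν 1) * ENNReal.ofReal (z ^ (2 / α) - 1) ≤
      ∫⁻ s in Ioi (1 : ℝ), (1 - laplace ν (z * s⁻¹ ^ (α / 2))) := by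
    rw [← Real.volume_Ioc, ← setLIntegral_const]
    refine (setLIntegral_mono' measurableSet_Ioc fun s hs => ?_).trans
      (lintegral_mono_set Ioc_subset_Ioi_self)
    refine tsub_le_tsub_left (hν.laplace_antitone ?_) _
    have hs0 : (0 : ℝ) < s := zero_lt_one.trans hs.1
    have h2 : z⁻¹ ≤ s⁻¹ ^ (α / 2) := by
      rw [le_inv_rpow_iff (by linarith) hs0 (inv_pos.2 hz0), Real.inv_rpow hz0.le,
        Real.rpow_neg hz0.le, inv_inv, one_div_div]
      exact hs.2
    calc 1 = z * z⁻¹ := (mul_inv_cancel₀ hz0.ne').symm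
      _ ≤ _ := mul_le_mul_of_nonneg_left h2 hz0.le
  have hF' : (1 - laplace ν 1) ≤ (F : ℝ≥0∞) := tsub_le_self.trans (by exact_mod_cast hF)
  rw [ENNReal.ofReal_mul ENNReal.toReal_nonneg, ENNReal.ofReal_toReal hne]
  calc (1 - laplace ν 1) * ENNReal.ofReal (z ^ (2 / α))
      = (1 - laplace ν 1) * (1 + ENNReal.ofReal (z ^ (2 / α) - 1)) := by
        rw [← ENNReal.ofReal_one, ← ENNReal.ofReal_add zero_le_one (by linarith)]
        congr 2; ring
    _ = (1 - laplace ν 1) + (1 - laplace ν 1) * ENNReal.ofReal (z ^ (2 / α) - 1) := by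
        rw [mul_add, mul_one]
    _ ≤ _ := add_le_add hF' h1

lemma interferenceTerm_nonneg (hα : 2 < α) (hν : IsFadingLaw ν) {y : ℝ} (hy : 0 < y) (k : ℕ) :
    0 ≤ interferenceTerm α ν y k := by
  have : 2 / α < 1 := (div_lt_one (by linarith)).2 hα
  refine mul_nonneg (mul_nonneg (by positivity) (integral_nonneg_of_ae ?_))
    (inv_nonneg.2 (Real.Gamma_pos_of_pos ?_).le)
  · filter_upwards [hν.nonneg] with x hx
    exact mul_nonneg (pow_nonneg hx _) (Real.exp_pos _).le
  · have : (0 : ℝ) ≤ k := by positivity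
    linarith

/-- No higher moments are assumed: the exponential bounds the integrand, through `t^n / n! ≤ e^t`
with `t = y * x` and `n = k + 1`. -/
lemma integrable_pow_mul_exp (hν : IsFadingLaw ν) {y : ℝ} (hy : 0 < y) (k : ℕ) :
    Integrable (fun x => x ^ (k + 1) * Real.exp (-(y * x))) ν := by
  have := hν.prob
  refine Integrable.of_bound (by fun_prop) ((k + 1).factorial / y ^ (k + 1)) ?_
  filter_upwards [hν.nonneg] with x hx
  have h0 : 0 ≤ x := hx
  rw [Real.norm_eq_abs, abs_of_nonneg (by positivity), Real.exp_neg, ← div_eq_mul_inv,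
    div_le_div_iff₀ (Real.exp_pos _) (by positivity), ← mul_pow, mul_comm x y,
    ← div_le_iff₀' (by positivity)]
  exact Real.pow_div_factorial_le_exp _ (by positivity) _

lemma ofReal_interferenceTerm (hα : 2 < α) (hν : IsFadingLaw ν) {y : ℝ} (hy : 0 < y) (k : ℕ) :
    ENNReal.ofReal (Real.Gamma (1 - 2 / α) * interferenceTerm α ν y k) =
      ∫⁻ x, ENNReal.ofReal (Real.Gamma (1 - 2 / α) * ((y * x) ^ (k + 1) * Real.exp (-(y * x)) *
        (Real.Gamma (1 - 2 / α + 1 + k))⁻¹)) ∂ν := by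
  have h2 : 2 / α < 1 := (div_lt_one (by linarith)).2 hα
  have hk : (0 : ℝ) ≤ k := by positivity
  have hG1 := Real.Gamma_pos_of_pos (show 0 < 1 - 2 / α by linarith)
  have hG2 := Real.Gamma_pos_of_pos (show 0 < 1 - 2 / α + 1 + k by linarith)
  have e : ∀ x : ℝ, Real.Gamma (1 - 2 / α) * ((y * x) ^ (k + 1) * Real.exp (-(y * x)) *
        (Real.Gamma (1 - 2 / α + 1 + k))⁻¹) = (Real.Gamma (1 - 2 / α) * y ^ (k + 1) *
        (Real.Gamma (1 - 2 / α + 1 + k))⁻¹) * (x ^ (k + 1) * Real.exp (-(y * x))) := fun x => by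
    rw [mul_pow]; ring
  simp_rw [e]
  rw [← ofReal_integral_eq_lintegral_ofReal ((integrable_pow_mul_exp hν hy k).const_mul _),
    integral_const_mul]
  · congr 1
    rw [interferenceTerm, fadingMGFDeriv]
    have : (2 : ℝ) - 2 / α + k = 1 - 2 / α + 1 + k := by ring
    rw [this]
    ring
  · filter_upwards [hν.nonneg] with x hx
    have h0 : 0 ≤ x := hx
    show 0 ≤ _
    positivity

/-- For each value `x` of the gain, `setLIntegral_Ioi_one_sub_exp` and the incomplete Gamma series
at `c = z * x` give the identity. Averaging over `x` commutes with the integral and the series, all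
terms being nonnegative. -/
lemma lintegral_one_sub_laplace_add (hα : 2 < α) (hν : IsFadingLaw ν) {z : ℝ} (hz : 0 < z) :
    (∫⁻ s in Ioi (1 : ℝ), (1 - laplace ν (z * s⁻¹ ^ (α / 2)))) + (1 - laplace ν z) =
      ∑' k, ENNReal.ofReal (Real.Gamma (1 - 2 / α) * interferenceTerm α ν z k) := by
  have := hν.prob
  have h2 : 2 / α < 1 := (div_lt_one (by linarith)).2 hα
  have h2' : 1 / (α / 2) = 2 / α := by rw [one_div_div]
  simp_rw [ofReal_interferenceTerm hα hν hz]
  rw [← lintegral_tsum (fun k => by fun_prop)]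
  simp_rw [hν.one_sub_laplace]
  rw [lintegral_lintegral_swap (by fun_prop), ← lintegral_add_right _ (by fun_prop)]
  refine lintegral_congr_ae ?_
  filter_upwards [hν.nonneg] with x hx
  have hc : 0 ≤ z * x := mul_nonneg hz.le hx
  have h := setLIntegral_Ioi_one_sub_exp (β := α / 2) (by linarith) hc
  rw [h2', setLIntegral_rpow_mul_exp (by linarith) hc] at h
  rw [← h]
  have hsub : ∀ t : ℝ, 0 ≤ t → 1 - expNeg (ENNReal.ofReal t) =
      ENNReal.ofReal (1 - Real.exp (-t)) := fun t ht => by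
    rw [expNeg_ofReal ht, ENNReal.ofReal_sub _ (Real.exp_pos _).le, ENNReal.ofReal_one]
  rw [hsub _ hc]
  congr 1
  refine setLIntegral_congr_fun measurableSet_Ioi fun s hs => ?_
  have hs0 : (0 : ℝ) < s := zero_lt_one.trans hs
  rw [mul_right_comm, hsub]
  exact mul_nonneg hc (by positivity)

lemma summable_interferenceTerm (hα : 2 < α) (hν : IsFadingLaw ν) {z : ℝ} (hz : 0 < z) :
    Summable (interferenceTerm α ν z) := by
  have h2 : 2 / α < 1 := (div_lt_one (by linarith)).2 hα
  have hG1 := Real.Gamma_pos_of_pos (show 0 < 1 - 2 / α by linarith)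
  have hlt : ∑' k, ENNReal.ofReal (Real.Gamma (1 - 2 / α) * interferenceTerm α ν z k) ≠ ∞ := by
    rw [← lintegral_one_sub_laplace_add hα hν hz]
    -- With `F = 0` only the integral remains in `integralZ`.
    have h := integralZ_ne_top (F := 0) hα hν hz.le
    rw [integralZ, Nat.cast_zero, zero_add] at h
    exact ENNReal.add_ne_top.2 ⟨h, (tsub_le_self.trans_lt ENNReal.one_lt_top).ne⟩
  have hs := ENNReal.summable_toReal hlt
  simp_rw [ENNReal.toReal_ofReal (mul_nonneg hG1.le (interferenceTerm_nonneg hα hν hz _))] at hs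
  exact (summable_mul_left_iff hG1.ne').1 hs

/-- The function `Z` is given by an integral. -/
lemma ofReal_reuseZ (hα : 2 < α) (hF : 1 ≤ F) (hν : IsFadingLaw ν) {z : ℝ} (hz : 0 < z) :
    ENNReal.ofReal (reuseZ α F ν z) = integralZ α F ν z := by
  have h2 : 2 / α < 1 := (div_lt_one (by linarith)).2 hα
  have hG1 := Real.Gamma_pos_of_pos (show 0 < 1 - 2 / α by linarith)
  have hs := (summable_interferenceTerm hα hν hz).mul_left (Real.Gamma (1 - 2 / α))
  have h := lintegral_one_sub_laplace_add hα hν hz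
  rw [← ENNReal.ofReal_tsum_of_nonneg
    (fun k => mul_nonneg hG1.le (interferenceTerm_nonneg hα hν hz k)) hs, tsum_mul_left,
    ← interferenceT] at h
  have hT : 0 ≤ interferenceT α ν z :=
    mul_nonneg hG1.le (tsum_nonneg (interferenceTerm_nonneg hα hν hz))
  have hM : 0 ≤ fadingMGF ν z := integral_nonneg fun x => (Real.exp_pos _).le
  have hF' : (0 : ℝ) ≤ F - 1 := by
    have : (1 : ℝ) ≤ F := by exact_mod_cast hF
    linarith
  have hFe : (F : ℝ≥0∞) = ENNReal.ofReal ((F : ℝ) - 1) + 1 := by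
    rw [← ENNReal.ofReal_one, ← ENNReal.ofReal_add hF' zero_le_one, sub_add_cancel,
      ENNReal.ofReal_natCast]
  have hL := hν.laplace_le_one z
  rw [reuseZ, ENNReal.ofReal_add (add_nonneg hF' hM) hT, ENNReal.ofReal_add hF' hM, ← h,
    hν.ofReal_fadingMGF hz.le, integralZ, hFe]
  -- `T` equals the integral plus `1 - M`, so the summand `M` of `Z` completes `F - 1` to `F`.
  have : laplace ν z + (1 - laplace ν z) = 1 := add_tsub_cancel_of_le hL
  calc _ = ENNReal.ofReal ((F : ℝ) - 1) + (laplace ν z + (1 - laplace ν z)) +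
        ∫⁻ s in Ioi (1 : ℝ), (1 - laplace ν (z * s⁻¹ ^ (α / 2))) := by ring
    _ = _ := by rw [this]

lemma one_le_reuseZ (hα : 2 < α) (hF : 1 ≤ F) (hν : IsFadingLaw ν) {z : ℝ} (hz : 0 < z) :
    1 ≤ reuseZ α F ν z := by
  rw [← ENNReal.one_le_ofReal, ofReal_reuseZ hα hF hν hz]
  exact le_trans (by exact_mod_cast hF) (natCast_le_integralZ z)

lemma exists_le_reuseZ (hα : 2 < α) (hF : 1 ≤ F) (hν : IsFadingLaw ν) :
    ∃ δ : ℝ, 0 < δ ∧ ∀ z, 1 ≤ z → δ * z ^ (2 / α) ≤ reuseZ α F ν z := by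
  obtain ⟨δ, hδ, h⟩ := exists_le_integralZ hα hF hν
  refine ⟨δ, hδ, fun z hz => ?_⟩
  have hz0 : 0 < z := zero_lt_one.trans_le hz
  have := h z hz
  rw [← ofReal_reuseZ hα hF hν hz0] at this
  exact (ENNReal.ofReal_le_ofReal_iff (zero_le_one.trans (one_le_reuseZ hα hF hν hz0))).1 this

lemma aemeasurable_reuseZ (hα : 2 < α) (hF : 1 ≤ F) (hν : IsFadingLaw ν) :
    AEMeasurable (reuseZ α F ν) (volume.restrict (Ioi 0)) := by
  refine ⟨fun z => (integralZ α F ν z).toReal, (measurable_integralZ hν).ennreal_toReal, ?_⟩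
  refine (ae_restrict_iff' measurableSet_Ioi).2 (ae_of_all _ fun z hz => ?_)
  simp only [← ofReal_reuseZ hα hF hν hz,
    ENNReal.toReal_ofReal (zero_le_one.trans (one_le_reuseZ hα hF hν hz))]

end Z

end Downlink

/-! ### Independence, thinning by bands, and the relative interference -/

namespace Downlink

lemma continuous_negLog : Continuous negLog :=
  EReal.continuous_toENNReal.comp (continuous_neg.comp ENNReal.continuous_log)

lemma negLog_antitone : Antitone negLog := fun x y h => by
  unfold negLog
  refine EReal.toENNReal_le_toENNReal ?_
  rw [EReal.neg_le_neg_iff]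
  exact ENNReal.log_monotone h

lemma lintegral_of_indepFun {Ω β γ : Type*} [MeasurableSpace Ω] [MeasurableSpace β]
    [MeasurableSpace γ] {μ : Measure Ω} [IsProbabilityMeasure μ] {Y : Ω → β} {Y' : Ω → γ}
    (hY : Measurable Y) (hY' : Measurable Y') (h : IndepFun Y Y' μ) {H : β → γ → ℝ≥0∞}
    (hH : Measurable (Function.uncurry H)) :
    ∫⁻ ω, H (Y ω) (Y' ω) ∂μ = ∫⁻ ω, ∫⁻ ω', H (Y ω) (Y' ω') ∂μ ∂μ := by
  have : IsProbabilityMeasure (μ.map Y') := Measure.isProbabilityMeasure_map hY'.aemeasurable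
  have h1 := (indepFun_iff_map_prod_eq_prod_map_map hY.aemeasurable hY'.aemeasurable).1 h
  calc ∫⁻ ω, H (Y ω) (Y' ω) ∂μ
      = ∫⁻ p, Function.uncurry H p ∂(μ.map fun ω => (Y ω, Y' ω)) :=
        (lintegral_map hH (hY.prodMk hY')).symm
    _ = ∫⁻ y, ∫⁻ y', H y y' ∂(μ.map Y') ∂(μ.map Y) := by
        rw [h1, lintegral_prod _ hH.aemeasurable]; rfl
    _ = ∫⁻ ω, ∫⁻ y', H (Y ω) y' ∂(μ.map Y') ∂μ :=
        lintegral_map hH.lintegral_prod_right' hY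
    _ = _ := lintegral_congr fun ω => lintegral_map (hH.comp measurable_prodMk_left) hY'

/-- The Laplace transform of the gain of a base station that is counted with probability `1 / F`. -/
noncomputable def thinnedLaplace (F : ℕ) (ν : Measure ℝ) (s : ℝ) : ℝ≥0∞ :=
  (1 - (F : ℝ≥0∞)⁻¹) + (F : ℝ≥0∞)⁻¹ * laplace ν s

section Thinned

variable {F : ℕ} {ν : Measure ℝ}

lemma inv_natCast_le_one (hF : 1 ≤ F) : (F : ℝ≥0∞)⁻¹ ≤ 1 :=
  ENNReal.inv_le_one.2 (by exact_mod_cast hF)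

lemma thinnedLaplace_le_one (hF : 1 ≤ F) (hν : IsFadingLaw ν) (s : ℝ) :
    thinnedLaplace F ν s ≤ 1 := by
  calc thinnedLaplace F ν s ≤ (1 - (F : ℝ≥0∞)⁻¹) + (F : ℝ≥0∞)⁻¹ * 1 :=
        add_le_add_right (mul_le_mul_right (hν.laplace_le_one s) _) _
    _ = 1 := by rw [mul_one, tsub_add_cancel_of_le (inv_natCast_le_one hF)]

/-- Random band choice only scales the deficit `1 - M` by `1 / F`. This is the source of the
effective density `λ / F`. -/
lemma one_sub_thinnedLaplace (hF : 1 ≤ F) (hν : IsFadingLaw ν) (s : ℝ) :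
    1 - thinnedLaplace F ν s = (F : ℝ≥0∞)⁻¹ * (1 - laplace ν s) := by
  have h1 := inv_natCast_le_one hF
  refine ENNReal.sub_eq_of_eq_add_rev
    ((thinnedLaplace_le_one hF hν s).trans_lt ENNReal.one_lt_top).ne ?_
  rw [thinnedLaplace, add_assoc, ← mul_add, add_tsub_cancel_of_le (hν.laplace_le_one s), mul_one,
    tsub_add_cancel_of_le h1]

lemma continuous_thinnedLaplace (hF : 1 ≤ F) (hν : IsFadingLaw ν) :
    Continuous (thinnedLaplace F ν) := by
  have hne : (F : ℝ≥0∞)⁻¹ ≠ ∞ := ((inv_natCast_le_one hF).trans_lt ENNReal.one_lt_top).ne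
  exact continuous_const.add ((ENNReal.continuous_const_mul hne).comp hν.continuous_laplace)

lemma thinnedLaplace_antitone (hν : IsFadingLaw ν) : Antitone (thinnedLaplace F ν) :=
  fun _ _ h => add_le_add_right (mul_le_mul_right (hν.laplace_antitone h) _) _

end Thinned

/-- The aggregate interference relative to the mean power of the serving link, for base stations
at `x`, gains `g` and bands `κ`, as an element of `[0, ∞]`. -/
noncomputable def relInterference {F : ℕ} (α : ℝ) (k : Fin F) (x : ℕ → EuclideanSpace ℝ (Fin 2))
    (κ : ℕ → Fin F) (g : ℕ → ℝ) : ℝ≥0∞ :=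
  ∑' b, if ⨅ b, ‖x b‖ < ‖x b‖ then
    (if κ b = k then ENNReal.ofReal ((((⨅ b, ‖x b‖) / ‖x b‖) ^ 2) ^ (α / 2) * g b) else 0) else 0

lemma measurable_relInterference {F : ℕ} (α : ℝ) (k : Fin F) :
    Measurable fun t : (ℕ → EuclideanSpace ℝ (Fin 2)) × (ℕ → Fin F) × (ℕ → ℝ) =>
      relInterference α k t.1 t.2.1 t.2.2 := by
  have hD : Measurable fun t : (ℕ → EuclideanSpace ℝ (Fin 2)) × (ℕ → Fin F) × (ℕ → ℝ) =>
      ⨅ b, ‖t.1 b‖ := measurable_iInf_norm.comp measurable_fst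
  refine Measurable.tsum fun b => Measurable.ite (measurableSet_lt hD (by fun_prop))
    (Measurable.ite ?_ ?_ measurable_const) measurable_const
  · have : Measurable fun t : (ℕ → EuclideanSpace ℝ (Fin 2)) × (ℕ → Fin F) × (ℕ → ℝ) => t.2.1 b :=
      by fun_prop
    exact this (measurableSet_singleton k)
  · have hx : Measurable fun t : (ℕ → EuclideanSpace ℝ (Fin 2)) × (ℕ → Fin F) × (ℕ → ℝ) =>
      ‖t.1 b‖ := by fun_prop
    have hg : Measurable fun t : (ℕ → EuclideanSpace ℝ (Fin 2)) × (ℕ → Fin F) × (ℕ → ℝ) =>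
      t.2.2 b := by fun_prop
    exact ((((hD.div hx).pow_const 2).pow_const _).mul hg).ennreal_ofReal

namespace Network

variable {lam : ℝ} {F : ℕ} {ν₀ νI : Measure ℝ} (N : Network.{u} lam F ν₀ νI)

lemma lintegral_comp_g (b : ℕ) {f : ℝ → ℝ≥0∞} (hf : Measurable f) :
    ∫⁻ ω, f (N.g b ω) ∂N.P = ∫⁻ x, f x ∂νI := by
  rw [← lintegral_map hf (N.measurable_g b), N.law_g]

lemma lintegral_band (b : ℕ) (c : ℝ≥0∞) :
    ∫⁻ ω, (if N.band b ω = N.servingBand then c else 1) ∂N.P =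
      (1 - (F : ℝ≥0∞)⁻¹) + (F : ℝ≥0∞)⁻¹ * c := by
  have hm : MeasurableSet {ω | N.band b ω = N.servingBand} :=
    N.measurable_band b (measurableSet_singleton _)
  have h1 : ∫⁻ ω in {ω | N.band b ω = N.servingBand},
      (if N.band b ω = N.servingBand then c else 1) ∂N.P =
      ∫⁻ _ in {ω | N.band b ω = N.servingBand}, c ∂N.P :=
    setLIntegral_congr_fun hm fun ω hω => if_pos hω
  have h2 : ∫⁻ ω in {ω | N.band b ω = N.servingBand}ᶜ,
      (if N.band b ω = N.servingBand then c else 1) ∂N.P =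
      ∫⁻ _ in {ω | N.band b ω = N.servingBand}ᶜ, 1 ∂N.P :=
    setLIntegral_congr_fun hm.compl fun ω hω => if_neg hω
  rw [← lintegral_add_compl _ hm, h1, h2, add_comm, setLIntegral_const, setLIntegral_const,
    prob_compl_eq_one_sub hm, N.law_band, one_mul, mul_comm c]

/-- The Laplace transform of the relative interference, given the positions. -/
lemma lintegral_expNeg_relInterference (hF : 1 ≤ F) (hνI : IsFadingLaw νI) (α : ℝ) {z : ℝ}
    (hz : 0 ≤ z) (x : ℕ → EuclideanSpace ℝ (Fin 2)) :
    ∫⁻ ω, ∫⁻ ω', expNeg (ENNReal.ofReal z * relInterference α N.servingBand x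
        (fun b => N.band b ω) (fun b => N.g b ω')) ∂N.P ∂N.P =
      expNeg (∑' b, if ⨅ b, ‖x b‖ < ‖x b‖ then negLog (thinnedLaplace F νI
        (z * (((⨅ b, ‖x b‖) / ‖x b‖) ^ 2) ^ (α / 2))) else 0) := by
  set D := ⨅ b, ‖x b‖ with hD
  let t : ℕ → ℝ := fun b => ((D / ‖x b‖) ^ 2) ^ (α / 2)
  -- The gains are averaged first with the bands frozen, then the bands. Each time independence
  -- across stations factorizes the exponential.
  have inner : ∀ κ : ℕ → Fin F, ∫⁻ ω', expNeg (ENNReal.ofReal z *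
      relInterference α N.servingBand x κ (fun b => N.g b ω')) ∂N.P =
      expNeg (∑' b, if D < ‖x b‖ then
        (if κ b = N.servingBand then negLog (laplace νI (z * t b)) else 0) else 0) := by
    intro κ
    simp_rw [relInterference, ← ENNReal.tsum_mul_left]
    refine lintegral_expNeg_tsum_of_iIndepFun N.iIndep_g N.measurable_g
      (fun b y => ENNReal.ofReal z * if D < ‖x b‖ then
        (if κ b = N.servingBand then ENNReal.ofReal (t b * y) else 0) else 0) (fun b => ?_) _
      (fun b => ?_)
    · split_ifs <;> fun_prop
    · split_ifs with h1 h2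
      · rw [expNeg_negLog (hνI.laplace_le_one _), N.lintegral_comp_g b
          (f := fun y => expNeg (ENNReal.ofReal z * ENNReal.ofReal (t b * y))) (by fun_prop)]
        simp_rw [← ENNReal.ofReal_mul hz, ← mul_assoc]
        rfl
      · simp
      · simp
  simp_rw [inner]
  refine lintegral_expNeg_tsum_of_iIndepFun N.iIndep_band N.measurable_band
    (fun b j => if D < ‖x b‖ then
        (if j = N.servingBand then negLog (laplace νI (z * t b)) else 0) else 0)
    (fun b => measurable_from_top) _ (fun b => ?_)
  split_ifs with h1
  · rw [expNeg_negLog (thinnedLaplace_le_one hF hνI _), thinnedLaplace, ← N.lintegral_band b]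
    refine lintegral_congr fun ω => ?_
    split_ifs
    · exact expNeg_negLog (hνI.laplace_le_one _)
    · exact expNeg_zero
  · simp

end Network

end Downlink

/-! ### Expectation of the integral representation -/

namespace Downlink

/-- Only `X ⊥ (Y, Y')` and `Y ⊥ Y'` are given. With `X` frozen, `A (Y)` and `B (x, Y')` are
independent, and integrating over `X` keeps the factor of `Y`. Applied with `Y` the serving gain. -/
lemma lintegral_mul_of_indepFun {Ω β γ δ : Type*} [MeasurableSpace Ω] [MeasurableSpace β]
    [MeasurableSpace γ] [MeasurableSpace δ] {μ : Measure Ω} [IsProbabilityMeasure μ]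
    {X : Ω → β} {Y : Ω → γ} {Y' : Ω → δ} (hX : Measurable X) (hY : Measurable Y)
    (hY' : Measurable Y') (h : IndepFun X (fun ω => (Y ω, Y' ω)) μ) (h' : IndepFun Y Y' μ)
    {A : γ → ℝ≥0∞} {B : β → δ → ℝ≥0∞} (hA : Measurable A) (hB : Measurable (Function.uncurry B)) :
    ∫⁻ ω, A (Y ω) * B (X ω) (Y' ω) ∂μ = (∫⁻ ω, A (Y ω) ∂μ) * ∫⁻ ω, B (X ω) (Y' ω) ∂μ := by
  have hBx : ∀ x, Measurable fun ω => B x (Y' ω) := fun x =>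
    hB.comp (measurable_prodMk_left.comp hY')
  have hBB : Measurable fun p : β × Ω => B p.1 (Y' p.2) :=
    hB.comp (measurable_fst.prodMk (hY'.comp measurable_snd))
  have hBBX : Measurable fun ω => ∫⁻ ω', B (X ω) (Y' ω') ∂μ := hBB.lintegral_prod_right'.comp hX
  rw [lintegral_of_indepFun hX (hY.prodMk hY') h (H := fun x t => A t.1 * B x t.2)
      ((hA.comp (measurable_fst.comp measurable_snd)).mul
        (hB.comp (measurable_fst.prodMk (measurable_snd.comp measurable_snd)))),
    lintegral_of_indepFun hX hY' (h.comp measurable_id measurable_snd) hB,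
    ← lintegral_const_mul _ hBBX]
  refine lintegral_congr fun ω => ?_
  exact lintegral_mul_eq_lintegral_mul_lintegral_of_indepFun (hA.comp hY) (hBx _)
    (h'.comp hA (hB.comp measurable_prodMk_left))

/-- The integral `c ∫₀^∞ exp (-c Z ξ - σ z ξ^(α/2)) dξ`, with values in `[0, ∞]`. -/
noncomputable def rateWeight (α c σ Z z : ℝ) : ℝ≥0∞ :=
  ∫⁻ ξ in Ioi (0 : ℝ), ENNReal.ofReal
    (c * (Real.exp (-(c * Z * ξ)) * Real.exp (-(σ * z * ξ ^ (α / 2)))))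

lemma rateWeight_zero_noise {α c Z : ℝ} (hc : 0 < c) (hZ : 0 < Z) (z : ℝ) :
    rateWeight α c 0 Z z = ENNReal.ofReal (1 / Z) := by
  have h : ∀ ξ : ℝ, ENNReal.ofReal (c * (Real.exp (-(c * Z * ξ)) *
      Real.exp (-(0 * z * ξ ^ (α / 2))))) =
      ENNReal.ofReal c * ENNReal.ofReal (Real.exp (-(ξ * (c * Z)))) := fun ξ => by
    rw [← ENNReal.ofReal_mul hc.le, mul_comm ξ]; simp
  simp_rw [rateWeight, h]
  rw [lintegral_const_mul _ (by fun_prop), setLIntegral_Ioi_exp (mul_pos hc hZ),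
    ← ENNReal.ofReal_mul hc.le]
  congr 1
  field_simp

namespace Network

variable {lam : ℝ} {F : ℕ} {ν₀ νI : Measure ℝ} (N : Network.{u} lam F ν₀ νI)

/-- The interference relative to the mean power of the serving link. -/
noncomputable def relativeInterference (α : ℝ) (ω : N.Ω) : ℝ≥0∞ :=
  relInterference α N.servingBand (fun b => N.X b ω) (fun b => N.band b ω) (fun b => N.g b ω)

lemma measurable_servingDist : Measurable N.servingDist :=
  measurable_iInf_norm.comp (measurable_pi_lambda _ N.poisson.measurable)

lemma measurable_relativeInterference (α : ℝ) : Measurable (N.relativeInterference α) := by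
  have hX : Measurable fun ω b => N.X b ω := measurable_pi_lambda _ N.poisson.measurable
  have hg : Measurable fun ω b => N.g b ω := measurable_pi_lambda _ N.measurable_g
  have hb : Measurable fun ω b => N.band b ω := measurable_pi_lambda _ N.measurable_band
  have h := (measurable_relInterference α N.servingBand).comp (hX.prodMk (hb.prodMk hg))
  have e : (fun ω => N.relativeInterference α ω) = (fun t : (ℕ → EuclideanSpace ℝ (Fin 2)) ×
      (ℕ → Fin F) × (ℕ → ℝ) => relInterference α N.servingBand t.1 t.2.1 t.2.2) ∘
      fun ω => ((fun b => N.X b ω), (fun b => N.band b ω), (fun b => N.g b ω)) := by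
    ext ω
    rw [relativeInterference, Function.comp_apply]
  rw [← e] at h
  exact h

/-- Averaging gains and bands at fixed positions leaves a sum of costs over the stations beyond the
nearest, to which `lintegral_nearest_sq` applies. The exponents add up as `πλξ + πλξ (Z - F) / F = c
Z ξ` with `c = πλ / F`; the density prefactor `πλ = F c` accounts for the factor `F`. -/
lemma lintegral_noise_interference {α σ z : ℝ} (hα : 2 < α) (hF : 1 ≤ F) (hνI : IsFadingLaw νI)
    (hlam : 0 < lam) (hσ : 0 ≤ σ) (hz : 0 < z) :
    ∫⁻ ω, expNeg (ENNReal.ofReal (z * σ * (N.servingDist ω ^ 2) ^ (α / 2))) *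
        expNeg (ENNReal.ofReal z * N.relativeInterference α ω) ∂N.P =
      F * rateWeight α (Real.pi * (lam / F)) σ (reuseZ α F νI z) z := by
  let Q : ℝ → ℝ≥0∞ := fun ξ => expNeg (ENNReal.ofReal (z * σ * ξ ^ (α / 2)))
  let v : ℝ → ℝ≥0∞ := fun t => negLog (thinnedLaplace F νI (z * t ^ (α / 2)))
  have hα0 : 0 ≤ α / 2 := by linarith
  have hrpow : Continuous fun t : ℝ => t ^ (α / 2) := Real.continuous_rpow_const hα0
  have hQ : Continuous Q := continuous_expNeg.comp (ENNReal.continuous_ofReal.comp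
    (continuous_const.mul hrpow))
  have hv : Continuous v := continuous_negLog.comp ((continuous_thinnedLaplace hF hνI).comp
    (continuous_const.mul hrpow))
  have hvmono : MonotoneOn v (Ici 0) := fun a ha b hb hab =>
    negLog_antitone (thinnedLaplace_antitone hνI
      (mul_le_mul_of_nonneg_left (Real.rpow_le_rpow ha hab hα0) hz.le))
  have hX : Measurable fun ω b => N.X b ω := measurable_pi_lambda _ N.poisson.measurable
  have hg : Measurable fun ω b => N.g b ω := measurable_pi_lambda _ N.measurable_g
  have hb : Measurable fun ω b => N.band b ω := measurable_pi_lambda _ N.measurable_band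
  have hH := measurable_relInterference (F := F) α N.servingBand
  have indXm : IndepFun (fun ω b => N.X b ω)
      (fun ω => ((fun b => N.band b ω), (fun b => N.g b ω))) N.P :=
    N.indep_X.comp (φ := id) (ψ := fun t : ℝ × (ℕ → ℝ) × (ℕ → Fin F) => (t.2.2, t.2.1))
      measurable_id (by fun_prop)
  have hA : Measurable fun x : ℕ → EuclideanSpace ℝ (Fin 2) => Q ((⨅ b, ‖x b‖) ^ 2) :=
    hQ.measurable.comp (measurable_iInf_norm.pow_const 2)
  have step1 : ∫⁻ ω, Q (N.servingDist ω ^ 2) *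
      expNeg (ENNReal.ofReal z * N.relativeInterference α ω) ∂N.P =
      ∫⁻ ω, Q (N.servingDist ω ^ 2) * expNeg (∑' b, if ⨅ b, ‖N.X b ω‖ < ‖N.X b ω‖ then
        v (((⨅ b, ‖N.X b ω‖) / ‖N.X b ω‖) ^ 2) else 0) ∂N.P := by
    have h1 := lintegral_of_indepFun hX (hb.prodMk hg) indXm
      (H := fun x t => Q ((⨅ b, ‖x b‖) ^ 2) *
        expNeg (ENNReal.ofReal z * relInterference α N.servingBand x t.1 t.2))
      ((hA.comp measurable_fst).mul (measurable_expNeg.comp (hH.const_mul _)))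
    refine h1.trans (lintegral_congr fun ω => ?_)
    have hQt : Q ((⨅ b, ‖N.X b ω‖) ^ 2) ≠ ∞ := expNeg_ne_top _
    rw [lintegral_const_mul' _ _ hQt, lintegral_of_indepFun hb hg N.indep_g_band.symm
      (H := fun κ g => expNeg (ENNReal.ofReal z *
        relInterference α N.servingBand (fun b => N.X b ω) κ g))
      (measurable_expNeg.comp ((hH.comp measurable_prodMk_left).const_mul _)),
      N.lintegral_expNeg_relInterference hF hνI α hz.le]
    rfl
  have step2 := N.poisson.lintegral_nearest_sq hlam (q := Q) (v := v) hQ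
    (fun _ => expNeg_le_one _) hv hvmono
  refine step1.trans (step2.trans ?_)
  have hF0 : (0 : ℝ) < F := by exact_mod_cast hF
  have hZ := one_le_reuseZ hα hF hνI hz
  -- The thinned deficit is `1 / F` times that of the gain, whose integral over `s > 1` is `Z - F`.
  have hW : ∫⁻ s in Ioi (1 : ℝ), (1 - expNeg (v s⁻¹)) =
      ENNReal.ofReal ((reuseZ α F νI z - F) / F) := by
    simp_rw [v, expNeg_negLog (thinnedLaplace_le_one hF hνI _), one_sub_thinnedLaplace hF hνI]
    rw [lintegral_const_mul' _ _ ((inv_natCast_le_one hF).trans_lt ENNReal.one_lt_top).ne]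
    have h := ofReal_reuseZ hα hF hνI hz
    rw [integralZ] at h
    have h2 : ∫⁻ s in Ioi (1 : ℝ), (1 - laplace νI (z * s⁻¹ ^ (α / 2))) =
        ENNReal.ofReal (reuseZ α F νI z - F) := by
      rw [ENNReal.ofReal_sub _ hF0.le, h, ENNReal.ofReal_natCast,
        ENNReal.add_sub_cancel_left (ENNReal.natCast_ne_top F)]
    rw [h2, ENNReal.ofReal_div_of_pos hF0, ENNReal.ofReal_natCast, ENNReal.div_eq_inv_mul]
  have hFZ : (F : ℝ) ≤ reuseZ α F νI z := by
    have := natCast_le_integralZ (α := α) (F := F) (ν := νI) z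
    rwa [← ofReal_reuseZ hα hF hνI hz, ← ENNReal.ofReal_natCast,
      ENNReal.ofReal_le_ofReal_iff (by linarith)] at this
  rw [hW, rateWeight, ← lintegral_const_mul' _ _ (ENNReal.natCast_ne_top F)]
  refine setLIntegral_congr_fun measurableSet_Ioi fun ξ hξ => ?_
  have hξ : 0 < ξ := hξ
  have hπ := Real.pi_pos
  have hd : 0 ≤ (reuseZ α F νI z - F) / F := div_nonneg (by linarith) hF0.le
  simp only [Q]
  rw [← ENNReal.ofReal_mul (by positivity), expNeg_ofReal (by positivity),
    expNeg_ofReal (by positivity), ← ENNReal.ofReal_mul (Real.exp_pos _).le,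
    ← ENNReal.ofReal_mul (by positivity), ← ENNReal.ofReal_natCast,
    ← ENNReal.ofReal_mul hF0.le]
  congr 1
  have e : Real.exp (-(Real.pi * (lam / F) * reuseZ α F νI z * ξ)) =
      Real.exp (-(Real.pi * lam * ξ)) *
        Real.exp (-(Real.pi * lam * ξ * ((reuseZ α F νI z - F) / F))) := by
    rw [← Real.exp_add]
    congr 1
    field_simp
    ring
  have e2 : (F : ℝ) * (Real.pi * (lam / F)) = Real.pi * lam := by field_simp
  rw [e, ← e2, mul_comm z σ]
  ring

/-- The integrand of the representation of the rate as a mixture of exponentials. -/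
noncomputable def logIntegrand (α σ : ℝ) (ω : N.Ω) (z : ℝ) : ℝ≥0∞ :=
  ENNReal.ofReal ((1 - Real.exp (-(z * N.g₀ ω))) / z) *
    (expNeg (ENNReal.ofReal (z * σ * (N.servingDist ω ^ 2) ^ (α / 2))) *
      expNeg (ENNReal.ofReal z * N.relativeInterference α ω))

lemma measurable_logIntegrand (α σ : ℝ) :
    Measurable fun p : N.Ω × ℝ => N.logIntegrand α σ p.1 p.2 := by
  have h0 : Measurable fun p : N.Ω × ℝ => N.g₀ p.1 := N.measurable_g₀.comp measurable_fst
  have hD : Measurable fun p : N.Ω × ℝ => N.servingDist p.1 :=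
    N.measurable_servingDist.comp measurable_fst
  have hS : Measurable fun p : N.Ω × ℝ => N.relativeInterference α p.1 :=
    (N.measurable_relativeInterference α).comp measurable_fst
  have hz : Measurable fun p : N.Ω × ℝ => p.2 := measurable_snd
  refine Measurable.mul ?_ (Measurable.mul ?_ ?_)
  · exact (((measurable_const.sub (hz.mul h0).neg.exp).div hz)).ennreal_ofReal
  · exact measurable_expNeg.comp
      ((hz.mul_const σ).mul ((hD.pow_const 2).pow_const _)).ennreal_ofReal
  · exact measurable_expNeg.comp (hz.ennreal_ofReal.mul hS)

lemma lintegral_one_sub_exp_g₀ (hν₀ : IsFadingLaw ν₀) {z : ℝ} (hz : 0 < z) :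
    ∫⁻ ω, ENNReal.ofReal ((1 - Real.exp (-(z * N.g₀ ω))) / z) ∂N.P =
      ENNReal.ofReal ((1 - fadingMGF ν₀ z) / z) := by
  have := hν₀.prob
  have hm : Measurable fun x : ℝ => ENNReal.ofReal ((1 - Real.exp (-(z * x))) / z) := by fun_prop
  have h1 : ∫⁻ ω, ENNReal.ofReal ((1 - Real.exp (-(z * N.g₀ ω))) / z) ∂N.P =
      ∫⁻ x, ENNReal.ofReal ((1 - Real.exp (-(z * x))) / z) ∂ν₀ := by
    rw [← lintegral_map hm N.measurable_g₀, N.law_g₀]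
  have h2 : ∀ᵐ x ∂ν₀, ENNReal.ofReal ((1 - Real.exp (-(z * x))) / z) =
      (ENNReal.ofReal z)⁻¹ * (1 - expNeg (ENNReal.ofReal (z * x))) := by
    filter_upwards [hν₀.nonneg] with x hx
    rw [expNeg_ofReal (mul_nonneg hz.le hx), ← ENNReal.ofReal_one,
      ← ENNReal.ofReal_sub _ (Real.exp_pos _).le, ENNReal.ofReal_div_of_pos hz,
      ENNReal.div_eq_inv_mul]
  have hM : 0 ≤ fadingMGF ν₀ z := integral_nonneg fun x => (Real.exp_pos _).le
  rw [h1, lintegral_congr_ae h2, lintegral_const_mul _ (by fun_prop), ← hν₀.one_sub_laplace,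
    ← hν₀.ofReal_fadingMGF hz.le, ← ENNReal.ofReal_one, ← ENNReal.ofReal_sub _ hM,
    ENNReal.ofReal_div_of_pos hz, ENNReal.div_eq_inv_mul]

/-- The expectation of the integral representation of the rate. -/
lemma lintegral_logIntegrand {α σ : ℝ} (hα : 2 < α) (hF : 1 ≤ F) (hν₀ : IsFadingLaw ν₀)
    (hνI : IsFadingLaw νI) (hlam : 0 < lam) (hσ : 0 ≤ σ) :
    ∫⁻ ω, (∫⁻ z in Ioi (0 : ℝ), N.logIntegrand α σ ω z) ∂N.P =
      F * ∫⁻ z in Ioi (0 : ℝ), ENNReal.ofReal ((1 - fadingMGF ν₀ z) / z) *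
        rateWeight α (Real.pi * (lam / F)) σ (reuseZ α F νI z) z := by
  rw [lintegral_lintegral_swap (N.measurable_logIntegrand α σ).aemeasurable,
    ← lintegral_const_mul' _ _ (ENNReal.natCast_ne_top F)]
  refine setLIntegral_congr_fun measurableSet_Ioi fun z hz => ?_
  have hz : 0 < z := hz
  have hX : Measurable fun ω b => N.X b ω := measurable_pi_lambda _ N.poisson.measurable
  have hg : Measurable fun ω b => N.g b ω := measurable_pi_lambda _ N.measurable_g
  have hb : Measurable fun ω b => N.band b ω := measurable_pi_lambda _ N.measurable_band
  have hgb : Measurable fun ω => ((fun b => N.g b ω), (fun b => N.band b ω)) := hg.prodMk hb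
  have hH := measurable_relInterference (F := F) α N.servingBand
  have h := lintegral_mul_of_indepFun hX N.measurable_g₀ hgb N.indep_X N.indep_g₀
    (A := fun x => ENNReal.ofReal ((1 - Real.exp (-(z * x))) / z))
    (B := fun x t => expNeg (ENNReal.ofReal (z * σ * ((⨅ b, ‖x b‖) ^ 2) ^ (α / 2))) *
      expNeg (ENNReal.ofReal z * relInterference α N.servingBand x t.2 t.1)) (by fun_prop) ?_
  · refine h.trans ?_
    rw [N.lintegral_one_sub_exp_g₀ hν₀ hz]
    have := N.lintegral_noise_interference hα hF hνI hlam hσ hz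
    refine (congrArg _ this).trans ?_
    ring
  · refine Measurable.mul (measurable_expNeg.comp ?_) (measurable_expNeg.comp ?_)
    · exact ((((measurable_iInf_norm.comp measurable_fst).pow_const 2).pow_const _).const_mul
        (z * σ)).ennreal_ofReal
    · have : Measurable fun p : (ℕ → EuclideanSpace ℝ (Fin 2)) × (ℕ → ℝ) × (ℕ → Fin F) =>
        (p.1, p.2.2, p.2.1) := by fun_prop
      exact (hH.comp this).const_mul _

end Network

end Downlink

/-! ### Upper bounds and integrability -/

namespace Downlink

section Weight

variable {α c σ Z : ℝ}

lemma rateWeight_le (hc : 0 < c) (hZ : 0 < Z) (hσ : 0 ≤ σ) {z : ℝ} (hz : 0 ≤ z) :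
    rateWeight α c σ Z z ≤ ENNReal.ofReal (1 / Z) := by
  rw [← rateWeight_zero_noise (α := α) hc hZ z]
  refine setLIntegral_mono' measurableSet_Ioi fun ξ hξ => ENNReal.ofReal_le_ofReal ?_
  have hξ : 0 < ξ := hξ
  gcongr

lemma limitIntegrand_eq (M Z : ℝ → ℝ) (z : ℝ) :
    limitIntegrand M Z z = (1 - M z) / z * (1 / Z z) := by
  rw [limitIntegrand]; ring

end Weight

section Bounds

variable {α : ℝ} {F : ℕ} {ν₀ νI : Measure ℝ}

lemma IsFadingLaw.fadingMGF_le_one {ν : Measure ℝ} (hν : IsFadingLaw ν) {z : ℝ} (hz : 0 ≤ z) :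
    fadingMGF ν z ≤ 1 := by
  rw [← ENNReal.ofReal_le_one, hν.ofReal_fadingMGF hz]
  exact hν.laplace_le_one z

lemma IsFadingLaw.one_sub_fadingMGF_le {ν : Measure ℝ} (hν : IsFadingLaw ν) {z : ℝ} (hz : 0 ≤ z) :
    1 - fadingMGF ν z ≤ z := by
  have hM : 0 ≤ fadingMGF ν z := integral_nonneg fun x => (Real.exp_pos _).le
  rw [← ENNReal.ofReal_le_ofReal_iff hz, ENNReal.ofReal_sub _ hM, ENNReal.ofReal_one,
    hν.ofReal_fadingMGF hz]
  exact hν.one_sub_laplace_le hz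

lemma IsFadingLaw.aemeasurable_fadingMGF {ν : Measure ℝ} (hν : IsFadingLaw ν) :
    AEMeasurable (fadingMGF ν) (volume.restrict (Ioi 0)) := by
  refine ⟨fun z => (laplace ν z).toReal, hν.continuous_laplace.measurable.ennreal_toReal, ?_⟩
  refine (ae_restrict_iff' measurableSet_Ioi).2 (ae_of_all _ fun z hz => ?_)
  have hM : 0 ≤ fadingMGF ν z := integral_nonneg fun x => (Real.exp_pos _).le
  simp only [← hν.ofReal_fadingMGF (le_of_lt hz.out), ENNReal.toReal_ofReal hM]

/-- A function on the half-line that is bounded near zero and decays like a power that is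
integrable at infinity is integrable. -/
lemma integrableOn_of_le_rpow {f : ℝ → ℝ} (hf : AEMeasurable f (volume.restrict (Ioi 0)))
    {C a : ℝ} (ha : a < -1) (h0 : ∀ z ∈ Ioc (0 : ℝ) 1, |f z| ≤ 1)
    (h1 : ∀ z ∈ Ioi (1 : ℝ), |f z| ≤ C * z ^ a) : IntegrableOn f (Ioi 0) := by
  rw [← Ioc_union_Ioi_eq_Ioi zero_le_one]
  refine IntegrableOn.union ?_ ?_
  · refine Integrable.of_bound ((hf.mono_measure (Measure.restrict_mono
      Ioc_subset_Ioi_self le_rfl)).aestronglyMeasurable) 1 ?_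
    exact (ae_restrict_iff' measurableSet_Ioc).2 (ae_of_all _ h0)
  · refine Integrable.mono' ((integrableOn_Ioi_rpow_of_lt ha one_pos).const_mul C)
      ((hf.mono_measure (Measure.restrict_mono
        (Ioi_subset_Ioi zero_le_one) le_rfl)).aestronglyMeasurable) ?_
    exact (ae_restrict_iff' measurableSet_Ioi).2 (ae_of_all _ h1)

/-- Near zero `1 - M₀(z) ≤ z` and `Z ≥ 1` bound the integrand by 1. Beyond 1 the growth `Z ≥ δ
z^(2/α)` gives decay of order `z^(-1-2/α)`. -/
lemma integrableOn_limitIntegrand (hα : 2 < α) (hF : 1 ≤ F) (hν₀ : IsFadingLaw ν₀)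
    (hνI : IsFadingLaw νI) :
    IntegrableOn (limitIntegrand (fadingMGF ν₀) (reuseZ α F νI)) (Ioi 0) := by
  obtain ⟨δ, hδ, hle⟩ := exists_le_reuseZ hα hF hνI
  have hα2 : 0 < 2 / α := by positivity
  have hnn : ∀ z, 0 < z → 0 ≤ limitIntegrand (fadingMGF ν₀) (reuseZ α F νI) z := fun z hz =>
    mul_nonneg (div_nonneg (sub_nonneg.2 (hν₀.fadingMGF_le_one hz.le))
      (zero_le_one.trans (one_le_reuseZ hα hF hνI hz))) (by positivity)
  refine integrableOn_of_le_rpow (C := δ⁻¹) (a := -(2 / α) - 1) ?_ (by linarith)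
    (fun z hz => ?_) (fun z hz => ?_)
  · exact ((aemeasurable_const.sub hν₀.aemeasurable_fadingMGF).div
      (aemeasurable_reuseZ hα hF hνI)).mul (by fun_prop)
  · have hz0 := hz.1
    have hZ := one_le_reuseZ hα hF hνI hz0
    rw [abs_of_nonneg (hnn z hz0), limitIntegrand_eq]
    refine mul_le_one₀ ((div_le_one hz0).2 (hν₀.one_sub_fadingMGF_le hz0.le)) (by positivity) ?_
    exact (div_le_one (by linarith)).2 hZ
  · have hz1 : 1 < z := hz
    have hz0 : 0 < z := zero_lt_one.trans hz1
    have hM : 0 ≤ fadingMGF ν₀ z := integral_nonneg fun x => (Real.exp_pos _).le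
    have hzp : 0 < z ^ (2 / α) := Real.rpow_pos_of_pos hz0 _
    have e : δ⁻¹ * z ^ (-(2 / α) - 1) = 1 / (δ * z ^ (2 / α)) * (1 / z) := by
      rw [Real.rpow_sub hz0, Real.rpow_neg hz0.le, Real.rpow_one]
      field_simp
    rw [abs_of_nonneg (hnn z hz0), limitIntegrand, e]
    refine mul_le_mul_of_nonneg_right ?_ (by positivity)
    exact div_le_div₀ zero_le_one (by linarith) (by positivity) (hle z hz1.le)

/-- There is no factor `1 / z` here, but `Z^(1+α/2)` grows at least like `z^(2/α+1)`, so the decay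
exponent is the same as for the limiting rate. -/
lemma integrableOn_correctionIntegrand (hα : 2 < α) (hF : 1 ≤ F) (hν₀ : IsFadingLaw ν₀)
    (hνI : IsFadingLaw νI) :
    IntegrableOn (correctionIntegrand α (fadingMGF ν₀) (reuseZ α F νI)) (Ioi 0) := by
  obtain ⟨δ, hδ, hle⟩ := exists_le_reuseZ hα hF hνI
  have hα2 : 0 < 2 / α := by positivity
  have hnn : ∀ z, 0 < z → 0 ≤ correctionIntegrand α (fadingMGF ν₀) (reuseZ α F νI) z :=
    fun z hz => div_nonneg (sub_nonneg.2 (hν₀.fadingMGF_le_one hz.le))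
      (Real.rpow_nonneg (zero_le_one.trans (one_le_reuseZ hα hF hνI hz)) _)
  refine integrableOn_of_le_rpow (C := (δ ^ (1 + α / 2))⁻¹) (a := -(2 / α) - 1) ?_ (by linarith)
    (fun z hz => ?_) (fun z hz => ?_)
  · exact (aemeasurable_const.sub hν₀.aemeasurable_fadingMGF).div
      ((aemeasurable_reuseZ hα hF hνI).pow_const _)
  · have hz0 := hz.1
    have hM : 0 ≤ fadingMGF ν₀ z := integral_nonneg fun x => (Real.exp_pos _).le
    have hZ := Real.one_le_rpow (one_le_reuseZ hα hF hνI hz0) (show 0 ≤ 1 + α / 2 by linarith)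
    rw [abs_of_nonneg (hnn z hz0), correctionIntegrand]
    exact (div_le_one (by linarith)).2 (by linarith)
  · have hz1 : 1 < z := hz
    have hz0 : 0 < z := zero_lt_one.trans hz1
    have hM : 0 ≤ fadingMGF ν₀ z := integral_nonneg fun x => (Real.exp_pos _).le
    have hzp : 0 < z ^ (2 / α) := Real.rpow_pos_of_pos hz0 _
    have e : (δ ^ (1 + α / 2))⁻¹ * z ^ (-(2 / α) - 1) = 1 / (δ * z ^ (2 / α)) ^ (1 + α / 2) := by
      rw [Real.mul_rpow hδ.le hzp.le, ← Real.rpow_mul hz0.le, one_div, mul_inv,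
        ← Real.rpow_neg hz0.le]
      congr 2
      have : α ≠ 0 := by linarith
      field_simp
      ring
    rw [abs_of_nonneg (hnn z hz0), e, correctionIntegrand]
    exact div_le_div₀ zero_le_one (by linarith) (by positivity)
      (Real.rpow_le_rpow (by positivity) (hle z hz1.le) (by linarith))

/-- The rate as an integral with values in `[0, ∞]`. -/
noncomputable def rateIntegral (α c σ : ℝ) (M₀ Z : ℝ → ℝ) : ℝ≥0∞ :=
  ∫⁻ z in Ioi (0 : ℝ), ENNReal.ofReal ((1 - M₀ z) / z) * rateWeight α c σ (Z z) z

/-- Noise only decreases the weight, which is `1 / Z` without it. -/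
lemma rateIntegral_le (hα : 2 < α) (hF : 1 ≤ F) (hν₀ : IsFadingLaw ν₀) (hνI : IsFadingLaw νI)
    {c σ : ℝ} (hc : 0 < c) (hσ : 0 ≤ σ) :
    rateIntegral α c σ (fadingMGF ν₀) (reuseZ α F νI) ≤
      ENNReal.ofReal (limitRate (fadingMGF ν₀) (reuseZ α F νI)) := by
  have hnn : ∀ z ∈ Ioi (0 : ℝ), 0 ≤ limitIntegrand (fadingMGF ν₀) (reuseZ α F νI) z := fun z hz =>
    mul_nonneg (div_nonneg (sub_nonneg.2 (hν₀.fadingMGF_le_one (le_of_lt hz.out)))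
      (zero_le_one.trans (one_le_reuseZ hα hF hνI hz))) (one_div_nonneg.2 (le_of_lt hz.out))
  rw [limitRate, ofReal_integral_eq_lintegral_ofReal (integrableOn_limitIntegrand hα hF hν₀ hνI)
    ((ae_restrict_iff' measurableSet_Ioi).2 (ae_of_all _ hnn))]
  refine setLIntegral_mono' measurableSet_Ioi fun z hz => ?_
  have hz : 0 < z := hz
  have hZ := one_le_reuseZ hα hF hνI hz
  rw [limitIntegrand_eq, ENNReal.ofReal_mul
    (div_nonneg (sub_nonneg.2 (hν₀.fadingMGF_le_one hz.le)) hz.le)]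
  exact mul_le_mul_right (rateWeight_le hc (by linarith) hσ hz.le) _

lemma rateIntegral_zero_noise (hα : 2 < α) (hF : 1 ≤ F) (hν₀ : IsFadingLaw ν₀)
    (hνI : IsFadingLaw νI) {c : ℝ} (hc : 0 < c) :
    rateIntegral α c 0 (fadingMGF ν₀) (reuseZ α F νI) =
      ENNReal.ofReal (limitRate (fadingMGF ν₀) (reuseZ α F νI)) := by
  have hnn : ∀ z ∈ Ioi (0 : ℝ), 0 ≤ limitIntegrand (fadingMGF ν₀) (reuseZ α F νI) z := fun z hz =>
    mul_nonneg (div_nonneg (sub_nonneg.2 (hν₀.fadingMGF_le_one (le_of_lt hz.out)))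
      (zero_le_one.trans (one_le_reuseZ hα hF hνI hz))) (one_div_nonneg.2 (le_of_lt hz.out))
  rw [limitRate, ofReal_integral_eq_lintegral_ofReal (integrableOn_limitIntegrand hα hF hν₀ hνI)
    ((ae_restrict_iff' measurableSet_Ioi).2 (ae_of_all _ hnn))]
  refine setLIntegral_congr_fun measurableSet_Ioi fun z hz => ?_
  have hz : 0 < z := hz
  have hZ := one_le_reuseZ hα hF hνI hz
  simp only [limitIntegrand_eq, ENNReal.ofReal_mul
    (div_nonneg (sub_nonneg.2 (hν₀.fadingMGF_le_one hz.le)) hz.le)]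
  rw [rateWeight_zero_noise hc (by linarith)]

end Bounds

end Downlink

/-! ### From the network to the rate integral -/

namespace Downlink

namespace Network

variable {lam : ℝ} {F : ℕ} {ν₀ νI : Measure ℝ} (N : Network.{u} lam F ν₀ νI)

/-- Without noise the transform is `E[e^(-zS)] = F / Z(z)`. For `z > 0` the integrand vanishes where
`S = ∞`, so `P(S < ∞) ≥ F / Z(z)`, and this tends to 1 as `z → 0` because `Z(z) ≤ F + C z`. -/
lemma ae_relativeInterference_ne_top {α : ℝ} (hα : 2 < α) (hF : 1 ≤ F) (hνI : IsFadingLaw νI)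
    (hlam : 0 < lam) : ∀ᵐ ω ∂N.P, N.relativeInterference α ω ≠ ∞ := by
  have hF0 : (0 : ℝ) < F := by exact_mod_cast hF
  have hS := N.measurable_relativeInterference α
  have hm : MeasurableSet {ω | N.relativeInterference α ω ≠ ∞} :=
    (hS (measurableSet_singleton ∞)).compl
  obtain ⟨C, hC, hle⟩ := exists_integralZ_le (F := F) hα hνI
  have key : ∀ z : ℝ, 0 < z →
      (F : ℝ≥0∞) ≤ N.P {ω | N.relativeInterference α ω ≠ ∞} * (F + ENNReal.ofReal z * C) := by
    intro z hz
    have hZ := one_le_reuseZ hα hF hνI hz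
    have h := N.lintegral_noise_interference hα hF hνI hlam le_rfl hz
    rw [rateWeight_zero_noise (by positivity) (by linarith)] at h
    have h1 : (F : ℝ≥0∞) * ENNReal.ofReal (1 / reuseZ α F νI z) ≤
        N.P {ω | N.relativeInterference α ω ≠ ∞} := by
      rw [← h, ← lintegral_indicator_one hm]
      refine lintegral_mono fun ω => ?_
      by_cases hω : N.relativeInterference α ω = ∞
      · simp [hω, hz]
      · rw [indicator_of_mem hω]
        exact mul_le_one' (expNeg_le_one _) (expNeg_le_one _)
    refine le_trans ?_ (mul_le_mul' h1 (hle z hz.le))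
    rw [← ofReal_reuseZ hα hF hνI hz, mul_assoc, ← ENNReal.ofReal_mul (by positivity),
      one_div_mul_cancel (by linarith), ENNReal.ofReal_one, mul_one]
  have hlim : Tendsto (fun n : ℕ => N.P {ω | N.relativeInterference α ω ≠ ∞} *
      (F + ENNReal.ofReal (1 / ((n : ℝ) + 1)) * C)) atTop
      (𝓝 (N.P {ω | N.relativeInterference α ω ≠ ∞} * (F + ENNReal.ofReal 0 * C))) := by
    refine ENNReal.Tendsto.const_mul (tendsto_const_nhds.add (ENNReal.Tendsto.mul_const
      (ENNReal.tendsto_ofReal tendsto_one_div_add_atTop_nhds_zero_nat) (Or.inr hC)))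
      (Or.inr (measure_ne_top _ _))
  have h2 := ge_of_tendsto' hlim fun n => key _ (by positivity)
  rw [ENNReal.ofReal_zero, zero_mul, add_zero] at h2
  have h3 : 1 ≤ N.P {ω | N.relativeInterference α ω ≠ ∞} := by
    by_contra hlt
    have hF1 : (F : ℝ≥0∞) ≠ 0 := by exact_mod_cast (by omega : F ≠ 0)
    have := ENNReal.mul_lt_mul_left hF1 (ENNReal.natCast_ne_top F) (not_le.1 hlt)
    rw [one_mul] at this
    exact this.not_ge h2
  exact (mem_ae_iff_prob_eq_one hm).2 (le_antisymm prob_le_one h3)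

/-- The interference from a base station relative to the mean power of the serving link. -/
noncomputable def relativeInterferenceFrom (α : ℝ) (ω : N.Ω) (b : ℕ) : ℝ :=
  if N.servingDist ω < ‖N.X b ω‖ then
    (if N.band b ω = N.servingBand then
      ((N.servingDist ω / ‖N.X b ω‖) ^ 2) ^ (α / 2) * N.g b ω else 0) else 0

lemma sq_rpow_half {t : ℝ} (ht : 0 ≤ t) (α : ℝ) : (t ^ 2) ^ (α / 2) = t ^ α := by
  rw [← Real.rpow_natCast, ← Real.rpow_mul ht]
  congr 1
  push_cast
  ring

lemma interferenceFrom_eq {α p : ℝ} {ω : N.Ω} (hD : 0 < N.servingDist ω) (b : ℕ) :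
    N.interferenceFrom α p ω b =
      p * N.servingDist ω ^ (-α) * N.relativeInterferenceFrom α ω b := by
  rw [interferenceFrom, relativeInterferenceFrom]
  by_cases h1 : N.servingDist ω < ‖N.X b ω‖
  · by_cases h2 : N.band b ω = N.servingBand
    · have hx : 0 < ‖N.X b ω‖ := hD.trans h1
      rw [if_pos ⟨h1, h2⟩, if_pos h1, if_pos h2, sq_rpow_half (by positivity),
        Real.div_rpow hD.le hx.le, Real.rpow_neg hx.le, Real.rpow_neg hD.le]
      have := Real.rpow_pos_of_pos hD α
      field_simp
    · rw [if_neg (fun h => h2 h.2), if_pos h1, if_neg h2, mul_zero]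
  · rw [if_neg (fun h => h1 h.1), if_neg h1, mul_zero]

lemma relativeInterferenceFrom_nonneg {α : ℝ} {ω : N.Ω} (hg : ∀ b, 0 ≤ N.g b ω) (b : ℕ) :
    0 ≤ N.relativeInterferenceFrom α ω b := by
  rw [relativeInterferenceFrom]
  have := hg b
  split_ifs <;> positivity

lemma relativeInterference_eq_tsum (α : ℝ) (ω : N.Ω) :
    N.relativeInterference α ω = ∑' b, ENNReal.ofReal (N.relativeInterferenceFrom α ω b) := by
  rw [relativeInterference, relInterference]
  refine tsum_congr fun b => ?_
  rw [relativeInterferenceFrom]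
  by_cases h1 : N.servingDist ω < ‖N.X b ω‖
  · rw [if_pos h1, if_pos (by exact h1)]
    split_ifs
    · rfl
    · exact ENNReal.ofReal_zero.symm
  · rw [if_neg h1, if_neg (by exact h1), ENNReal.ofReal_zero]

lemma summable_relativeInterferenceFrom {α : ℝ} {ω : N.Ω} (hg : ∀ b, 0 ≤ N.g b ω)
    (hS : N.relativeInterference α ω ≠ ∞) : Summable (N.relativeInterferenceFrom α ω) := by
  rw [relativeInterference_eq_tsum] at hS
  have := ENNReal.summable_toReal hS
  simpa only [ENNReal.toReal_ofReal (N.relativeInterferenceFrom_nonneg hg _)] using this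

lemma interference_eq {α p : ℝ} {ω : N.Ω} (hD : 0 < N.servingDist ω) (hg : ∀ b, 0 ≤ N.g b ω) :
    N.interference α p ω =
      p * N.servingDist ω ^ (-α) * (N.relativeInterference α ω).toReal := by
  rw [interference, relativeInterference_eq_tsum, ENNReal.tsum_toReal_eq fun b => ENNReal.ofReal_ne_top]
  simp_rw [N.interferenceFrom_eq hD, ENNReal.toReal_ofReal (N.relativeInterferenceFrom_nonneg hg _)]
  rw [tsum_mul_left]

/-- Numerator and denominator are divided by `p * D ^ (-α)`, after which the power enters only
through `noise / p`. -/
lemma sinr_eq {α p noise : ℝ} (hp : 0 < p) {ω : N.Ω} (hD : 0 < N.servingDist ω)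
    (hg : ∀ b, 0 ≤ N.g b ω) :
    N.sinr α p noise ω = N.g₀ ω / (noise / p * (N.servingDist ω ^ 2) ^ (α / 2) +
      (N.relativeInterference α ω).toReal) := by
  have hd := Real.rpow_pos_of_pos hD α
  have hne : p * N.servingDist ω ^ (-α) ≠ 0 := (mul_pos hp (Real.rpow_pos_of_pos hD _)).ne'
  rw [sinr, N.interference_eq hD hg, sq_rpow_half hD.le]
  conv_rhs => rw [← mul_div_mul_left _ _ hne]
  congr 1
  · ring
  · rw [mul_add]
    congr 1
    rw [Real.rpow_neg hD.le]
    field_simp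

/-- The logarithm of one plus the signal-to-interference-plus-noise ratio, as an integral. -/
lemma ofReal_log_sinr {α p noise : ℝ} (hp : 0 < p) (hn : 0 ≤ noise) {ω : N.Ω}
    (hD : 0 < N.servingDist ω) (hg : ∀ b, 0 ≤ N.g b ω) (hg₀ : 0 ≤ N.g₀ ω)
    (hS : N.relativeInterference α ω ≠ ∞)
    (hfin : ∫⁻ z in Ioi (0 : ℝ), N.logIntegrand α (noise / p) ω z ≠ ∞) :
    ENNReal.ofReal (Real.log (1 + N.sinr α p noise ω)) =
      ∫⁻ z in Ioi (0 : ℝ), N.logIntegrand α (noise / p) ω z := by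
  rw [N.sinr_eq hp hD hg]
  set S := (N.relativeInterference α ω).toReal with hSdef
  set T := noise / p * (N.servingDist ω ^ 2) ^ (α / 2) with hTdef
  have hS0 : 0 ≤ S := ENNReal.toReal_nonneg
  have hT0 : 0 ≤ T := by positivity
  have h1 : ∫⁻ z in Ioi (0 : ℝ), N.logIntegrand α (noise / p) ω z = ∫⁻ z in Ioi (0 : ℝ),
      ENNReal.ofReal (Real.exp (-(z * (T + S))) * ((1 - Real.exp (-(z * N.g₀ ω))) / z)) := by
    refine setLIntegral_congr_fun measurableSet_Ioi fun z hz => ?_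
    have hz : 0 < z := hz
    have e1 : z * (noise / p) * (N.servingDist ω ^ 2) ^ (α / 2) = z * T := by rw [hTdef]; ring
    have e2 : N.relativeInterference α ω = ENNReal.ofReal S := (ENNReal.ofReal_toReal hS).symm
    simp only [logIntegrand]
    rw [e1, e2, ← ENNReal.ofReal_mul hz.le, expNeg_ofReal (by positivity),
      expNeg_ofReal (by positivity), ← ENNReal.ofReal_mul (Real.exp_pos _).le, ← Real.exp_add,
      mul_comm, ← ENNReal.ofReal_mul (Real.exp_pos _).le]
    congr 3
    ring
  rw [h1] at hfin ⊢
  -- If `T + S = 0`, division by zero makes the SINR and the logarithm zero, whereas the integral is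
  -- infinite unless `g₀ = 0`. Finiteness, `hfin`, leaves only that harmless case.
  rcases (add_nonneg hT0 hS0).eq_or_lt with h0 | h0
  · rcases hg₀.eq_or_lt with h00 | h00
    · simp [← h00]
    · rw [← h0, setLIntegral_exp_eq_top h00] at hfin
      exact absurd rfl hfin
  · exact (setLIntegral_exp_eq_ofReal_log hg₀ h0).symm

lemma ae_g_nonneg (hνI : IsFadingLaw νI) : ∀ᵐ ω ∂N.P, ∀ b, 0 ≤ N.g b ω := by
  rw [ae_all_iff]
  intro b
  refine ae_of_ae_map (p := fun x => 0 ≤ x) (N.measurable_g b).aemeasurable ?_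
  have := hνI.nonneg
  rwa [N.law_g b]

lemma ae_g₀_nonneg (hν₀ : IsFadingLaw ν₀) : ∀ᵐ ω ∂N.P, 0 ≤ N.g₀ ω := by
  refine ae_of_ae_map (p := fun x => 0 ≤ x) N.measurable_g₀.aemeasurable ?_
  have := hν₀.nonneg
  rwa [N.law_g₀]

lemma ae_log_sinr_nonneg {α p noise : ℝ} (hp : 0 < p) (hν₀ : IsFadingLaw ν₀)
    (hνI : IsFadingLaw νI) (hlam : 0 < lam) (hn : 0 ≤ noise) :
    ∀ᵐ ω ∂N.P, 0 ≤ Real.log (1 + N.sinr α p noise ω) := by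
  filter_upwards [N.poisson.ae_iInf_norm_pos hlam, N.ae_g_nonneg hνI, N.ae_g₀_nonneg hν₀]
    with ω h1 h2 h3
  rw [N.sinr_eq hp h1 h2]
  refine Real.log_nonneg (le_add_of_nonneg_right (div_nonneg h3 ?_))
  positivity

lemma aemeasurable_sinr {α p noise : ℝ} (hp : 0 < p) (hνI : IsFadingLaw νI) (hlam : 0 < lam) :
    AEMeasurable (N.sinr α p noise) N.P := by
  have hD := N.measurable_servingDist
  have hS := N.measurable_relativeInterference α
  refine ⟨fun ω => N.g₀ ω / (noise / p * (N.servingDist ω ^ 2) ^ (α / 2) +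
      (N.relativeInterference α ω).toReal), ?_, ?_⟩
  · exact N.measurable_g₀.div ((((hD.pow_const 2).pow_const _).const_mul _).add hS.ennreal_toReal)
  · filter_upwards [N.poisson.ae_iInf_norm_pos hlam, N.ae_g_nonneg hνI] with ω h1 h2
    exact N.sinr_eq hp h1 h2

section Rate

variable {α p noise : ℝ} (hα : 2 < α) (hp : 0 < p) (hF : 1 ≤ F) (hν₀ : IsFadingLaw ν₀)
  (hνI : IsFadingLaw νI) (hlam : 0 < lam) (hn : 0 ≤ noise)

include hα hp hF hν₀ hνI hlam hn

lemma lintegral_logIntegrand_eq :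
    ∫⁻ ω, (∫⁻ z in Ioi (0 : ℝ), N.logIntegrand α (noise / p) ω z) ∂N.P =
      F * rateIntegral α (Real.pi * (lam / F)) (noise / p) (fadingMGF ν₀) (reuseZ α F νI) :=
  N.lintegral_logIntegrand hα hF hν₀ hνI hlam (div_nonneg hn hp.le)

lemma lintegral_logIntegrand_ne_top :
    ∫⁻ ω, (∫⁻ z in Ioi (0 : ℝ), N.logIntegrand α (noise / p) ω z) ∂N.P ≠ ∞ := by
  have hF0 : (0 : ℝ) < F := by exact_mod_cast hF
  rw [N.lintegral_logIntegrand_eq hα hp hF hν₀ hνI hlam hn]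
  exact ENNReal.mul_ne_top (ENNReal.natCast_ne_top F) ((rateIntegral_le hα hF hν₀ hνI
    (by positivity) (div_nonneg hn hp.le)).trans_lt ENNReal.ofReal_lt_top).ne

lemma ae_ofReal_log_sinr : ∀ᵐ ω ∂N.P, ENNReal.ofReal (Real.log (1 + N.sinr α p noise ω)) =
    ∫⁻ z in Ioi (0 : ℝ), N.logIntegrand α (noise / p) ω z := by
  have hm : Measurable fun ω => ∫⁻ z in Ioi (0 : ℝ), N.logIntegrand α (noise / p) ω z :=
    (N.measurable_logIntegrand α (noise / p)).lintegral_prod_right'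
  filter_upwards [N.poisson.ae_iInf_norm_pos hlam, N.ae_g_nonneg hνI, N.ae_g₀_nonneg hν₀,
    N.ae_relativeInterference_ne_top hα hF hνI hlam,
    ae_lt_top hm (N.lintegral_logIntegrand_ne_top hα hp hF hν₀ hνI hlam hn)] with ω h1 h2 h3 h4 h5
  exact N.ofReal_log_sinr hp hn h1 h2 h3 h4 h5.ne

/-- The series converges because its relative version has finite sum almost surely. The expectation
is finite because it equals `F * rateIntegral`, which `rateIntegral_le` bounds. -/
lemma rateWellDefined : N.RateWellDefined α p noise := by
  refine ⟨?_, ?_, ?_⟩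
  · filter_upwards [N.poisson.ae_iInf_norm_pos hlam, N.ae_g_nonneg hνI,
      N.ae_relativeInterference_ne_top hα hF hνI hlam] with ω h1 h2 h3
    have := (N.summable_relativeInterferenceFrom h2 h3).mul_left (p * N.servingDist ω ^ (-α))
    exact this.congr fun b => (N.interferenceFrom_eq h1 b).symm
  · exact (Real.measurable_log.comp_aemeasurable ((N.aemeasurable_sinr hp hνI hlam).const_add 1)).aestronglyMeasurable
  · rw [hasFiniteIntegral_iff_ofReal (N.ae_log_sinr_nonneg hp hν₀ hνI hlam hn),
      lintegral_congr_ae (N.ae_ofReal_log_sinr hα hp hF hν₀ hνI hlam hn)]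
    exact lt_top_iff_ne_top.2 (N.lintegral_logIntegrand_ne_top hα hp hF hν₀ hνI hlam hn)

/-- The average rate as an integral. -/
lemma avgRate_eq : N.avgRate α p noise =
    (rateIntegral α (Real.pi * (lam / F)) (noise / p) (fadingMGF ν₀) (reuseZ α F νI)).toReal := by
  have hF0 : (F : ℝ) ≠ 0 := by exact_mod_cast (by omega : F ≠ 0)
  rw [avgRate, integral_eq_lintegral_of_nonneg_ae
    (N.ae_log_sinr_nonneg hp hν₀ hνI hlam hn)
    (N.rateWellDefined hα hp hF hν₀ hνI hlam hn).2.aestronglyMeasurable,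
    lintegral_congr_ae (N.ae_ofReal_log_sinr hα hp hF hν₀ hνI hlam hn),
    N.lintegral_logIntegrand_eq hα hp hF hν₀ hνI hlam hn, ENNReal.toReal_mul,
    ENNReal.toReal_natCast, ← mul_assoc, one_div_mul_cancel hF0, one_mul]

end Rate

end Network

end Downlink

/-! ### The weight `G_I` and the real-valued rate formulas -/

namespace Downlink

section Weight

variable {α c σ Z z : ℝ}

lemma integrableOn_rateWeight (hc : 0 < c) (hZ : 0 < Z) (hσz : 0 ≤ σ * z) :
    IntegrableOn (fun ξ => c * (Real.exp (-(c * Z * ξ)) * Real.exp (-(σ * z * ξ ^ (α / 2)))))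
      (Ioi 0) := by
  refine Integrable.mono' ((exp_neg_integrableOn_Ioi 0 (mul_pos hc hZ)).const_mul c)
    (by fun_prop) ((ae_restrict_iff' measurableSet_Ioi).2 (ae_of_all _ fun ξ hξ => ?_))
  have hξ : 0 < ξ := hξ
  rw [Real.norm_eq_abs, abs_of_nonneg (by positivity), neg_mul]
  refine mul_le_mul_of_nonneg_left (mul_le_of_le_one_right (Real.exp_pos _).le ?_) hc.le
  rw [Real.exp_le_one_iff, neg_nonpos]
  positivity

lemma rateWeight_eq_ofReal (hc : 0 < c) (hZ : 0 < Z) (hσz : 0 ≤ σ * z) :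
    rateWeight α c σ Z z = ENNReal.ofReal (∫ ξ in Ioi (0 : ℝ),
      c * (Real.exp (-(c * Z * ξ)) * Real.exp (-(σ * z * ξ ^ (α / 2))))) := by
  rw [rateWeight, ofReal_integral_eq_lintegral_ofReal (integrableOn_rateWeight hc hZ hσz)]
  exact ae_of_all _ fun ξ => by positivity

lemma integrableOn_rpow_mul_exp {a r : ℝ} (ha : 0 < a) (hr : 0 < r) :
    IntegrableOn (fun ξ : ℝ => ξ ^ (a - 1) * Real.exp (-(r * ξ))) (Ioi 0) := by
  have := integrableOn_rpow_mul_exp_neg_mul_rpow (p := 1) (s := a - 1) (b := r) (by linarith)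
    one_pos hr
  simpa only [Real.rpow_one, neg_mul] using this

/-- The integral of the derivative of `exp (-A ξ - y ξ^(α/2))`. -/
lemma integral_exp_mul_exp_rpow {A y : ℝ} (hα : 2 < α) (hA : 0 < A) (hy : 0 ≤ y) :
    IntegrableOn (fun ξ : ℝ => ξ ^ (α / 2 - 1) * Real.exp (-(A * ξ)) *
      Real.exp (-(y * ξ ^ (α / 2)))) (Ioi 0) ∧
    A * (∫ ξ in Ioi (0 : ℝ), Real.exp (-(A * ξ)) * Real.exp (-(y * ξ ^ (α / 2)))) +
      y * (α / 2) * (∫ ξ in Ioi (0 : ℝ), ξ ^ (α / 2 - 1) * Real.exp (-(A * ξ)) *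
        Real.exp (-(y * ξ ^ (α / 2)))) = 1 := by
  have hβ : 0 < α / 2 := by linarith
  have hle : ∀ ξ ∈ Ioi (0 : ℝ), Real.exp (-(y * ξ ^ (α / 2))) ≤ 1 := fun ξ hξ => by
    have hξ : 0 < ξ := hξ
    rw [Real.exp_le_one_iff, neg_nonpos]
    positivity
  have h1 : IntegrableOn (fun ξ : ℝ => ξ ^ (α / 2 - 1) * Real.exp (-(A * ξ)) *
      Real.exp (-(y * ξ ^ (α / 2)))) (Ioi 0) := by
    refine Integrable.mono' (integrableOn_rpow_mul_exp hβ hA) (by fun_prop)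
      ((ae_restrict_iff' measurableSet_Ioi).2 (ae_of_all _ fun ξ hξ => ?_))
    have hξ' : 0 < ξ := hξ
    rw [Real.norm_eq_abs, abs_of_nonneg (by positivity)]
    exact mul_le_of_le_one_right (by positivity) (hle ξ hξ)
  have h2 : IntegrableOn (fun ξ : ℝ => Real.exp (-(A * ξ)) * Real.exp (-(y * ξ ^ (α / 2))))
      (Ioi 0) := by
    have := integrableOn_rateWeight (α := α) (c := 1) (Z := A) (σ := y) (z := 1) one_pos hA
      (by simpa using hy)
    simpa using this
  refine ⟨h1, ?_⟩
  have hcont : Continuous fun ξ : ℝ => -(Real.exp (-(A * ξ)) * Real.exp (-(y * ξ ^ (α / 2)))) := by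
    have : Continuous fun ξ : ℝ => ξ ^ (α / 2) := Real.continuous_rpow_const hβ.le
    fun_prop
  have hder : ∀ ξ ∈ Ioi (0 : ℝ), HasDerivAt
      (fun ξ : ℝ => -(Real.exp (-(A * ξ)) * Real.exp (-(y * ξ ^ (α / 2)))))
      (A * (Real.exp (-(A * ξ)) * Real.exp (-(y * ξ ^ (α / 2)))) +
        y * (α / 2) * (ξ ^ (α / 2 - 1) * Real.exp (-(A * ξ)) * Real.exp (-(y * ξ ^ (α / 2))))) ξ := by
    intro ξ hξ
    have hξ : 0 < ξ := hξ
    have d1 : HasDerivAt (fun ξ : ℝ => Real.exp (-(A * ξ))) (Real.exp (-(A * ξ)) * -(A * 1)) ξ :=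
      (((hasDerivAt_id ξ).const_mul A).neg).exp
    have d2 : HasDerivAt (fun ξ : ℝ => Real.exp (-(y * ξ ^ (α / 2))))
        (Real.exp (-(y * ξ ^ (α / 2))) * -(y * (α / 2 * ξ ^ (α / 2 - 1)))) ξ :=
      (((Real.hasDerivAt_rpow_const (Or.inl hξ.ne')).const_mul y).neg).exp
    have := (d1.mul d2).neg
    convert! this using 1
    ring
  have hlim : Tendsto (fun ξ : ℝ => -(Real.exp (-(A * ξ)) * Real.exp (-(y * ξ ^ (α / 2)))))
      atTop (𝓝 0) := by
    have h3 : Tendsto (fun ξ : ℝ => Real.exp (-(A * ξ))) atTop (𝓝 0) :=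
      Real.tendsto_exp_neg_atTop_nhds_zero.comp (tendsto_id.const_mul_atTop hA)
    rw [← neg_zero]
    refine Tendsto.neg (squeeze_zero' (Eventually.of_forall fun ξ => by positivity) ?_ h3)
    filter_upwards [eventually_gt_atTop 0] with ξ hξ
    exact mul_le_of_le_one_right (Real.exp_pos _).le (hle ξ hξ)
  have h := integral_Ioi_of_hasDerivAt_of_tendsto hcont.continuousWithinAt hder
    ((h2.const_mul A).add (h1.const_mul (y * (α / 2)))) hlim
  rw [integral_add (h2.const_mul A) (h1.const_mul (y * (α / 2))), integral_const_mul,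
    integral_const_mul] at h
  rw [h]
  simp [Real.zero_rpow hβ.ne']

/-- The weight of the general rate formula as an integral. -/
lemma weightG_eq {lam snr y : ℝ} {Z : ℝ → ℝ} (hα : 2 < α) (hlam : 0 < lam) (hsnr : 0 < snr)
    (hy : 0 < y) (hZ : 0 < Z (snr * y)) :
    weightG α lam snr Z y = ∫ ξ in Ioi (0 : ℝ), Real.pi * lam *
      (Real.exp (-(Real.pi * lam * Z (snr * y) * ξ)) *
        Real.exp (-(1 / snr * (snr * y) * ξ ^ (α / 2)))) := by
  have hA : 0 < Real.pi * lam * Z (snr * y) := by positivity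
  have h := (integral_exp_mul_exp_rpow hα hA hy.le).2
  have e : 1 / snr * (snr * y) = y := by field_simp
  rw [e, integral_const_mul, weightG]
  simp only [innerIntegrand]
  set I := ∫ ξ in Ioi (0 : ℝ), ξ ^ (α / 2 - 1) *
    Real.exp (-(Real.pi * lam * Z (snr * y) * ξ)) * Real.exp (-(y * ξ ^ (α / 2)))
  set J := ∫ ξ in Ioi (0 : ℝ), Real.exp (-(Real.pi * lam * Z (snr * y) * ξ)) *
    Real.exp (-(y * ξ ^ (α / 2)))
  -- The exact-derivative identity `A J + y (α/2) I = 1`, with `A = πλ Z`, trades the integral `I`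
  -- in `G_I` for `J`; then `(1 - y (α/2) I) / Z = πλ J`.
  have h' : y * (α / 2) * I = 1 - Real.pi * lam * Z (snr * y) * J := by linarith
  have : α / 2 * (y / Z (snr * y)) * I = (y * (α / 2) * I) / Z (snr * y) := by ring
  rw [this, h']
  field_simp
  ring

/-- The lower bound `exp (-t) ≥ 1 - t` for the noise. -/
lemma le_integral_rateWeight (hα : 2 < α) (hc : 0 < c) (hZ : 0 < Z) (hσz : 0 ≤ σ * z) :
    1 / Z - c ^ (-(α / 2)) * Real.Gamma (1 + α / 2) * (σ * z) / Z ^ (1 + α / 2) ≤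
      ∫ ξ in Ioi (0 : ℝ),
        c * (Real.exp (-(c * Z * ξ)) * Real.exp (-(σ * z * ξ ^ (α / 2)))) := by
  have hA : 0 < c * Z := mul_pos hc hZ
  have i1 := exp_neg_integrableOn_Ioi 0 hA
  have i2 := integrableOn_rpow_mul_exp (a := 1 + α / 2) (by linarith) hA
  have v1 := integral_exp_mul_Ioi (a := -(c * Z)) (by linarith) 0
  have v2 := Real.integral_rpow_mul_exp_neg_mul_Ioi (a := 1 + α / 2) (r := c * Z) (by linarith) hA
  -- The linearized noise factor integrates explicitly: `∫ e^(-cZξ) dξ = 1 / (cZ)` and `∫ ξ^(α/2)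
  -- e^(-cZξ) dξ = Γ(1 + α/2) / (cZ)^(1+α/2)`.
  have e : 1 / Z - c ^ (-(α / 2)) * Real.Gamma (1 + α / 2) * (σ * z) / Z ^ (1 + α / 2) =
      ∫ ξ in Ioi (0 : ℝ), (c * Real.exp (-(c * Z) * ξ) -
        c * (σ * z) * (ξ ^ (1 + α / 2 - 1) * Real.exp (-(c * Z * ξ)))) := by
    rw [integral_sub (i1.const_mul c) (i2.const_mul _), integral_const_mul, integral_const_mul,
      v1, v2, one_div (c * Z), Real.inv_rpow hA.le, Real.mul_rpow hc.le hZ.le, Real.rpow_add hc,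
      Real.rpow_one, Real.rpow_neg hc.le]
    have h1 := Real.rpow_pos_of_pos hc (α / 2)
    have h2 := Real.rpow_pos_of_pos hZ (1 + α / 2)
    simp only [mul_zero, Real.exp_zero]
    field_simp
  rw [e]
  refine setIntegral_mono_on ((i1.const_mul c).sub (i2.const_mul _))
    (integrableOn_rateWeight hc hZ hσz) measurableSet_Ioi fun ξ hξ => ?_
  have hξ : 0 < ξ := hξ
  have h := Real.add_one_le_exp (-(σ * z * ξ ^ (α / 2)))
  have h3 := mul_le_mul_of_nonneg_left h (mul_nonneg hc.le (Real.exp_pos (-(c * Z * ξ))).le)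
  have e3 : 1 + α / 2 - 1 = α / 2 := by ring
  rw [e3, neg_mul]
  linarith

end Weight

section Rate

variable {α : ℝ} {F : ℕ} {ν₀ νI : Measure ℝ}

/-- A measurable version of the density of `rateIntegral`. -/
noncomputable def rateDensity (α : ℝ) (F : ℕ) (ν₀ νI : Measure ℝ) (c σ z : ℝ) : ℝ≥0∞ :=
  ENNReal.ofReal ((1 - (laplace ν₀ z).toReal) / z) *
    rateWeight α c σ (integralZ α F νI z).toReal z

variable (hα : 2 < α) (hF : 1 ≤ F) (hν₀ : IsFadingLaw ν₀) (hνI : IsFadingLaw νI)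
  {c σ : ℝ} (hc : 0 < c) (hσ : 0 ≤ σ)

include hν₀ hνI in
lemma measurable_rateDensity : Measurable (rateDensity α F ν₀ νI c σ) := by
  have hL := hν₀.continuous_laplace.measurable
  have hZ := measurable_integralZ (α := α) (F := F) hνI
  have hZ' : Measurable fun p : ℝ × ℝ => (integralZ α F νI p.1).toReal :=
    (hZ.comp measurable_fst).ennreal_toReal
  refine Measurable.mul (by fun_prop) (Measurable.lintegral_prod_right' (f := fun p : ℝ × ℝ =>
    ENNReal.ofReal (c * (Real.exp (-(c * (integralZ α F νI p.1).toReal * p.2)) *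
      Real.exp (-(σ * p.1 * p.2 ^ (α / 2)))))) ?_)
  fun_prop

include hα hF hν₀ hνI in
lemma rateDensity_eq {z : ℝ} (hz : 0 < z) : rateDensity α F ν₀ νI c σ z =
    ENNReal.ofReal ((1 - fadingMGF ν₀ z) / z) * rateWeight α c σ (reuseZ α F νI z) z := by
  have hM : 0 ≤ fadingMGF ν₀ z := integral_nonneg fun x => (Real.exp_pos _).le
  rw [rateDensity, ← hν₀.ofReal_fadingMGF hz.le, ENNReal.toReal_ofReal hM,
    ← ofReal_reuseZ hα hF hνI hz,
    ENNReal.toReal_ofReal (zero_le_one.trans (one_le_reuseZ hα hF hνI hz))]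

include hα hF hν₀ hνI in
lemma lintegral_rateDensity : ∫⁻ z in Ioi (0 : ℝ), rateDensity α F ν₀ νI c σ z =
    rateIntegral α c σ (fadingMGF ν₀) (reuseZ α F νI) :=
  setLIntegral_congr_fun measurableSet_Ioi fun _ hz => rateDensity_eq hα hF hν₀ hνI hz

include hα hF hν₀ hνI hc hσ

lemma rateIntegral_ne_top : rateIntegral α c σ (fadingMGF ν₀) (reuseZ α F νI) ≠ ∞ :=
  ((rateIntegral_le hα hF hν₀ hνI hc hσ).trans_lt ENNReal.ofReal_lt_top).ne

lemma rateDensity_ne_top {z : ℝ} (hz : 0 < z) : rateDensity α F ν₀ νI c σ z ≠ ∞ := by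
  rw [rateDensity_eq hα hF hν₀ hνI hz]
  exact ENNReal.mul_ne_top ENNReal.ofReal_ne_top ((rateWeight_le hc (zero_lt_one.trans_le
    (one_le_reuseZ hα hF hνI hz)) hσ hz.le).trans_lt ENNReal.ofReal_lt_top).ne

lemma toReal_rateDensity {z : ℝ} (hz : 0 < z) : (rateDensity α F ν₀ νI c σ z).toReal =
    (1 - fadingMGF ν₀ z) / z * ∫ ξ in Ioi (0 : ℝ),
      c * (Real.exp (-(c * reuseZ α F νI z * ξ)) * Real.exp (-(σ * z * ξ ^ (α / 2)))) := by
  rw [rateDensity_eq hα hF hν₀ hνI hz, rateWeight_eq_ofReal hc (zero_lt_one.trans_le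
    (one_le_reuseZ hα hF hνI hz)) (mul_nonneg hσ hz.le), ENNReal.toReal_mul,
    ENNReal.toReal_ofReal (div_nonneg (sub_nonneg.2 (hν₀.fadingMGF_le_one hz.le)) hz.le),
    ENNReal.toReal_ofReal (integral_nonneg fun ξ => by positivity)]

lemma integrableOn_toReal_rateDensity :
    IntegrableOn (fun z => (rateDensity α F ν₀ νI c σ z).toReal) (Ioi 0) := by
  refine integrable_toReal_of_lintegral_ne_top (measurable_rateDensity hν₀ hνI).aemeasurable ?_
  rw [lintegral_rateDensity hα hF hν₀ hνI]
  exact rateIntegral_ne_top hα hF hν₀ hνI hc hσ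

lemma integral_toReal_rateDensity : ∫ z in Ioi (0 : ℝ), (rateDensity α F ν₀ νI c σ z).toReal =
    (rateIntegral α c σ (fadingMGF ν₀) (reuseZ α F νI)).toReal := by
  rw [integral_toReal (measurable_rateDensity hν₀ hνI).aemeasurable,
    lintegral_rateDensity hα hF hν₀ hνI]
  exact (ae_restrict_iff' measurableSet_Ioi).2 (ae_of_all _ fun z hz =>
    lt_top_iff_ne_top.2 (rateDensity_ne_top hα hF hν₀ hνI hc hσ hz))

omit hc hσ

variable {lam snr : ℝ} (hlam : 0 < lam) (hsnr : 0 < snr)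

include hlam hsnr

/-- The substitution `z = snr * y`: the factor `snr` is its Jacobian, and `σ = 1 / snr` makes the
noise exponent `σ z = y`. -/
lemma rateIntegrand_eq {y : ℝ} (hy : 0 < y) :
    rateIntegrand α lam snr (fadingMGF ν₀) (reuseZ α F νI) y =
      snr * (rateDensity α F ν₀ νI (Real.pi * lam) (1 / snr) (snr * y)).toReal := by
  have hz : 0 < snr * y := mul_pos hsnr hy
  rw [toReal_rateDensity hα hF hν₀ hνI (by positivity) (by positivity) hz, rateIntegrand,
    weightG_eq hα hlam hsnr hy (zero_lt_one.trans_le (one_le_reuseZ hα hF hνI hz))]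
  field_simp

lemma integrableOn_rateIntegrand :
    IntegrableOn (rateIntegrand α lam snr (fadingMGF ν₀) (reuseZ α F νI)) (Ioi 0) := by
  have h := integrableOn_toReal_rateDensity hα hF hν₀ hνI (c := Real.pi * lam) (σ := 1 / snr)
    (by positivity) (by positivity)
  rw [← mul_zero snr, ← integrableOn_Ioi_comp_mul_left_iff _ _ hsnr] at h
  refine Integrable.congr (h.const_mul snr) ?_
  exact (ae_restrict_iff' measurableSet_Ioi).2 (ae_of_all _ fun y hy =>
    (rateIntegrand_eq hα hF hν₀ hνI hlam hsnr hy).symm)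

/-- The general rate formula. -/
lemma rateFormula_eq : rateFormula α lam snr (fadingMGF ν₀) (reuseZ α F νI) =
    (rateIntegral α (Real.pi * lam) (1 / snr) (fadingMGF ν₀) (reuseZ α F νI)).toReal := by
  rw [← integral_toReal_rateDensity hα hF hν₀ hνI (by positivity) (by positivity), rateFormula,
    setIntegral_congr_fun measurableSet_Ioi
      fun y hy => rateIntegrand_eq hα hF hν₀ hνI hlam hsnr hy, integral_const_mul,
    integral_comp_mul_left_Ioi (fun z => (rateDensity α F ν₀ νI (Real.pi * lam) (1 / snr) z).toReal)
      0 hsnr, mul_zero, smul_eq_mul, mul_inv_cancel_left₀ hsnr.ne']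

/-- The high-SNR lower bound. -/
lemma highSNRRate_le : highSNRRate α lam snr (fadingMGF ν₀) (reuseZ α F νI) ≤
    (rateIntegral α (Real.pi * lam) (1 / snr) (fadingMGF ν₀) (reuseZ α F νI)).toReal := by
  have hc : 0 < Real.pi * lam := by positivity
  have hσ : 0 ≤ 1 / snr := by positivity
  have i1 := integrableOn_limitIntegrand hα hF hν₀ hνI
  have i2 := integrableOn_correctionIntegrand hα hF hν₀ hνI
  rw [← integral_toReal_rateDensity hα hF hν₀ hνI hc hσ, highSNRRate, limitRate,
    ← integral_const_mul, ← integral_sub i1 (i2.const_mul _)]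
  refine setIntegral_mono_on (i1.sub (i2.const_mul _))
    (integrableOn_toReal_rateDensity hα hF hν₀ hνI hc hσ) measurableSet_Ioi fun z hz => ?_
  have hz : 0 < z := hz
  have hZ := zero_lt_one.trans_le (one_le_reuseZ hα hF hνI hz)
  rw [toReal_rateDensity hα hF hν₀ hνI hc hσ hz, limitIntegrand_eq, correctionIntegrand]
  -- The pointwise bound is multiplied by `(1 - M₀(z)) / z`. The factor `z` of the noise correction
  -- cancels, which is why the correction integral carries no `1 / z`.
  have h := mul_le_mul_of_nonneg_left
    (le_integral_rateWeight (α := α) (σ := 1 / snr) (z := z) hα hc hZ (by positivity))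
    (div_nonneg (sub_nonneg.2 (hν₀.fadingMGF_le_one hz.le)) hz.le)
  refine le_trans (le_of_eq ?_) h
  have := Real.rpow_pos_of_pos hZ (1 + α / 2)
  field_simp

end Rate

end Downlink

/-! ### The dense limit and the main theorem -/

namespace Downlink

/-- The density enters the lower bound only through `(πλ / F)^(-α/2)`, which tends to zero; the
lower bound therefore rises to the upper bound. -/
lemma tendsto_highSNRRate {α snr : ℝ} {F : ℕ} (hα : 2 < α) (hF : 1 ≤ F) (M₀ Z : ℝ → ℝ) :
    Tendsto (fun lam : ℝ => highSNRRate α (lam / F) snr M₀ Z) atTop (𝓝 (limitRate M₀ Z)) := by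
  have hF0 : (0 : ℝ) < F := by exact_mod_cast hF
  have h1 : Tendsto (fun lam : ℝ => (Real.pi * (lam / F)) ^ (-(α / 2))) atTop (𝓝 0) :=
    (tendsto_rpow_neg_atTop (show 0 < α / 2 by linarith)).comp
      ((tendsto_id.atTop_div_const hF0).const_mul_atTop Real.pi_pos)
  have h2 := ((((h1.mul_const (Real.Gamma (1 + α / 2))).mul_const (1 / snr)).mul_const
    (∫ z in Ioi (0 : ℝ), correctionIntegrand α M₀ Z z)).const_sub (limitRate M₀ Z))
  simpa [highSNRRate] using h2

end Downlink

theorem corollary5 (α p : ℝ) (hα : 2 < α) (hp : 0 < p) (F : ℕ) (hF : 1 ≤ F)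
    (ν₀ νI : Measure ℝ) (hν₀ : IsFadingLaw ν₀) (hνI : IsFadingLaw νI) :
    -- all the expressions in the formulas converge
    ((∀ y : ℝ, 0 < y → Summable (interferenceTerm α νI y)) ∧
      IntegrableOn (limitIntegrand (fadingMGF ν₀) (reuseZ α F νI)) (Ioi 0) ∧
      IntegrableOn (correctionIntegrand α (fadingMGF ν₀) (reuseZ α F νI)) (Ioi 0) ∧
      ∀ lam snr : ℝ, 0 < lam → 0 < snr →
        (∀ y : ℝ, 0 < y →
          IntegrableOn (innerIntegrand α (lam / F) snr (reuseZ α F νI) y) (Ioi 0)) ∧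
        IntegrableOn (rateIntegrand α (lam / F) snr (fadingMGF ν₀) (reuseZ α F νI)) (Ioi 0)) ∧
    -- the average rate is well defined
    (∀ (lam noise : ℝ), 0 < lam → 0 ≤ noise → ∀ N : Network.{u} lam F ν₀ νI,
      N.RateWellDefined α p noise) ∧
    -- the general formula
    (∀ (lam noise : ℝ), 0 < lam → 0 < noise → ∀ N : Network.{u} lam F ν₀ νI,
      N.avgRate α p noise =
        rateFormula α (lam / F) (p / noise) (fadingMGF ν₀) (reuseZ α F νI)) ∧
    -- the dense-network upper bound, which is the limit for growing density
    (∀ (lam noise : ℝ), 0 < lam → 0 < noise → ∀ N : Network.{u} lam F ν₀ νI,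
      N.avgRate α p noise ≤ limitRate (fadingMGF ν₀) (reuseZ α F νI)) ∧
    (∀ noise : ℝ, 0 < noise → ∀ N : (∀ lam : Ioi (0 : ℝ), Network.{u} (lam : ℝ) F ν₀ νI),
      Tendsto (fun lam => (N lam).avgRate α p noise) atTop
        (𝓝 (limitRate (fadingMGF ν₀) (reuseZ α F νI)))) ∧
    -- the interference-limited case
    (∀ lam : ℝ, 0 < lam → ∀ N : Network.{u} lam F ν₀ νI,
      N.avgRate α p 0 = limitRate (fadingMGF ν₀) (reuseZ α F νI)) ∧
    -- the high-SNR bounds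
    (∀ (lam noise : ℝ), 0 < lam → 0 < noise → ∀ N : Network.{u} lam F ν₀ νI,
      highSNRRate α (lam / F) (p / noise) (fadingMGF ν₀) (reuseZ α F νI) ≤
          N.avgRate α p noise ∧
        N.avgRate α p noise ≤ limitRate (fadingMGF ν₀) (reuseZ α F νI)) := by
  have hF0 : (0 : ℝ) < F := by exact_mod_cast hF
  have hnn : 0 ≤ limitRate (fadingMGF ν₀) (reuseZ α F νI) :=
    setIntegral_nonneg measurableSet_Ioi fun z hz =>
      mul_nonneg (div_nonneg (sub_nonneg.2 (hν₀.fadingMGF_le_one (le_of_lt hz.out)))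
        (zero_le_one.trans (one_le_reuseZ hα hF hνI hz))) (one_div_nonneg.2 (le_of_lt hz.out))
  have upper : ∀ (lam noise : ℝ), 0 < lam → 0 < noise → ∀ N : Network.{u} lam F ν₀ νI,
      N.avgRate α p noise ≤ limitRate (fadingMGF ν₀) (reuseZ α F νI) := by
    intro lam noise hlam hn N
    rw [N.avgRate_eq hα hp hF hν₀ hνI hlam hn.le]
    exact ENNReal.toReal_le_of_le_ofReal hnn
      (rateIntegral_le hα hF hν₀ hνI (by positivity) (by positivity))
  have lower : ∀ (lam noise : ℝ), 0 < lam → 0 < noise → ∀ N : Network.{u} lam F ν₀ νI,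
      highSNRRate α (lam / F) (p / noise) (fadingMGF ν₀) (reuseZ α F νI) ≤
        N.avgRate α p noise := by
    intro lam noise hlam hn N
    rw [N.avgRate_eq hα hp hF hν₀ hνI hlam hn.le, ← one_div_div p noise]
    exact highSNRRate_le hα hF hν₀ hνI (by positivity) (by positivity)
  refine ⟨⟨fun y hy => summable_interferenceTerm hα hνI hy,
    integrableOn_limitIntegrand hα hF hν₀ hνI, integrableOn_correctionIntegrand hα hF hν₀ hνI,
    fun lam snr hlam hsnr => ⟨fun y hy => ?_,
      integrableOn_rateIntegrand hα hF hν₀ hνI (by positivity) hsnr⟩⟩,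
    fun lam noise hlam hn N => N.rateWellDefined hα hp hF hν₀ hνI hlam hn,
    fun lam noise hlam hn N => ?_, upper, fun noise hn N => ?_, fun lam hlam N => ?_,
    fun lam noise hlam hn N => ⟨lower lam noise hlam hn N, upper lam noise hlam hn N⟩⟩
  · have hZ := zero_lt_one.trans_le (one_le_reuseZ hα hF hνI (mul_pos hsnr hy))
    exact (integral_exp_mul_exp_rpow hα
      (show 0 < Real.pi * (lam / F) * reuseZ α F νI (snr * y) by positivity) hy.le).1
  · rw [N.avgRate_eq hα hp hF hν₀ hνI hlam hn.le, ← one_div_div p noise,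
      rateFormula_eq hα hF hν₀ hνI (by positivity) (by positivity)]
  -- Squeeze between the two bounds, which hold for whichever network is chosen at each density.
  · have h := (tendsto_highSNRRate (snr := p / noise) hα hF (fadingMGF ν₀)
      (reuseZ α F νI)).comp ((tendsto_comp_val_Ioi_atTop (a := (0 : ℝ))).2 tendsto_id)
    exact tendsto_of_tendsto_of_tendsto_of_le_of_le h tendsto_const_nhds
      (fun lam => lower lam noise lam.2 hn (N lam)) (fun lam => upper lam noise lam.2 hn (N lam))
  · rw [N.avgRate_eq hα hp hF hν₀ hνI hlam le_rfl, zero_div,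
      rateIntegral_zero_noise hα hF hν₀ hνI (by positivity), ENNReal.toReal_ofReal hnn]
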